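/- Let $\mathbb D$ be the open unit disk in $\mathbb C$, let $0<p\le\infty$ and $0<\alpha<\infty$. For $f$ holomorphic on $\mathbb D$ and $0\le r<1$ put $M_p(r,f)=\left(\int_0^{2\pi}|f(re^{i\theta})|^p\,\frac{d\theta}{2\pi}\right)^{1/p}$ if $p<\infty$ and $M_\infty(r,f)=\max_{\theta}|f(re^{i\theta})|$. Let $H(p,\infty,\alpha)$ be the space of holomorphic $f$ on $\mathbb D$ with $\|f\|_{p,\infty,\alpha}=\sup_{0\le r<1}(1-r)^\alpha M_p(r,f)<\infty$, with the topology given by this norm (a quasi-norm if $p<1$), and let $H(p,0,\alpha)$ be the subspace, with the same (quasi-)norm, of those $f$ with $\lim_{r\to1^-}(1-r)^\alpha M_p(r,f)=0$. The Bloch space $\mathcal B$ consists of the holomorphic $g$ on $\mathbb D$ with $\sup_{z\in\mathbb D}(1-|z|^2)|g'(z)|<\infty$, and the little Bloch space $\mathcal B_0$ of those with $\lim_{|z|\to1^-}(1-|z|^2)|g'(z)|=0$. For $g$ holomorphic on $\mathbb D$ let $T_g(f)(z)=\int_0^z f(\zeta)g'(\zeta)\,d\zeta$. A bounded linear operator $T\colon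 X\to Y$ between quasi-normed spaces is (weakly) compact if it maps the unit ball of $X$ to a relatively compact set for the (weak) topology of $Y$. It fixes a copy of a Banach space $Z$ if $X$ has a subspace $M$ isomorphic to $Z$ such that $T|_M$ is an isomorphism onto its image. Let $g\in\mathcal B$. Then $T_g$ is a bounded linear operator from $H(p,\infty,\alpha)$ to itself and from $H(p,0,\alpha)$ to itself, and the following are equivalent: - (a) $T_g\colon H(p,\infty,\alpha)\to H(p,\infty,\alpha)$ is compact; - (b) $T_g\colon H(p,\infty,\alpha)\to H(p,\infty,\alpha)$ is weakly compact; - (c) $T_g$ maps $H(p,\infty,\alpha)$ boundedly into $H(p,0,\alpha)$; - (d) $T_g\colon H(p,0,\alpha)\to H(p,0,\alpha)$ is compact; - (e) $T_g\colon H(p,0,\alpha)\to H(p,0,\alpha)$ is weakly compact; - (f) $T_g\colon H(p,\infty,\alpha)\to H(p,\infty,\alpha)$ does not fix a copy of $\ell_\infty$; - (g) $T_g\colon H(p,0,\alpha)\to H(p,0,\alpha)$ does not fix a copy of $c_0$; - (h) $g\in\mathcal B_0$. -/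

import Mathlib

open Set Filter Topology MeasureTheory Metric
open scoped ENNReal

noncomputable section

namespace MixedNorm

/-- Normalized Lebesgue measure `dθ / 2π` on `(0, 2π]`. -/
def angleMeasure : Measure ℝ :=
  ENNReal.ofReal (1 / (2 * Real.pi)) • volume.restrict (Ioc 0 (2 * Real.pi))

/-- The integral mean `M_p(r, f)`, i.e. the `L^p(dθ / 2π)` (quasi-)norm of `θ ↦ f (r e^{iθ})`. For
`p = ∞` this is the essential supremum, which is the maximum because only functions that are
continuous on the circle `|z| = r` are considered. -/
def integralMean (p : ℝ≥0∞) (r : ℝ) (f : ℂ → ℂ) : ℝ≥0∞ :=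
  eLpNorm (fun θ : ℝ => f (r * Complex.exp (θ * Complex.I))) p angleMeasure

/-- The (quasi-)norm `sup_{0 ≤ r < 1} (1 - r)^α M_p(r, f)`, with values in `[0, ∞]`. -/
def mixedNorm (p : ℝ≥0∞) (α : ℝ) (f : ℂ → ℂ) : ℝ≥0∞ :=
  ⨆ r ∈ Ico (0 : ℝ) 1, ENNReal.ofReal ((1 - r) ^ α) * integralMean p r f

/-- Holomorphic functions on the open unit disk; such a function is represented by its extension
by zero to `ℂ`, so that equality of representatives is equality on the disk. -/
def IsHolo (f : ℂ → ℂ) : Prop :=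
  DifferentiableOn ℂ f (ball 0 1) ∧ ∀ z ∉ ball (0 : ℂ) 1, f z = 0

theorem IsHolo.aestronglyMeasurable {f : ℂ → ℂ} (hf : IsHolo f) {r : ℝ} (hr : r ∈ Ico (0 : ℝ) 1) :
    AEStronglyMeasurable (fun θ : ℝ => f (r * Complex.exp (θ * Complex.I))) angleMeasure := by
  refine Continuous.aestronglyMeasurable ?_
  refine hf.1.continuousOn.comp_continuous (by fun_prop) fun θ => ?_
  rw [mem_ball_zero_iff, norm_mul, Complex.norm_exp_ofReal_mul_I, mul_one, Complex.norm_real,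
    Real.norm_of_nonneg hr.1]
  exact hr.2

theorem IsHolo.zero : IsHolo 0 := ⟨differentiableOn_const 0, fun _ _ => rfl⟩

theorem IsHolo.add {f g : ℂ → ℂ} (hf : IsHolo f) (hg : IsHolo g) : IsHolo (f + g) :=
  ⟨hf.1.add hg.1, fun z hz => by simp [hf.2 z hz, hg.2 z hz]⟩

theorem IsHolo.smul {f : ℂ → ℂ} (c : ℂ) (hf : IsHolo f) : IsHolo (c • f) :=
  ⟨hf.1.const_smul c, fun z hz => by simp [hf.2 z hz]⟩

theorem integralMean_add_le (p : ℝ≥0∞) {r : ℝ} (hr : r ∈ Ico (0 : ℝ) 1) {f g : ℂ → ℂ}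
    (hf : IsHolo f) (hg : IsHolo g) :
    integralMean p r (f + g) ≤ ENNReal.LpAddConst p * (integralMean p r f + integralMean p r g) :=
  eLpNorm_add_le' (hf.aestronglyMeasurable hr) (hg.aestronglyMeasurable hr) p

theorem integralMean_smul (p : ℝ≥0∞) (r : ℝ) (c : ℂ) (f : ℂ → ℂ) :
    integralMean p r (c • f) = ‖c‖ₑ * integralMean p r f :=
  eLpNorm_const_smul c (fun θ : ℝ => f (r * Complex.exp (θ * Complex.I))) p angleMeasure

theorem le_mixedNorm (p : ℝ≥0∞) (α : ℝ) {r : ℝ} (hr : r ∈ Ico (0 : ℝ) 1) (f : ℂ → ℂ) :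
    ENNReal.ofReal ((1 - r) ^ α) * integralMean p r f ≤ mixedNorm p α f :=
  le_iSup₂ (f := fun r (_ : r ∈ Ico (0 : ℝ) 1) =>
    ENNReal.ofReal ((1 - r) ^ α) * integralMean p r f) r hr

theorem weight_add_le (p : ℝ≥0∞) (α : ℝ) {r : ℝ} (hr : r ∈ Ico (0 : ℝ) 1) {f g : ℂ → ℂ}
    (hf : IsHolo f) (hg : IsHolo g) :
    ENNReal.ofReal ((1 - r) ^ α) * integralMean p r (f + g) ≤
      ENNReal.LpAddConst p * (ENNReal.ofReal ((1 - r) ^ α) * integralMean p r f +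
        ENNReal.ofReal ((1 - r) ^ α) * integralMean p r g) := by
  refine (mul_le_mul_right (integralMean_add_le p hr hf hg) _).trans_eq ?_
  ring

theorem mixedNorm_add_le (p : ℝ≥0∞) (α : ℝ) {f g : ℂ → ℂ} (hf : IsHolo f) (hg : IsHolo g) :
    mixedNorm p α (f + g) ≤ ENNReal.LpAddConst p * (mixedNorm p α f + mixedNorm p α g) := by
  refine iSup₂_le fun r hr => (weight_add_le p α hr hf hg).trans ?_
  gcongr
  · exact le_mixedNorm p α hr f
  · exact le_mixedNorm p α hr g

theorem mixedNorm_smul (p : ℝ≥0∞) (α : ℝ) (c : ℂ) (f : ℂ → ℂ) :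
    mixedNorm p α (c • f) = ‖c‖ₑ * mixedNorm p α f := by
  simp only [mixedNorm, integralMean_smul, ENNReal.mul_iSup]
  exact iSup_congr fun r => iSup_congr fun _ => by ring

theorem integralMean_zero (p : ℝ≥0∞) (r : ℝ) : integralMean p r 0 = 0 := by
  simp [integralMean]

/-- `H(p,∞,α)` as a vector space of functions. -/
def bigO (p : ℝ≥0∞) (α : ℝ) : Submodule ℂ (ℂ → ℂ) where
  carrier := {f | IsHolo f ∧ mixedNorm p α f < ∞}
  zero_mem' := ⟨IsHolo.zero, by simp [mixedNorm, integralMean_zero]⟩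
  add_mem' := fun {f g} hf hg => ⟨hf.1.add hg.1, (mixedNorm_add_le p α hf.1 hg.1).trans_lt
    (ENNReal.mul_lt_top (ENNReal.LpAddConst_lt_top p) (ENNReal.add_lt_top.2 ⟨hf.2, hg.2⟩))⟩
  smul_mem' := fun c f hf => ⟨hf.1.smul c, by
    rw [mixedNorm_smul]; exact ENNReal.mul_lt_top enorm_lt_top hf.2⟩

/-- `H(p,0,α)` as a vector space of functions: those `f` in `H(p,∞,α)` such that
`(1 - r)^α M_p(r, f) → 0` as `r → 1⁻`. -/
def littleO (p : ℝ≥0∞) (α : ℝ) : Submodule ℂ (ℂ → ℂ) where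
  carrier := {f | f ∈ bigO p α ∧
    Tendsto (fun r : ℝ => ENNReal.ofReal ((1 - r) ^ α) * integralMean p r f) (𝓝[<] 1) (𝓝 0)}
  zero_mem' := ⟨(bigO p α).zero_mem, by simp [integralMean_zero]⟩
  add_mem' := fun {f g} hf hg => ⟨(bigO p α).add_mem hf.1 hg.1, by
    have h := ENNReal.Tendsto.const_mul (a := ENNReal.LpAddConst p) (hf.2.add hg.2)
      (Or.inr (ENNReal.LpAddConst_lt_top p).ne)
    simp only [add_zero, mul_zero] at h
    refine tendsto_of_tendsto_of_tendsto_of_le_of_le' tendsto_const_nhds h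
      (Eventually.of_forall fun _ => zero_le) ?_
    filter_upwards [Ico_mem_nhdsLT (zero_lt_one' ℝ)] with r hr
    exact weight_add_le p α hr hf.1.1 hg.1.1⟩
  smul_mem' := fun c f hf => ⟨(bigO p α).smul_mem c hf.1, by
    have h := ENNReal.Tendsto.const_mul (a := ‖c‖ₑ) hf.2 (Or.inr enorm_ne_top)
    rw [mul_zero] at h
    refine h.congr fun r => ?_
    rw [integralMean_smul]
    ring⟩

/-- A space of functions `S`, to be equipped with the (quasi-)norm `mixedNorm p α`. It is a type of
its own, because `S` already has the topology of pointwise convergence as a subspace of `ℂ → ℂ`. -/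
def Normed (_p : ℝ≥0∞) (_α : ℝ) (S : Submodule ℂ (ℂ → ℂ)) : Type := S

namespace Normed

variable {p : ℝ≥0∞} {α : ℝ} {S : Submodule ℂ (ℂ → ℂ)}

instance instAddCommGroup : AddCommGroup (Normed p α S) := inferInstanceAs (AddCommGroup S)

instance instModule : Module ℂ (Normed p α S) := inferInstanceAs (Module ℂ S)

/-- The function represented by an element of the space. -/
def toFun (f : Normed p α S) : ℂ → ℂ := Subtype.val (p := fun h => h ∈ S) f

/-- The topology of the (quasi-)norm: a set is open iff with each of its points `f` it contains a
ball `{h | mixedNorm p α (h - f) < ε}`, `ε > 0`. -/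
instance instTopologicalSpace : TopologicalSpace (Normed p α S) where
  IsOpen U := ∀ f ∈ U, ∃ ε : ℝ≥0∞, 0 < ε ∧ ∀ h : Normed p α S,
    mixedNorm p α (h - f).toFun < ε → h ∈ U
  isOpen_univ := fun _ _ => ⟨1, one_pos, fun _ _ => mem_univ _⟩
  isOpen_inter := fun U V hU hV f hf => by
    obtain ⟨ε, hε, h1⟩ := hU f hf.1
    obtain ⟨δ, hδ, h2⟩ := hV f hf.2
    exact ⟨min ε δ, lt_min hε hδ, fun h hh =>
      ⟨h1 h (hh.trans_le (min_le_left _ _)), h2 h (hh.trans_le (min_le_right _ _))⟩⟩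
  isOpen_sUnion := fun s hs f ⟨U, hU, hf⟩ => by
    obtain ⟨ε, hε, h1⟩ := hs U hU f hf
    exact ⟨ε, hε, fun h hh => ⟨U, hU, h1 h hh⟩⟩

end Normed

/-- The space `H(p,∞,α)` with the topology of its (quasi-)norm. -/
abbrev HBig (p : ℝ≥0∞) (α : ℝ) : Type := Normed p α (bigO p α)

/-- The space `H(p,0,α)` with the topology of the (quasi-)norm of `H(p,∞,α)`. -/
abbrev HLittle (p : ℝ≥0∞) (α : ℝ) : Type := Normed p α (littleO p α)

/-- `g` belongs to the Bloch space `𝓑`; only the values of `g` on the disk matter. -/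
def Bloch (g : ℂ → ℂ) : Prop :=
  DifferentiableOn ℂ g (ball 0 1) ∧
    ∃ C : ℝ, ∀ z ∈ ball (0 : ℂ) 1, (1 - ‖z‖ ^ 2) * ‖deriv g z‖ ≤ C

/-- `g` belongs to the little Bloch space `𝓑₀`: `(1 - |z|²) |g'(z)| → 0` as `|z| → 1⁻`. -/
def LittleBloch (g : ℂ → ℂ) : Prop :=
  DifferentiableOn ℂ g (ball 0 1) ∧
    Tendsto (fun z : ℂ => (1 - ‖z‖ ^ 2) * ‖deriv g z‖) (comap norm (𝓝[<] (1 : ℝ))) (𝓝 0)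

/-- `T_g f (z) = ∫₀^z f(ζ) g'(ζ) dζ` for `|z| < 1`, the integral taken along the segment
`ζ = t z`, `0 ≤ t ≤ 1`; the value outside the disk is zero. -/
def integralOp (g f : ℂ → ℂ) : ℂ → ℂ :=
  (ball (0 : ℂ) 1).indicator fun z =>
    ∫ t in (0 : ℝ)..1, f (t * z) * deriv g (t * z) * z

section Operators

variable {X Y : Type*} [AddCommGroup X] [Module ℂ X] [TopologicalSpace X]
  [AddCommGroup Y] [Module ℂ Y] [TopologicalSpace Y]

/-- `T` is weakly compact: it maps some neighbourhood of `0` (equivalently, for quasi-normed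
spaces, the unit ball) into a compact set of the weak topology of `Y`, the coarsest topology for
which all continuous linear functionals on `Y` are continuous. -/
def IsWeaklyCompactOperator (T : X →L[ℂ] Y) : Prop :=
  IsCompactOperator fun x => toWeakSpace ℂ Y (T x)

/-- `T` fixes a copy of `Z`: there is an isomorphism `Φ` of `Z` onto a subspace of `X` such that
the restriction of `T` to that subspace is an isomorphism onto its image. -/
def FixesCopy (Z : Type*) [AddCommGroup Z] [Module ℂ Z] [TopologicalSpace Z]
    (T : X →L[ℂ] Y) : Prop :=
  ∃ Φ : Z →L[ℂ] X, IsEmbedding Φ ∧ IsEmbedding fun a => T (Φ a)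

end Operators

/-- The space `ℓ_∞` of bounded complex sequences. -/
abbrev EllInfty : Type := lp (fun _ : ℕ => ℂ) ∞

/-- The space `c₀` of complex null sequences with the supremum norm. -/
abbrev CZero : Type := ZeroAtInftyContinuousMap ℕ ℂ

end MixedNorm

end

/-! One recursive estimate yields everything that follows from `LittleBloch g`. When `LittleBloch g`
fails, one operator defined on `ℓ_∞` refutes each of the other conditions.

Upper estimate. Between the radii `r` and `r' = max 0 (1 - b (1 - r))` the function `T_g f` changes,
along each ray, by at most a constant times `sup (1 - |z|)|g'(z)|` times a maximal function of `f`
at scale `1 - r`. The `L^p` norm of that maximal function is controlled by the means of `f` on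
comparable circles (`exists_maximal_bound`), because `|f|^p` has a local sub-mean value property for
every `p > 0`. If `b` is large, the weight gained from `r` to `r'` beats the quasi-triangle
constant, and the weighted mean at `r` is at most half of that at `r'` plus an error
(`exists_weightedMean_integralOp_le`). Iteration gives boundedness on both spaces. Near the circle
it shows that a little Bloch `g` sends `H(p,∞,α)` into `H(p,0,α)`. For such `g`, a norm-bounded `f`
that is small on a large compact disk has `T_g f` small in norm, so Montel's theorem gives
compactness.

Lower estimate (`exists_interpolation`). If `g` is Bloch but not little Bloch, there are points
`z_k`, tending to the circle as fast as desired, with `(1 - |z_k|)|g'(z_k)| ≥ c > 0`. Normalized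
kernels `f_k` peaking at `z_k` give a bounded map `Φ a = ∑ a_k f_k` on `ℓ_∞`, taking null sequences
into `H(p,0,α)`. The functionals `F ↦ F'(z_k) / (g'(z_k) f_k(z_k))` form a bounded map `L` into
`ℓ_∞`, taking `H(p,0,α)` to null sequences. As `(T_g f)' = f g'`, the map `L T_g Φ` only sees the
values `(Φ a)(z_k)`, and lacunarity makes it differ from the identity by at most `‖a‖ / 2`.

Hence `T_g Φ` is an embedding, so copies of `ℓ_∞` and, by restriction, `c₀` are fixed. Every
coordinate of `L T_g Φ 1` has modulus at least `1/2`, so `T_g Φ 1` is not in `H(p,0,α)`. For weak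
compactness, a weak limit `y` of scaled images of the truncations of `1` has coordinates `(L y)_k`
bounded away from zero. On `H(p,0,α)` this is absurd at once; on `H(p,∞,α)` the functional "limit of
`L` along an ultrafilter" vanishes at all the images, hence at `y`. This explicit functional
replaces a Hahn–Banach argument, which is unavailable for `p < 1`. -/

noncomputable section

namespace MixedNorm

/-! ### The topology of the spaces and the angular measure -/

section

namespace Normed

variable {p : ℝ≥0∞} {α : ℝ} {S S' : Submodule ℂ (ℂ → ℂ)}

/-- An element of `S` as an element of the space with the mixed norm. -/
def mk (f : ℂ → ℂ) (hf : f ∈ S) : Normed p α S := ⟨f, hf⟩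

theorem toFun_mk (f : ℂ → ℂ) (hf : f ∈ S) : (mk f hf : Normed p α S).toFun = f := rfl

theorem toFun_mem (f : Normed p α S) : f.toFun ∈ S := f.2

theorem toFun_add (f h : Normed p α S) : (f + h).toFun = f.toFun + h.toFun := rfl

theorem toFun_sub (f h : Normed p α S) : (f - h).toFun = f.toFun - h.toFun := rfl

theorem toFun_smul (c : ℂ) (f : Normed p α S) : (c • f).toFun = c • f.toFun := rfl

theorem toFun_zero : (0 : Normed p α S).toFun = 0 := rfl

theorem ext {f h : Normed p α S} (H : f.toFun = h.toFun) : f = h := Subtype.ext H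

theorem isOpen_iff {U : Set (Normed p α S)} : IsOpen U ↔ ∀ f ∈ U, ∃ ε : ℝ≥0∞, 0 < ε ∧
    ∀ h : Normed p α S, mixedNorm p α (h - f).toFun < ε → h ∈ U := Iff.rfl

/-- Balls of a quasi-norm need not be open, so this is not just the definition of the topology. The
points having some ball inside `s` form an open set: by the quasi-triangle inequality, two steps of
size `δ` stay in a ball of radius `ε` once `K (δ + δ) < ε`. -/
theorem mem_nhds_iff (hS : S ≤ bigO p α) {f : Normed p α S} {s : Set (Normed p α S)} :
    s ∈ 𝓝 f ↔ ∃ ε : ℝ≥0∞, 0 < ε ∧ ∀ h : Normed p α S,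
      mixedNorm p α (h - f).toFun < ε → h ∈ s := by
  constructor
  · intro hs
    obtain ⟨U, hUs, hU, hfU⟩ := _root_.mem_nhds_iff.1 hs
    obtain ⟨ε, hε, h1⟩ := isOpen_iff.1 hU f hfU
    exact ⟨ε, hε, fun h hh => hUs (h1 h hh)⟩
  · intro hs
    refine _root_.mem_nhds_iff.2 ⟨{k | ∃ ε : ℝ≥0∞, 0 < ε ∧ ∀ h : Normed p α S,
      mixedNorm p α (h - k).toFun < ε → h ∈ s}, ?_, ?_, hs⟩
    · rintro k ⟨ε, hε, hk⟩
      refine hk k ?_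
      simpa [sub_self, toFun_zero, mixedNorm, integralMean_zero] using hε
    · refine isOpen_iff.2 ?_
      rintro k ⟨ε, hε, hk⟩
      have hK := ENNReal.LpAddConst_lt_top p
      obtain ⟨δ, hδ, hδε⟩ : ∃ δ : ℝ≥0∞, 0 < δ ∧ ENNReal.LpAddConst p * (δ + δ) < ε := by
        have h0 : Tendsto (fun δ : ℝ≥0∞ => ENNReal.LpAddConst p * (δ + δ)) (𝓝[>] 0) (𝓝 0) := by
          have : Tendsto (fun δ : ℝ≥0∞ => ENNReal.LpAddConst p * (δ + δ)) (𝓝 0)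
              (𝓝 (ENNReal.LpAddConst p * (0 + 0))) :=
            ENNReal.Tendsto.const_mul (tendsto_id.add tendsto_id) (Or.inr hK.ne)
          simp only [add_zero, mul_zero] at this
          exact this.mono_left nhdsWithin_le_nhds
        obtain ⟨δ, h1, h2⟩ := ((h0.eventually (gt_mem_nhds hε)).and self_mem_nhdsWithin).exists
        exact ⟨δ, h2, h1⟩
      refine ⟨δ, hδ, fun h hh => ⟨δ, hδ, fun l hl => hk l ?_⟩⟩
      have hlk : (l - k).toFun = (l - h).toFun + (h - k).toFun := by
        rw [← toFun_add, sub_add_sub_cancel]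
      rw [hlk]
      refine (mixedNorm_add_le p α (hS (toFun_mem _)).1 (hS (toFun_mem _)).1).trans_lt
        (lt_of_le_of_lt ?_ hδε)
      gcongr

theorem continuous_of_bound (T : Normed p α S →ₗ[ℂ] Normed p α S') (C : ℝ≥0∞) (hC : C ≠ ∞)
    (hT : ∀ f, mixedNorm p α (T f).toFun ≤ C * mixedNorm p α f.toFun) : Continuous T := by
  refine continuous_def.2 fun U hU => isOpen_iff.2 fun f hf => ?_
  obtain ⟨ε, hε, h1⟩ := isOpen_iff.1 hU _ hf
  refine ⟨ε / C, ENNReal.div_pos hε.ne' hC, fun h hh => h1 _ ?_⟩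
  rw [← map_sub]
  refine (hT _).trans_lt ?_
  rw [mul_comm]
  exact ENNReal.mul_lt_of_lt_div hh

theorem continuous_of_bound_domain {Z : Type*} [SeminormedAddCommGroup Z] [Module ℂ Z]
    (T : Normed p α S →ₗ[ℂ] Z) (C : ℝ≥0∞) (hC : C ≠ ∞)
    (hT : ∀ f, ‖T f‖ₑ ≤ C * mixedNorm p α f.toFun) : Continuous T := by
  refine continuous_def.2 fun U hU => isOpen_iff.2 fun f hf => ?_
  obtain ⟨ε, hε, h1⟩ := EMetric.isOpen_iff.1 hU _ hf
  refine ⟨ε / C, ENNReal.div_pos hε.ne' hC, fun h hh => h1 ?_⟩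
  rw [Metric.mem_eball, edist_eq_enorm_sub, ← map_sub]
  refine (hT _).trans_lt ?_
  rw [mul_comm]
  exact ENNReal.mul_lt_of_lt_div hh

theorem continuous_of_bound_codomain {Z : Type*} [SeminormedAddCommGroup Z] [Module ℂ Z]
    (T : Z →ₗ[ℂ] Normed p α S) (C : ℝ≥0∞) (hC : C ≠ ∞)
    (hT : ∀ a, mixedNorm p α (T a).toFun ≤ C * ‖a‖ₑ) : Continuous T := by
  refine continuous_def.2 fun U hU => EMetric.isOpen_iff.2 fun a ha => ?_
  obtain ⟨ε, hε, h1⟩ := isOpen_iff.1 hU _ ha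
  refine ⟨ε / C, ENNReal.div_pos hε.ne' hC, fun b hb => h1 _ ?_⟩
  rw [Metric.mem_eball, edist_eq_enorm_sub] at hb
  rw [← map_sub]
  refine (hT _).trans_lt ?_
  rw [mul_comm]
  exact ENNReal.mul_lt_of_lt_div hb

end Normed

theorem littleO_le_bigO (p : ℝ≥0∞) (α : ℝ) : littleO p α ≤ bigO p α := fun _ hf => hf.1

/-- The inclusion of `H(p,0,α)` into `H(p,∞,α)`. -/
def inclusion (p : ℝ≥0∞) (α : ℝ) : HLittle p α →L[ℂ] HBig p α where
  toLinearMap := Submodule.inclusion (littleO_le_bigO p α)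
  cont := Normed.continuous_of_bound (S := littleO p α) (S' := bigO p α)
    (Submodule.inclusion (littleO_le_bigO p α)) 1 ENNReal.one_ne_top
    fun f => by rw [one_mul]; rfl

theorem toFun_inclusion {p : ℝ≥0∞} {α : ℝ} (f : HLittle p α) :
    (inclusion p α f).toFun = f.toFun := rfl

theorem isHolo_toFun {p : ℝ≥0∞} {α : ℝ} (f : HBig p α) : IsHolo f.toFun := f.toFun_mem.1

theorem angleMeasure_univ : angleMeasure univ = 1 := by
  have : (0 : ℝ) < 2 * Real.pi := by positivity
  simp only [angleMeasure, Measure.smul_apply, Measure.restrict_apply_univ, Real.volume_Ioc,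
    smul_eq_mul, sub_zero]
  rw [← ENNReal.ofReal_mul (by positivity), one_div, inv_mul_cancel₀ this.ne', ENNReal.ofReal_one]

instance isProbabilityMeasure_angleMeasure : IsProbabilityMeasure angleMeasure :=
  ⟨angleMeasure_univ⟩

theorem lintegral_angleMeasure (F : ℝ → ℝ≥0∞) : ∫⁻ θ, F θ ∂angleMeasure =
    ENNReal.ofReal (1 / (2 * Real.pi)) * ∫⁻ θ in Ioc 0 (2 * Real.pi), F θ := by
  rw [angleMeasure, lintegral_smul_measure, smul_eq_mul]

theorem integralMean_rpow {p : ℝ≥0∞} (hp : p ≠ 0) (hp' : p ≠ ∞) (r : ℝ) (f : ℂ → ℂ) :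
    integralMean p r f ^ p.toReal =
      ∫⁻ θ, ‖f (r * Complex.exp (θ * Complex.I))‖ₑ ^ p.toReal ∂angleMeasure := by
  have := ENNReal.toReal_pos hp hp'
  rw [integralMean, eLpNorm_eq_lintegral_rpow_enorm_toReal hp hp', ← ENNReal.rpow_mul,
    one_div, inv_mul_cancel₀ this.ne', ENNReal.rpow_one]

theorem norm_mul_exp {r : ℝ} (hr : 0 ≤ r) (θ : ℝ) : ‖(r : ℂ) * Complex.exp (θ * Complex.I)‖ = r := by
  rw [norm_mul, Complex.norm_exp_ofReal_mul_I, mul_one, Complex.norm_real, Real.norm_of_nonneg hr]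

theorem lintegral_angle_shift (F : ℝ → ℝ≥0∞) (hF : Function.Periodic F (2 * Real.pi)) (φ : ℝ) :
    ∫⁻ θ, F (θ + φ) ∂angleMeasure = ∫⁻ θ, F θ ∂angleMeasure := by
  have hT : (0 : ℝ) < 2 * Real.pi := by positivity
  rw [lintegral_angleMeasure, lintegral_angleMeasure]
  congr 1
  have h1 : ∫⁻ θ in Ioc 0 (2 * Real.pi), F (θ + φ) =
      ∫⁻ θ in Ioc φ (φ + 2 * Real.pi), F θ := by
    rw [← (measurePreserving_add_right volume φ).setLIntegral_comp_preimage_emb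
      (measurableEmbedding_addRight φ) F (Ioc φ (φ + 2 * Real.pi))]
    simp
  rw [h1]
  have h2 := (isAddFundamentalDomain_Ioc hT φ).setLIntegral_eq
    (isAddFundamentalDomain_Ioc hT 0) F (by
      rintro ⟨g, hg⟩ x
      obtain ⟨n, rfl⟩ := AddSubgroup.mem_zmultiples_iff.1 hg
      change F (n • (2 * Real.pi) + x) = F x
      rw [add_comm]
      exact hF.zsmul n x)
  rwa [zero_add] at h2

/-- Rotating `w` over all angles only remembers `|w|`. Together with Fubini and the rotation
invariance of area, this does the work of polar coordinates. -/
theorem integralMean_eq_of_norm (F : ℝ≥0∞ → ℝ≥0∞) (f : ℂ → ℂ) (w : ℂ) :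
    ∫⁻ θ, F ‖f (Complex.exp (θ * Complex.I) * w)‖ₑ ∂angleMeasure =
      ∫⁻ θ, F ‖f (‖w‖ * Complex.exp (θ * Complex.I))‖ₑ ∂angleMeasure := by
  have hper : Function.Periodic
      (fun θ : ℝ => F ‖f (‖w‖ * Complex.exp (θ * Complex.I))‖ₑ) (2 * Real.pi) := by
    intro θ
    have : Complex.exp (((θ + 2 * Real.pi : ℝ) : ℂ) * Complex.I) =
        Complex.exp (θ * Complex.I) := by
      rw [← Complex.exp_periodic (θ * Complex.I)]
      congr 1
      push_cast
      ring
    simp only [this]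
  rw [← lintegral_angle_shift _ hper w.arg]
  refine lintegral_congr fun θ => ?_
  congr 3
  conv_lhs => rw [← Complex.norm_mul_exp_arg_mul_I w]
  push_cast
  rw [add_mul, Complex.exp_add]
  ring

end

/-! ### Sub-mean value estimates -/

section

theorem enorm_le_lintegral_circle {f : ℂ → ℂ} {z : ℂ} {R : ℝ}
    (hf : DiffContOnCl ℂ f (ball z |R|)) :
    ‖f z‖ₑ ≤ ∫⁻ θ, ‖f (z + R * Complex.exp (θ * Complex.I))‖ₑ ∂angleMeasure := by
  have h : f z = ∫ θ, f (z + R * Complex.exp (θ * Complex.I)) ∂angleMeasure := by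
    conv_lhs => rw [← hf.circleAverage]
    rw [Real.circleAverage_def, intervalIntegral.integral_of_le (by positivity), angleMeasure,
      integral_smul_measure, ENNReal.toReal_ofReal (by positivity), one_div]
    rfl
  rw [h]
  exact enorm_integral_le_lintegral_enorm _

theorem lintegral_rotation_ball (G : ℂ → ℝ≥0∞) (θ : ℝ) :
    ∫⁻ w, G (Complex.exp (θ * Complex.I) * w) = ∫⁻ w, G w := by
  have h := (rotation (Circle.exp θ)).measurePreserving
  have h2 := h.lintegral_comp_emb
    (rotation (Circle.exp θ)).toHomeomorph.measurableEmbedding G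
  simpa [rotation_apply] using h2

theorem lintegral_lintegral_rotation {G : ℂ → ℝ≥0∞} (hG : Measurable G) :
    ∫⁻ w, ∫⁻ θ, G (Complex.exp ((θ : ℝ) * Complex.I) * w) ∂angleMeasure = ∫⁻ w, G w := by
  rw [lintegral_lintegral_swap]
  · simp [lintegral_rotation_ball]
  · refine (hG.comp ?_).aemeasurable
    exact Continuous.measurable (by fun_prop)

/-- The circle mean value inequality integrated over the radius `‖w‖ < δ`, the area integral being
first averaged over rotations. -/
theorem enorm_mul_volume_le_lintegral_ball {f : ℂ → ℂ} {z : ℂ} {δ : ℝ}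
    (hf : DifferentiableOn ℂ f (ball z δ)) :
    ‖f z‖ₑ * volume (ball (0 : ℂ) δ) ≤ ∫⁻ w in ball z δ, ‖f w‖ₑ := by
  set G : ℂ → ℝ≥0∞ := (ball (0 : ℂ) δ).indicator fun w => ‖f (z + w)‖ₑ with hG
  have hc : ContinuousOn (fun w => ‖f (z + w)‖ₑ) (ball (0 : ℂ) δ) := by
    refine continuous_enorm.comp_continuousOn (hf.continuousOn.comp (by fun_prop) ?_)
    intro w hw
    simpa using hw
  have hGm : Measurable G := by
    classical
    rw [hG, ← Set.piecewise_eq_indicator]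
    exact hc.measurable_piecewise continuousOn_const measurableSet_ball
  have h1 : ∫⁻ w in ball z δ, ‖f w‖ₑ = ∫⁻ w, G w := by
    rw [hG, lintegral_indicator measurableSet_ball,
      ← (measurePreserving_add_left volume z).setLIntegral_comp_preimage_emb
        (measurableEmbedding_addLeft z)]
    simp
  rw [h1, ← lintegral_lintegral_rotation hGm, ← setLIntegral_const,
    ← lintegral_indicator measurableSet_ball]
  refine lintegral_mono fun w => ?_
  by_cases hw : w ∈ ball (0 : ℂ) δ
  · rw [indicator_of_mem hw]
    have hd : DiffContOnCl ℂ f (ball z |‖w‖|) := by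
      have hw' : ‖w‖ < δ := by simpa using hw
      refine (hf.mono ?_).diffContOnCl
      rw [abs_norm]
      refine closure_ball_subset_closedBall.trans (closedBall_subset_ball hw')
    refine (enorm_le_lintegral_circle hd).trans_eq ?_
    have h2 := integralMean_eq_of_norm id (fun w => f (z + w)) w
    simp only [id] at h2
    rw [← h2]
    refine lintegral_congr fun θ => ?_
    rw [hG, indicator_of_mem]
    rw [mem_ball_zero_iff, norm_mul, Complex.norm_exp_ofReal_mul_I, one_mul]
    simpa using hw
  · rw [indicator_of_notMem hw]
    exact zero_le

/-- Maximize `(ρ - |w - z|)^{2/p} |f(w)|`. Near a maximum point `z₁` the modulus of `f` is at most a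
constant times `|f(z₁)|`, so the area inequality for `|f|` turns into one for `|f|^p` on writing
`|f| = |f|^{1-p} |f|^p`. The exponent `2/p` makes the `p`-th power of the weight a squared radius.
-/
theorem enorm_rpow_le_lintegral_closedBall {p : ℝ} (hp : 0 < p) (hp1 : p ≤ 1) {f : ℂ → ℂ} {z : ℂ}
    {ρ : ℝ} (hρ : 0 < ρ) (hf : DifferentiableOn ℂ f (ball z ρ))
    (hc : ContinuousOn f (closedBall z ρ)) :
    ‖f z‖ₑ ^ p * ENNReal.ofReal (ρ ^ 2) ≤
      ENNReal.ofReal (4 * (2 ^ (2 / p)) ^ (1 - p)) * ∫⁻ w in ball z ρ, ‖f w‖ₑ ^ p := by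
  obtain ⟨z₁, hz₁, hmax⟩ := (isCompact_closedBall z ρ).exists_isMaxOn
    (f := fun w => (ρ - dist w z) ^ (2 / p) * ‖f w‖) ⟨z, mem_closedBall_self hρ.le⟩ (by
      refine ContinuousOn.mul ?_ hc.norm
      refine ContinuousOn.rpow_const (by fun_prop) fun w _ => Or.inr (by positivity))
  have hmax' : ∀ w ∈ closedBall z ρ, (ρ - dist w z) ^ (2 / p) * ‖f w‖ ≤
    (ρ - dist z₁ z) ^ (2 / p) * ‖f z₁‖ := fun w hw => hmax hw
  by_cases hfz : f z = 0
  · simp [hfz, hp]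
  have hz0 : 0 < ρ ^ (2 / p) * ‖f z‖ := by positivity
  have hz := hmax' z (mem_closedBall_self hρ.le)
  rw [dist_self, sub_zero] at hz
  have hle : dist z₁ z ≤ ρ := hz₁
  have hlt : dist z₁ z < ρ := by
    refine lt_of_le_of_ne hle fun h => ?_
    rw [h, sub_self, Real.zero_rpow (by positivity), zero_mul] at hz
    linarith
  have hM : 0 < ‖f z₁‖ := by
    rcases (norm_nonneg (f z₁)).eq_or_lt with h | h
    · rw [← h, mul_zero] at hz; linarith
    · exact h
  -- With half the distance to the boundary as radius, the base of the weight drops by a factor of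
  -- at most 2 on `ball z₁ δ`; hence the constant `2 ^ (2 / p)`.
  set δ := (ρ - dist z₁ z) / 2 with hδ
  have hδ0 : 0 < δ := by rw [hδ]; linarith
  have h2δ : ρ - dist z₁ z = 2 * δ := by rw [hδ]; ring
  have hsub : ball z₁ δ ⊆ ball z ρ := by
    refine ball_subset_ball' ?_
    linarith
  have hbd : ∀ w ∈ ball z₁ δ, ‖f w‖ ≤ 2 ^ (2 / p) * ‖f z₁‖ := by
    intro w hw
    have h1 := hmax' w (ball_subset_closedBall (hsub hw))
    have h2 : δ ≤ ρ - dist w z := by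
      have := dist_triangle w z₁ z
      have := mem_ball.1 hw
      linarith
    have h3 : δ ^ (2 / p) * ‖f w‖ ≤ (2 * δ) ^ (2 / p) * ‖f z₁‖ := by
      rw [← h2δ]
      refine le_trans ?_ h1
      gcongr
    rw [Real.mul_rpow (by norm_num) hδ0.le, mul_comm (2 ^ (2 / p) : ℝ), mul_assoc] at h3
    exact le_of_mul_le_mul_left h3 (by positivity)
  have harea := enorm_mul_volume_le_lintegral_ball (hf.mono hsub)
  have hpt : ∀ w ∈ ball z₁ δ, ‖f w‖ₑ ≤
      ENNReal.ofReal ((2 ^ (2 / p) * ‖f z₁‖) ^ (1 - p)) * ‖f w‖ₑ ^ p := by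
    intro w hw
    rw [← ofReal_norm, ENNReal.ofReal_rpow_of_nonneg (norm_nonneg _) hp.le,
      ← ENNReal.ofReal_mul (by positivity)]
    refine ENNReal.ofReal_le_ofReal ?_
    rcases (norm_nonneg (f w)).eq_or_lt with h | h
    · rw [← h]; positivity
    calc ‖f w‖ = ‖f w‖ ^ (1 - p) * ‖f w‖ ^ p := by
          rw [← Real.rpow_add h, sub_add_cancel, Real.rpow_one]
      _ ≤ _ := by
          have : 0 ≤ 1 - p := by linarith
          gcongr
          exact hbd w hw
  have hI : ∫⁻ w in ball z₁ δ, ‖f w‖ₑ ≤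
      ENNReal.ofReal ((2 ^ (2 / p) * ‖f z₁‖) ^ (1 - p)) * ∫⁻ w in ball z ρ, ‖f w‖ₑ ^ p := by
    rw [← lintegral_const_mul' _ _ ENNReal.ofReal_ne_top]
    exact (setLIntegral_mono' measurableSet_ball hpt).trans (lintegral_mono_set hsub)
  have hvol : ENNReal.ofReal (δ ^ 2) ≤ volume (ball (0 : ℂ) δ) := by
    rw [Complex.volume_ball, ENNReal.ofReal_pow hδ0.le]
    refine le_mul_of_one_le_right' ?_
    have : (1 : NNReal) ≤ NNReal.pi := by
      rw [← NNReal.coe_le_coe]; simpa using Real.pi_gt_three.le.trans' (by norm_num)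
    exact_mod_cast this
  have hreal : ‖f z‖ ^ p * ρ ^ 2 ≤ 4 * (‖f z₁‖ ^ p * δ ^ 2) := by
    have h := Real.rpow_le_rpow hz0.le hz hp.le
    rw [h2δ, Real.mul_rpow (by positivity) (by positivity),
      Real.mul_rpow (by positivity) (by positivity), ← Real.rpow_mul (by positivity),
      ← Real.rpow_mul (by positivity), div_mul_cancel₀ _ hp.ne', Real.rpow_two, Real.rpow_two] at h
    linarith
  calc ‖f z‖ₑ ^ p * ENNReal.ofReal (ρ ^ 2)
      = ENNReal.ofReal (‖f z‖ ^ p * ρ ^ 2) := by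
        rw [ENNReal.ofReal_mul (by positivity), ← ofReal_norm,
          ENNReal.ofReal_rpow_of_nonneg (norm_nonneg _) hp.le]
    _ ≤ ENNReal.ofReal (4 * (‖f z₁‖ ^ p * δ ^ 2)) := ENNReal.ofReal_le_ofReal hreal
    _ = ENNReal.ofReal (4 * ‖f z₁‖ ^ (p - 1)) * (‖f z₁‖ₑ * ENNReal.ofReal (δ ^ 2)) := by
        rw [← ofReal_norm, ← ENNReal.ofReal_mul (by positivity),
          ← ENNReal.ofReal_mul (by positivity)]
        congr 1
        rw [Real.rpow_sub_one hM.ne']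
        field_simp
    _ ≤ ENNReal.ofReal (4 * ‖f z₁‖ ^ (p - 1)) *
        (ENNReal.ofReal ((2 ^ (2 / p) * ‖f z₁‖) ^ (1 - p)) * ∫⁻ w in ball z ρ, ‖f w‖ₑ ^ p) := by
        exact mul_le_mul_right ((mul_le_mul_right hvol _).trans (harea.trans hI)) _
    _ = _ := by
        rw [← mul_assoc, ← ENNReal.ofReal_mul (by positivity)]
        congr 2
        rw [Real.mul_rpow (by positivity) hM.le]
        have : ‖f z₁‖ ^ (p - 1) * ‖f z₁‖ ^ (1 - p) = 1 := by
          rw [← Real.rpow_add hM]; simp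
        linear_combination 4 * (2 ^ (2 / p) : ℝ) ^ (1 - p) * this

/-- A local sub-mean value property of `|f|^p`, valid for all `p > 0`. -/
theorem exists_enorm_rpow_le_lintegral_ball {p : ℝ} (hp : 0 < p) :
    ∃ C : ℝ≥0∞, C ≠ ∞ ∧ ∀ (f : ℂ → ℂ) (z : ℂ) (ρ : ℝ), 0 < ρ →
      DifferentiableOn ℂ f (ball z ρ) →
      ‖f z‖ₑ ^ p * ENNReal.ofReal (ρ ^ 2) ≤ C * ∫⁻ w in ball z ρ, ‖f w‖ₑ ^ p := by
  -- Since `|f^m|^{p/m} = |f|^p`, passing to `f^m` reduces every exponent to one that is at most 1.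
  obtain ⟨m, hm⟩ := exists_nat_ge (max p 1)
  have hm1 : (1 : ℝ) ≤ m := (le_max_right _ _).trans hm
  have hm0 : (0 : ℝ) < m := by linarith
  set q := p / m with hq
  have hq0 : 0 < q := by positivity
  have hq1 : q ≤ 1 := (div_le_one hm0).2 ((le_max_left _ _).trans hm)
  have hpow : ∀ x : ℂ, ‖x ^ m‖ₑ ^ q = ‖x‖ₑ ^ p := by
    intro x
    rw [enorm_pow, ← ENNReal.rpow_natCast, ← ENNReal.rpow_mul, hq, mul_div_cancel₀ _ hm0.ne']
  refine ⟨4 * ENNReal.ofReal (4 * (2 ^ (2 / q)) ^ (1 - q)),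
    ENNReal.mul_ne_top (by simp) ENNReal.ofReal_ne_top, fun f z ρ hρ hf => ?_⟩
  -- Halving the radius provides continuity up to the boundary, at the price of a factor 4.
  have hcb : closedBall z (ρ / 2) ⊆ ball z ρ := closedBall_subset_ball (by linarith)
  have hd := hf.pow m
  have h := enorm_rpow_le_lintegral_closedBall hq0 hq1 (f := fun w => f w ^ m) (half_pos hρ)
    (hd.mono (ball_subset_closedBall.trans hcb)) (hd.continuousOn.mono hcb)
  simp only [hpow] at h
  have h4 : ENNReal.ofReal (ρ ^ 2) = 4 * ENNReal.ofReal ((ρ / 2) ^ 2) := by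
    rw [show (4 : ℝ≥0∞) = ENNReal.ofReal 4 by simp, ← ENNReal.ofReal_mul (by norm_num)]
    congr 1
    ring
  calc ‖f z‖ₑ ^ p * ENNReal.ofReal (ρ ^ 2)
      = 4 * (‖f z‖ₑ ^ p * ENNReal.ofReal ((ρ / 2) ^ 2)) := by rw [h4]; ring
    _ ≤ 4 * (ENNReal.ofReal (4 * (2 ^ (2 / q)) ^ (1 - q)) *
        ∫⁻ w in ball z ρ, ‖f w‖ₑ ^ p) := by
        refine mul_le_mul_right (h.trans (mul_le_mul_right (lintegral_mono_set ?_) _)) _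
        exact ball_subset_ball (by linarith)
    _ = _ := by ring

theorem IsHolo.measurable {f : ℂ → ℂ} (hf : IsHolo f) : Measurable f := by
  classical
  have h : f = (ball (0 : ℂ) 1).piecewise f 0 := by
    ext z
    by_cases hz : z ∈ ball (0 : ℂ) 1
    · rw [piecewise_eq_of_mem _ _ _ hz]
    · rw [piecewise_eq_of_notMem _ _ _ hz, hf.2 z hz]; rfl
  rw [h]
  exact hf.1.continuousOn.measurable_piecewise continuousOn_const measurableSet_ball

end

/-! ### Maximal functions, pointwise bounds and derivatives -/

section

theorem lintegral_ball_le_rotate {F : ℂ → ℝ≥0∞} {z : ℂ} {ρ θ : ℝ} {W : Set ℂ}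
    (hW : MeasurableSet W)
    (h : ∀ w : ℂ, Complex.exp (θ * Complex.I) * w ∈ ball z ρ → w ∈ W) :
    ∫⁻ w in ball z ρ, F w ≤ ∫⁻ w in W, F (Complex.exp (θ * Complex.I) * w) := by
  rw [← lintegral_indicator measurableSet_ball, ← lintegral_rotation_ball _ θ,
    ← lintegral_indicator hW]
  refine lintegral_mono fun w => ?_
  by_cases hw : Complex.exp (θ * Complex.I) * w ∈ ball z ρ
  · rw [indicator_of_mem hw, indicator_of_mem (h w hw)]
  · rw [indicator_of_notMem hw]
    exact zero_le

/-- By continuity, a value above the essential supremum would be approached on a whole interval of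
angles. -/
theorem enorm_le_integralMean_top {f : ℂ → ℂ} (hf : IsHolo f) {z : ℂ} (hz : ‖z‖ < 1) :
    ‖f z‖ₑ ≤ integralMean ∞ ‖z‖ f := by
  set F : ℝ → ℂ := fun θ => f (‖z‖ * Complex.exp (θ * Complex.I)) with hF
  have hcont : Continuous F := by
    refine hf.1.continuousOn.comp_continuous (by fun_prop) fun θ => ?_
    rw [mem_ball_zero_iff, norm_mul_exp (norm_nonneg z)]
    exact hz
  have hae : ∀ᵐ θ ∂angleMeasure, ‖F θ‖ₑ ≤ integralMean ∞ ‖z‖ f := by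
    rw [integralMean, eLpNorm_exponent_top]
    exact ae_le_eLpNormEssSup
  have hpi := Real.pi_pos
  have hopen : IsOpen {θ : ℝ | integralMean ∞ ‖z‖ f < ‖F θ‖ₑ} :=
    isOpen_lt continuous_const (continuous_enorm.comp hcont)
  obtain ⟨θ₀, hθ₀, hz0⟩ : ∃ θ₀ ∈ Ioc (0 : ℝ) (2 * Real.pi), F θ₀ = f z := by
    have key : ∀ θ : ℝ, Complex.exp (θ * Complex.I) = Complex.exp (z.arg * Complex.I) →
        F θ = f z := by
      intro θ h
      rw [hF]
      simp only [h, Complex.norm_mul_exp_arg_mul_I]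
    rcases lt_or_ge 0 z.arg with h | h
    · exact ⟨z.arg, ⟨h, by linarith [Complex.arg_le_pi z]⟩, key _ rfl⟩
    · refine ⟨z.arg + 2 * Real.pi, ⟨by linarith [Complex.neg_pi_lt_arg z], by linarith⟩, key _ ?_⟩
      rw [← Complex.exp_periodic (z.arg * Complex.I)]
      congr 1
      push_cast
      ring
  by_contra! hlt
  rw [← hz0] at hlt
  obtain ⟨ε, hε, hball⟩ := Metric.isOpen_iff.1 hopen θ₀ hlt
  -- The interval lies to the left of `θ₀`, because `θ₀` may be the right endpoint `2π`.
  set a := max 0 (θ₀ - ε) with ha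
  have haθ : a < θ₀ := max_lt hθ₀.1 (by linarith)
  have hsub : Ioo a θ₀ ⊆ {θ | ¬ ‖F θ‖ₑ ≤ integralMean ∞ ‖z‖ f} ∩ Ioc 0 (2 * Real.pi) := by
    intro θ hθ
    have h1 : θ₀ - ε ≤ a := le_max_right _ _
    have h2 : 0 ≤ a := le_max_left _ _
    refine ⟨?_, ⟨by linarith [hθ.1], by linarith [hθ.2, hθ₀.2]⟩⟩
    have := hball (show θ ∈ ball θ₀ ε by
      rw [Real.ball_eq_Ioo]
      exact ⟨by linarith [hθ.1], by linarith [hθ.2]⟩)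
    simpa using this
  have h0 : angleMeasure {θ | ¬ ‖F θ‖ₑ ≤ integralMean ∞ ‖z‖ f} = 0 := hae
  rw [angleMeasure, Measure.smul_apply, smul_eq_mul, mul_eq_zero] at h0
  rcases h0 with h0 | h0
  · rw [ENNReal.ofReal_eq_zero] at h0
    have : 0 < 1 / (2 * Real.pi) := by positivity
    linarith
  · have h3 := measure_mono_null hsub (Measure.restrict_apply_eq_zero'
      measurableSet_Ioc |>.1 h0)
    rw [Real.volume_Ioo, ENNReal.ofReal_eq_zero] at h3
    linarith

/-- A function `B` of the angle that dominates `|f|` on the Whitney boxes of size `δ`, with the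
`L^p` norm controlled by the integral means of `f` at distance comparable to `δ` from the
unit circle. -/
theorem exists_maximal_bound {p : ℝ≥0∞} (hp : p ≠ 0) {α : ℝ} (hα : 0 < α) {b : ℝ} (hb : 1 ≤ b) :
    ∃ C : ℝ≥0∞, C ≠ ∞ ∧ ∀ f : ℂ → ℂ, IsHolo f → ∀ δ : ℝ, 0 < δ → δ ≤ 1 → ∀ E : ℝ≥0∞,
      (∀ s ∈ Ico (0 : ℝ) 1, δ / 2 ≤ 1 - s → 1 - s ≤ (b + 1) * δ →
        ENNReal.ofReal ((1 - s) ^ α) * integralMean p s f ≤ E) →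
      ∃ B : ℝ → ℝ≥0∞, Measurable B ∧
        (∀ (θ : ℝ) (z : ℂ), ‖z‖ ≤ 1 - δ →
          ‖z - (1 - δ : ℝ) * Complex.exp (θ * Complex.I)‖ ≤ (b - 1) * δ → ‖f z‖ₑ ≤ B θ) ∧
        eLpNorm B p angleMeasure * ENNReal.ofReal (δ ^ α) ≤ C * E := by
  by_cases hp' : p = ∞
  · subst hp'
    refine ⟨1, ENNReal.one_ne_top, fun f hf δ hδ hδ1 E hE => ?_⟩
    have hδα : ENNReal.ofReal (δ ^ α) ≠ 0 := by
      rw [Ne, ENNReal.ofReal_eq_zero, not_le]; positivity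
    refine ⟨fun _ => E / ENNReal.ofReal (δ ^ α), measurable_const, fun θ z hz hzθ => ?_, ?_⟩
    · rw [ENNReal.le_div_iff_mul_le (Or.inl hδα) (Or.inl ENNReal.ofReal_ne_top)]
      have h1 : 1 - ‖z‖ ≤ b * δ := by
        have h2 := norm_sub_norm_le ((1 - δ : ℝ) * Complex.exp (θ * Complex.I)) z
        rw [norm_mul_exp (by linarith), norm_sub_rev] at h2
        linarith
      refine le_trans ?_ (hE ‖z‖ ⟨norm_nonneg z, by linarith⟩ (by linarith) (by linarith))
      rw [mul_comm]
      gcongr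
      · linarith
      · exact enorm_le_integralMean_top hf (by linarith)
    · refine (mul_le_mul_left (eLpNorm_le_of_ae_enorm_bound
        (C := E / ENNReal.ofReal (δ ^ α)) (Eventually.of_forall fun _ => by simp)) _).trans ?_
      simp [ENNReal.div_mul_cancel hδα ENNReal.ofReal_ne_top]
  obtain ⟨C₀, hC₀, hsub⟩ := exists_enorm_rpow_le_lintegral_ball (ENNReal.toReal_pos hp hp')
  set P := p.toReal with hP
  have hP0 : 0 < P := ENNReal.toReal_pos hp hp'
  set A : ℝ≥0∞ := C₀ * ENNReal.ofReal (4 * b ^ 2 * Real.pi) with hA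
  have hAtop : A ≠ ∞ := ENNReal.mul_ne_top hC₀ ENNReal.ofReal_ne_top
  refine ⟨A ^ (1 / P) * ENNReal.ofReal (2 ^ α), ENNReal.mul_ne_top
    (ENNReal.rpow_ne_top_of_nonneg (by positivity) hAtop) ENNReal.ofReal_ne_top,
    fun f hf δ hδ hδ1 E hE => ?_⟩
  set D : ℝ≥0∞ := ENNReal.ofReal ((δ / 2) ^ 2) with hD
  have hD0 : D ≠ 0 := by rw [hD, Ne, ENNReal.ofReal_eq_zero, not_le]; positivity
  have hDtop : D ≠ ∞ := ENNReal.ofReal_ne_top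
  -- Rotated back by `θ`, the ball of radius `δ / 2` about each admissible `z` lies in `W`.
  -- Conversely `δ / 2 ≤ 1 - |w| ≤ (b + 1) δ` on `W`, which is the range of radii in the hypothesis
  -- on `E`.
  set W : Set ℂ := ball ((1 - δ : ℝ) : ℂ) (b * δ) ∩ ball 0 (1 - δ / 2) with hW
  have hWm : MeasurableSet W := measurableSet_ball.inter measurableSet_ball
  have hmeas : Measurable fun x : ℝ × ℂ => ‖f (Complex.exp (x.1 * Complex.I) * x.2)‖ₑ ^ P := by
    refine Measurable.pow_const (Measurable.enorm (hf.measurable.comp ?_)) _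
    exact Continuous.measurable (by fun_prop)
  set J : ℝ → ℝ≥0∞ := fun θ => ∫⁻ w in W, ‖f (Complex.exp (θ * Complex.I) * w)‖ₑ ^ P with hJ
  have hJm : Measurable J := hmeas.lintegral_prod_right'
  refine ⟨fun θ => (C₀ * D⁻¹ * J θ) ^ (1 / P), (hJm.const_mul _).pow_const _,
    fun θ z hz hzθ => ?_, ?_⟩
  · have hball : ball z (δ / 2) ⊆ ball 0 1 := by
      refine ball_subset_ball' ?_
      rw [dist_zero_right]; linarith
    have h1 := hsub f z (δ / 2) (half_pos hδ) (hf.1.mono hball)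
    have h2 : ∫⁻ w in ball z (δ / 2), ‖f w‖ₑ ^ P ≤ J θ := by
      refine lintegral_ball_le_rotate (θ := θ) hWm fun w hw => ?_
      have hexp := Complex.norm_exp_ofReal_mul_I θ
      rw [mem_ball_iff_norm] at hw
      refine ⟨?_, ?_⟩
      · rw [mem_ball_iff_norm]
        calc ‖w - (1 - δ : ℝ)‖ = ‖Complex.exp (θ * Complex.I) * (w - (1 - δ : ℝ))‖ := by
              rw [norm_mul, hexp, one_mul]
          _ = ‖(Complex.exp (θ * Complex.I) * w - z) +
              (z - (1 - δ : ℝ) * Complex.exp (θ * Complex.I))‖ := by congr 1; ring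
          _ ≤ _ := norm_add_le _ _
          _ < b * δ := by nlinarith
      · rw [mem_ball_zero_iff]
        calc ‖w‖ = ‖Complex.exp (θ * Complex.I) * w‖ := by rw [norm_mul, hexp, one_mul]
          _ = ‖(Complex.exp (θ * Complex.I) * w - z) + z‖ := by congr 1; ring
          _ ≤ _ := norm_add_le _ _
          _ < 1 - δ / 2 := by linarith
    rw [one_div, ENNReal.le_rpow_inv_iff hP0]
    rw [← ENNReal.le_div_iff_mul_le (Or.inl hD0) (Or.inl hDtop)] at h1
    refine h1.trans ?_
    rw [ENNReal.div_eq_inv_mul, ← mul_assoc, mul_comm D⁻¹]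
    gcongr
  · set d : ℝ≥0∞ := ENNReal.ofReal ((δ / 2) ^ α) with hd
    have hd0 : d ≠ 0 := by rw [hd, Ne, ENNReal.ofReal_eq_zero, not_le]; positivity
    -- By Fubini, the inner integral over `θ` is the `p`-th power of the integral mean of `f` at
    -- radius `|w|`.
    have hint : ∫⁻ θ, J θ ∂angleMeasure ≤ volume W * (E / d) ^ P := by
      rw [hJ, lintegral_lintegral_swap hmeas.aemeasurable]
      rw [mul_comm, ← setLIntegral_const]
      refine setLIntegral_mono' hWm fun w hw => ?_
      rw [integralMean_eq_of_norm (fun x => x ^ P) f w, ← integralMean_rpow hp hp']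
      have hw2 : ‖w‖ < 1 - δ / 2 := by simpa using hw.2
      have hw1 := mem_ball_iff_norm.1 hw.1
      have hw3 : 1 - δ - b * δ < ‖w‖ := by
        have := norm_sub_norm_le ((1 - δ : ℝ) : ℂ) w
        rw [Complex.norm_real, Real.norm_of_nonneg (by linarith), norm_sub_rev] at this
        linarith
      have h3 := hE ‖w‖ ⟨norm_nonneg w, by linarith⟩ (by linarith) (by linarith)
      gcongr
      rw [ENNReal.le_div_iff_mul_le (Or.inl hd0) (Or.inl ENNReal.ofReal_ne_top)]
      refine le_trans ?_ h3
      rw [mul_comm, hd]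
      gcongr
      linarith
    have hvol : D⁻¹ * volume W ≤ ENNReal.ofReal (4 * b ^ 2 * Real.pi) := by
      rw [← ENNReal.div_eq_inv_mul]
      refine ENNReal.div_le_of_le_mul ?_
      refine (measure_mono inter_subset_left).trans ?_
      rw [Complex.volume_ball, hD, ← ENNReal.ofReal_mul (by positivity),
        ← ENNReal.ofReal_pow (by positivity), ← ENNReal.ofReal_coe_nnreal,
        ← ENNReal.ofReal_mul (by positivity)]
      refine ENNReal.ofReal_le_ofReal (le_of_eq ?_)
      rw [NNReal.coe_real_pi]
      ring
    have hnorm : eLpNorm (fun θ => (C₀ * D⁻¹ * J θ) ^ (1 / P)) p angleMeasure ≤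
        A ^ (1 / P) * (E / d) := by
      rw [eLpNorm_eq_lintegral_rpow_enorm_toReal hp hp', ← hP]
      simp only [enorm_eq_self, ← ENNReal.rpow_mul, one_div, inv_mul_cancel₀ hP0.ne',
        ENNReal.rpow_one]
      rw [lintegral_const_mul _ hJm, ENNReal.rpow_inv_le_iff hP0,
        ENNReal.mul_rpow_of_nonneg _ _ hP0.le, ← ENNReal.rpow_mul, inv_mul_cancel₀ hP0.ne',
        ENNReal.rpow_one]
      calc C₀ * D⁻¹ * ∫⁻ θ, J θ ∂angleMeasure ≤ C₀ * D⁻¹ * (volume W * (E / d) ^ P) := by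
            gcongr
        _ = C₀ * (D⁻¹ * volume W) * (E / d) ^ P := by ring
        _ ≤ _ := by rw [hA]; gcongr
    calc _ ≤ A ^ (1 / P) * (E / d) * ENNReal.ofReal (δ ^ α) := by gcongr
      _ = A ^ (1 / P) * ENNReal.ofReal (2 ^ α) * (E / d * d) := by
          have : ENNReal.ofReal (δ ^ α) = ENNReal.ofReal (2 ^ α) * d := by
            rw [hd, ← ENNReal.ofReal_mul (by positivity), ← Real.mul_rpow (by positivity)
              (by positivity)]
            congr 2
            ring
          rw [this]
          ring
      _ = _ := by rw [ENNReal.div_mul_cancel hd0 ENNReal.ofReal_ne_top]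

theorem norm_sub_circle_le {z : ℂ} {r θ₀ θ : ℝ} (hr : 0 ≤ r) (hr1 : r ≤ 1)
    (hz : z = r * Complex.exp (θ₀ * Complex.I)) :
    ‖z - r * Complex.exp (θ * Complex.I)‖ ≤ |θ - θ₀| := by
  have h1 : z - r * Complex.exp (θ * Complex.I) =
      -((r * Complex.exp (θ₀ * Complex.I)) * (Complex.exp (Complex.I * (θ - θ₀ : ℝ)) - 1)) := by
    have h2 : Complex.exp (θ * Complex.I) =
        Complex.exp (θ₀ * Complex.I) * Complex.exp (Complex.I * (θ - θ₀ : ℝ)) := by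
      rw [← Complex.exp_add]
      congr 1
      push_cast
      ring
    rw [hz, h2]
    ring
  rw [h1, norm_neg, norm_mul, norm_mul_exp hr]
  have h3 := Real.norm_exp_I_mul_ofReal_sub_one_le (x := θ - θ₀)
  rw [Real.norm_eq_abs] at h3
  calc r * _ ≤ 1 * |θ - θ₀| := by gcongr
    _ = _ := one_mul _

/-- According to the sign of `arg z`, the arc begins at `arg z` or ends at `arg z + 2π`, so that it
never leaves `(0, 2π]`. -/
theorem exists_arc (z : ℂ) {δ : ℝ} (hδ : 0 < δ) (hδ1 : δ ≤ 1) (hz : ‖z‖ = 1 - δ) :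
    ∃ a : ℝ, Ioc a (a + δ) ⊆ Ioc 0 (2 * Real.pi) ∧ ∀ θ ∈ Ioc a (a + δ),
      ‖z - (1 - δ : ℝ) * Complex.exp (θ * Complex.I)‖ ≤ δ := by
  have hpi := Real.pi_gt_three
  have hr : 0 ≤ 1 - δ := by linarith
  have hz1 : z = ((1 - δ : ℝ) : ℂ) * Complex.exp (z.arg * Complex.I) := by
    rw [← hz, Complex.norm_mul_exp_arg_mul_I]
  have hz2 : z = ((1 - δ : ℝ) : ℂ) * Complex.exp ((z.arg + 2 * Real.pi : ℝ) * Complex.I) := by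
    conv_lhs => rw [hz1, ← Complex.exp_periodic (z.arg * Complex.I)]
    congr 2
    push_cast
    ring
  rcases lt_or_ge 0 z.arg with h | h
  · refine ⟨z.arg, ?_, fun θ hθ => (norm_sub_circle_le hr (by linarith) hz1).trans ?_⟩
    · refine Ioc_subset_Ioc h.le ?_
      linarith [Complex.arg_le_pi z]
    · rw [abs_le]
      constructor <;> linarith [hθ.1, hθ.2]
  · refine ⟨z.arg + 2 * Real.pi - δ, ?_,
      fun θ hθ => (norm_sub_circle_le hr (by linarith) hz2).trans ?_⟩
    · refine Ioc_subset_Ioc ?_ (by linarith)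
      linarith [Complex.neg_pi_lt_arg z]
    · rw [abs_le]
      constructor <;> linarith [hθ.1, hθ.2]

/-- The maximal function dominates `|f(z)|` on an arc of length `1 - |z|`, and its `L^p` norm is
controlled; the arc accounts for the extra power `1/p`. For `p = ∞` the convention `p.toReal = 0`
gives `1 / p.toReal = 0`, the correct exponent. The factor 3 is `b + 1` with `b = 2`. -/
theorem exists_enorm_le {p : ℝ≥0∞} (hp : p ≠ 0) {α : ℝ} (hα : 0 < α) :
    ∃ C : ℝ≥0∞, C ≠ ∞ ∧ ∀ f : ℂ → ℂ, IsHolo f → ∀ z : ℂ, ‖z‖ < 1 → ∀ E : ℝ≥0∞,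
      (∀ s ∈ Ico (0 : ℝ) 1, 1 - s ≤ 3 * (1 - ‖z‖) →
        ENNReal.ofReal ((1 - s) ^ α) * integralMean p s f ≤ E) →
      ‖f z‖ₑ * ENNReal.ofReal ((1 - ‖z‖) ^ (α + 1 / p.toReal)) ≤ C * E := by
  obtain ⟨C, hC, h⟩ := exists_maximal_bound hp hα (b := 2) one_le_two
  have hpi := Real.pi_pos
  refine ⟨C * ENNReal.ofReal ((2 * Real.pi) ^ (1 / p.toReal)),
    ENNReal.mul_ne_top hC ENNReal.ofReal_ne_top, fun f hf z hz E hE => ?_⟩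
  set δ := 1 - ‖z‖ with hδ
  have hδ0 : 0 < δ := by linarith
  have hδ1 : δ ≤ 1 := by linarith [norm_nonneg z]
  have hzδ : ‖z‖ = 1 - δ := by linarith
  obtain ⟨B, hBm, hB, hBn⟩ := h f hf δ hδ0 hδ1 E fun s hs _ hs2 => hE s hs (by linarith)
  obtain ⟨a, ha1, ha2⟩ := exists_arc z hδ0 hδ1 hzδ
  set I := Ioc a (a + δ) with hI
  have hμ : angleMeasure I = ENNReal.ofReal (δ / (2 * Real.pi)) := by
    rw [angleMeasure, Measure.smul_apply, Measure.restrict_apply measurableSet_Ioc,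
      inter_eq_self_of_subset_left ha1, hI, Real.volume_Ioc, smul_eq_mul,
      ← ENNReal.ofReal_mul (by positivity)]
    congr 1
    ring
  have hμ0 : angleMeasure I ≠ 0 := by
    rw [hμ, Ne, ENNReal.ofReal_eq_zero, not_le]
    positivity
  have h1 : ‖f z‖ₑ * angleMeasure I ^ (1 / p.toReal) ≤ eLpNorm B p angleMeasure := by
    rw [← eLpNorm_indicator_const' measurableSet_Ioc hμ0 hp]
    refine eLpNorm_mono_enorm fun θ => ?_
    by_cases hθ : θ ∈ I
    · rw [indicator_of_mem hθ, enorm_eq_self]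
      exact hB θ z hzδ.le ((ha2 θ hθ).trans (by linarith))
    · rw [indicator_of_notMem hθ]
      simp
  have h2 : ENNReal.ofReal (δ ^ (α + 1 / p.toReal)) = ENNReal.ofReal (δ ^ α) *
      (ENNReal.ofReal ((2 * Real.pi) ^ (1 / p.toReal)) * angleMeasure I ^ (1 / p.toReal)) := by
    rw [hμ, ENNReal.ofReal_rpow_of_nonneg (by positivity) (by positivity),
      ← ENNReal.ofReal_mul (by positivity), ← ENNReal.ofReal_mul (by positivity),
      Real.rpow_add hδ0, ← Real.mul_rpow (by positivity) (by positivity)]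
    congr 3
    field_simp
  calc _ = (‖f z‖ₑ * angleMeasure I ^ (1 / p.toReal)) * ENNReal.ofReal (δ ^ α) *
        ENNReal.ofReal ((2 * Real.pi) ^ (1 / p.toReal)) := by rw [h2]; ring
    _ ≤ eLpNorm B p angleMeasure * ENNReal.ofReal (δ ^ α) *
        ENNReal.ofReal ((2 * Real.pi) ^ (1 / p.toReal)) := by gcongr
    _ ≤ C * E * ENNReal.ofReal ((2 * Real.pi) ^ (1 / p.toReal)) := by gcongr
    _ = _ := by ring

/-- Cauchy's estimate on the circle of radius `(1 - |z|) / 2`. There `1 - |w| ≤ (3/2)(1 - |z|)`, so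
the pointwise bound uses radii with `1 - s ≤ (9/2)(1 - |z|)`, which 5 covers. -/
theorem exists_norm_deriv_le {p : ℝ≥0∞} (hp : p ≠ 0) {α : ℝ} (hα : 0 < α) :
    ∃ C : ℝ, 0 < C ∧ ∀ f : ℂ → ℂ, IsHolo f → ∀ z : ℂ, ‖z‖ < 1 → ∀ E : ℝ, 0 ≤ E →
      (∀ s ∈ Ico (0 : ℝ) 1, 1 - s ≤ 5 * (1 - ‖z‖) →
        ENNReal.ofReal ((1 - s) ^ α) * integralMean p s f ≤ ENNReal.ofReal E) →
      ‖deriv f z‖ * (1 - ‖z‖) ^ (α + 1 / p.toReal + 1) ≤ C * E := by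
  obtain ⟨C, hC, h⟩ := exists_enorm_le hp hα
  set β := α + 1 / p.toReal with hβ
  have hβ0 : 0 < β := by positivity
  refine ⟨2 ^ (β + 1) * (C.toReal + 1), by positivity, fun f hf z hz E hE0 hE => ?_⟩
  set δ := 1 - ‖z‖ with hδ
  have hδ0 : 0 < δ := by linarith
  have hcb : closedBall z (δ / 2) ⊆ ball 0 1 := by
    refine closedBall_subset_ball' ?_
    rw [dist_zero_right]; linarith
  have h1 : ∀ w ∈ sphere z (δ / 2), ‖f w‖ ≤ C.toReal * E / (δ / 2) ^ β := by
    intro w hw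
    have hwz : ‖w - z‖ = δ / 2 := mem_sphere_iff_norm.1 hw
    have hw1 : ‖w‖ ≤ ‖z‖ + δ / 2 := by
      have := norm_add_le z (w - z)
      rwa [add_sub_cancel, hwz] at this
    have hw2 : ‖z‖ - δ / 2 ≤ ‖w‖ := by
      have := norm_sub_le w (w - z)
      rw [sub_sub_cancel, hwz] at this
      linarith
    have h2 := h f hf w (by linarith) (ENNReal.ofReal E) fun s hs hs2 => hE s hs (by linarith)
    rw [le_div_iff₀ (by positivity)]
    rw [← ofReal_norm, ← ENNReal.ofReal_mul (norm_nonneg _)] at h2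
    have h3 := ENNReal.toReal_mono (ENNReal.mul_ne_top hC ENNReal.ofReal_ne_top) h2
    rw [ENNReal.toReal_mul, ENNReal.toReal_ofReal hE0, ENNReal.toReal_ofReal
      (mul_nonneg (norm_nonneg _) (Real.rpow_nonneg (by linarith) _))] at h3
    refine le_trans ?_ h3
    gcongr
    linarith
  have h2 := Complex.norm_deriv_le_of_forall_mem_sphere_norm_le (half_pos hδ0)
    ((hf.1.mono (closure_ball_subset_closedBall.trans hcb)).diffContOnCl) h1
  calc ‖deriv f z‖ * δ ^ (β + 1) ≤ C.toReal * E / (δ / 2) ^ β / (δ / 2) * δ ^ (β + 1) := by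
        gcongr
    _ = 2 ^ (β + 1) * C.toReal * E := by
        rw [Real.div_rpow hδ0.le (by norm_num), Real.rpow_add_one hδ0.ne',
          Real.rpow_add_one two_ne_zero]
        field_simp
    _ ≤ _ := by
        rw [mul_assoc, mul_assoc]
        gcongr
        linarith

end

/-! ### The integral operator -/

section

variable {p : ℝ≥0∞} {α : ℝ} {f g : ℂ → ℂ}

theorem ofReal_mul_mem_ball {z : ℂ} (hz : z ∈ ball (0 : ℂ) 1) {t : ℝ} (ht : t ∈ Icc (0 : ℝ) 1) :
    (t : ℂ) * z ∈ ball (0 : ℂ) 1 := by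
  rw [mem_ball_zero_iff] at hz ⊢
  rw [norm_mul, Complex.norm_real, Real.norm_of_nonneg ht.1]
  nlinarith [ht.1, ht.2, norm_nonneg z]

/-- A holomorphic function on the disk has a primitive, which the fundamental theorem of calculus on
the segment from 0 to `z` identifies with `T_g f`. This gives holomorphy and `(T_g f)' = f g'`. -/
theorem exists_primitive (hf : IsHolo f) (hg : DifferentiableOn ℂ g (ball 0 1)) :
    ∃ F : ℂ → ℂ, F 0 = 0 ∧ (∀ z ∈ ball (0 : ℂ) 1, HasDerivAt F (f z * deriv g z) z) ∧
      ∀ z ∈ ball (0 : ℂ) 1, integralOp g f z = F z := by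
  have hd : DifferentiableOn ℂ (fun z => f z * deriv g z) (ball 0 1) :=
    hf.1.mul (hg.deriv isOpen_ball)
  obtain ⟨F, hF, hF0⟩ := hd.isExactOn_ball.with_val_at 0 0
  refine ⟨F, hF, hF0, fun z hz => ?_⟩
  rw [integralOp, indicator_of_mem hz]
  have h1 : ∀ t ∈ uIcc (0 : ℝ) 1, HasDerivAt (fun t : ℝ => F (t * z))
      (f (t * z) * deriv g (t * z) * z) t := by
    intro t ht
    rw [uIcc_of_le zero_le_one] at ht
    have h2 : HasDerivAt (fun t : ℝ => (t : ℂ) * z) z t := by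
      simpa using (Complex.ofRealCLM.hasDerivAt (x := t)).mul_const z
    have h3 := (hF0 _ (ofReal_mul_mem_ball hz ht)).comp t h2
    exact h3
  rw [intervalIntegral.integral_eq_sub_of_hasDerivAt h1]
  · simp [hF]
  · refine ContinuousOn.intervalIntegrable ?_
    rw [uIcc_of_le zero_le_one]
    refine ContinuousOn.mul ?_ continuousOn_const
    exact hd.continuousOn.comp (by fun_prop) fun t ht => ofReal_mul_mem_ball hz ht

theorem hasDerivAt_integralOp (hf : IsHolo f) (hg : DifferentiableOn ℂ g (ball 0 1)) {z : ℂ}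
    (hz : z ∈ ball (0 : ℂ) 1) : HasDerivAt (integralOp g f) (f z * deriv g z) z := by
  obtain ⟨F, -, hF, hFe⟩ := exists_primitive hf hg
  refine (hF z hz).congr_of_eventuallyEq ?_
  filter_upwards [isOpen_ball.mem_nhds hz] with w hw using hFe w hw

theorem integralOp_zero_eq (g f : ℂ → ℂ) : integralOp g f 0 = 0 := by
  simp [integralOp]

theorem isHolo_integralOp (hf : IsHolo f) (hg : DifferentiableOn ℂ g (ball 0 1)) :
    IsHolo (integralOp g f) :=
  ⟨fun _ hz => (hasDerivAt_integralOp hf hg hz).differentiableAt.differentiableWithinAt,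
    fun _ hz => indicator_of_notMem hz _⟩

theorem intervalIntegrable_integralOp (hf : IsHolo f) (hg : DifferentiableOn ℂ g (ball 0 1)) {z : ℂ}
    (hz : z ∈ ball (0 : ℂ) 1) : IntervalIntegrable
      (fun t : ℝ => f (t * z) * deriv g (t * z) * z) volume 0 1 := by
  refine ContinuousOn.intervalIntegrable ?_
  rw [uIcc_of_le zero_le_one]
  refine ContinuousOn.mul ?_ continuousOn_const
  exact (hf.1.mul (hg.deriv isOpen_ball)).continuousOn.comp (by fun_prop)
    fun t ht => ofReal_mul_mem_ball hz ht

theorem integralOp_add {f₁ f₂ : ℂ → ℂ} (h₁ : IsHolo f₁) (h₂ : IsHolo f₂)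
    (hg : DifferentiableOn ℂ g (ball 0 1)) :
    integralOp g (f₁ + f₂) = integralOp g f₁ + integralOp g f₂ := by
  ext z
  by_cases hz : z ∈ ball (0 : ℂ) 1
  · simp only [integralOp, Pi.add_apply, indicator_of_mem hz]
    rw [← intervalIntegral.integral_add (intervalIntegrable_integralOp h₁ hg hz)
      (intervalIntegrable_integralOp h₂ hg hz)]
    congr 1
    ext t
    ring
  · simp [integralOp, indicator_of_notMem hz]

theorem integralOp_smul (c : ℂ) (g f : ℂ → ℂ) : integralOp g (c • f) = c • integralOp g f := by
  ext z
  by_cases hz : z ∈ ball (0 : ℂ) 1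
  · simp only [integralOp, Pi.smul_apply, indicator_of_mem hz, smul_eq_mul]
    rw [← intervalIntegral.integral_const_mul]
    congr 1
    ext t
    ring
  · simp [integralOp, indicator_of_notMem hz]

/-- The weighted integral mean `(1 - r)^α M_p(r, f)`. -/
def weightedMean (p : ℝ≥0∞) (α r : ℝ) (f : ℂ → ℂ) : ℝ≥0∞ :=
  ENNReal.ofReal ((1 - r) ^ α) * integralMean p r f

theorem weightedMean_le_iff {D : ℝ≥0∞} : mixedNorm p α f ≤ D ↔
    ∀ r ∈ Ico (0 : ℝ) 1, weightedMean p α r f ≤ D := iSup₂_le_iff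

theorem integralMean_le_of_forall_norm_le {r : ℝ} (hr : 0 ≤ r) {c : ℝ≥0∞}
    (h : ∀ z : ℂ, ‖z‖ = r → ‖f z‖ₑ ≤ c) : integralMean p r f ≤ c := by
  refine (eLpNorm_le_of_ae_enorm_bound (C := c)
    (Eventually.of_forall fun θ => h _ (norm_mul_exp hr θ))).trans ?_
  simp

/-- Mean value inequality on a radial segment of length at most `(b - 1)(1 - r)`, on which `|f| ≤ B`
and `|g'| ≤ G / (1 - r)`. -/
theorem enorm_integralOp_sub_le (hf : IsHolo f) (hg : DifferentiableOn ℂ g (ball 0 1))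
    {r r' b θ G : ℝ} {B : ℝ≥0∞} (hr' : 0 ≤ r') (hrr : r' ≤ r) (hr : r < 1) (hb : 1 < b)
    (hrb : r - r' ≤ (b - 1) * (1 - r)) (hG : 0 < G)
    (hGz : ∀ z : ℂ, r' ≤ ‖z‖ → ‖z‖ ≤ r → (1 - ‖z‖) * ‖deriv g z‖ ≤ G)
    (hB : ∀ z : ℂ, ‖z‖ ≤ r → ‖z - r * Complex.exp (θ * Complex.I)‖ ≤ (b - 1) * (1 - r) →
      ‖f z‖ₑ ≤ B) :
    ‖integralOp g f (r * Complex.exp (θ * Complex.I)) -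
      integralOp g f (r' * Complex.exp (θ * Complex.I))‖ₑ ≤ ENNReal.ofReal (G * (b - 1)) * B := by
  have hδ : 0 < 1 - r := by linarith
  by_cases hBt : B = ∞
  · rw [hBt, ENNReal.mul_top]
    · exact le_top
    · rw [Ne, ENNReal.ofReal_eq_zero, not_le]
      exact mul_pos hG (by linarith)
  have hexp := Complex.norm_exp_ofReal_mul_I θ
  set e := Complex.exp (θ * Complex.I) with he
  have hmem : ∀ s ∈ Icc r' r, (s : ℂ) * e ∈ ball (0 : ℂ) 1 := by
    intro s hs
    rw [mem_ball_zero_iff, he, norm_mul_exp (hr'.trans hs.1)]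
    linarith [hs.2]
  have hder : ∀ s ∈ Icc r' r, HasDerivWithinAt (fun s : ℝ => integralOp g f (s * e))
      (f (s * e) * deriv g (s * e) * e) (Icc r' r) s := by
    intro s hs
    have h2 : HasDerivAt (fun t : ℝ => (t : ℂ) * e) e s := by
      simpa using (Complex.ofRealCLM.hasDerivAt (x := s)).mul_const e
    exact ((hasDerivAt_integralOp hf hg (hmem s hs)).comp s h2).hasDerivWithinAt
  have hbd : ∀ s ∈ Icc r' r, ‖f (s * e) * deriv g (s * e) * e‖ ≤ B.toReal * (G / (1 - r)) := by
    intro s hs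
    have hn : ‖(s : ℂ) * e‖ = s := norm_mul_exp (hr'.trans hs.1) θ
    rw [norm_mul, norm_mul, hexp, mul_one]
    have h1 : ‖f (s * e)‖ ≤ B.toReal := by
      rw [← toReal_enorm]
      refine ENNReal.toReal_mono hBt (hB _ (by rw [hn]; exact hs.2) ?_)
      rw [← sub_mul, norm_mul, hexp, mul_one, ← Complex.ofReal_sub, Complex.norm_real,
        Real.norm_eq_abs, abs_sub_comm, abs_of_nonneg (by linarith [hs.2])]
      linarith [hs.1]
    have h2 : ‖deriv g (s * e)‖ ≤ G / (1 - r) := by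
      rw [le_div_iff₀ hδ, mul_comm]
      refine le_trans ?_ (hGz (s * e) (by rw [hn]; exact hs.1) (by rw [hn]; exact hs.2))
      rw [hn]
      gcongr
      exact hs.2
    gcongr
  have h3 := (convex_Icc r' r).norm_image_sub_le_of_norm_hasDerivWithin_le hder hbd
    (left_mem_Icc.2 hrr) (right_mem_Icc.2 hrr)
  rw [Real.norm_of_nonneg (by linarith)] at h3
  rw [← ofReal_norm, ← ENNReal.ofReal_toReal hBt, ← ENNReal.ofReal_mul
    (mul_nonneg hG.le (by linarith))]
  refine ENNReal.ofReal_le_ofReal (h3.trans ?_)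
  calc B.toReal * (G / (1 - r)) * (r - r') ≤
        B.toReal * (G / (1 - r)) * ((b - 1) * (1 - r)) := by gcongr
    _ = _ := by field_simp

/-- The recursive estimate for the weighted means of `T_g f`. -/
theorem exists_weightedMean_integralOp_le (hp : p ≠ 0) (hα : 0 < α) :
    ∃ b : ℝ, 1 < b ∧ ∃ C : ℝ≥0∞, C ≠ ∞ ∧ ∀ g f : ℂ → ℂ, DifferentiableOn ℂ g (ball 0 1) →
      IsHolo f → ∀ r ∈ Ico (0 : ℝ) 1, ∀ G : ℝ, 0 < G → ∀ E : ℝ≥0∞,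
      (∀ z : ℂ, max 0 (1 - b * (1 - r)) ≤ ‖z‖ → ‖z‖ ≤ r → (1 - ‖z‖) * ‖deriv g z‖ ≤ G) →
      (∀ s ∈ Ico (0 : ℝ) 1, (1 - r) / 2 ≤ 1 - s → 1 - s ≤ (b + 1) * (1 - r) →
        weightedMean p α s f ≤ E) →
      weightedMean p α r (integralOp g f) ≤
        2⁻¹ * weightedMean p α (max 0 (1 - b * (1 - r))) (integralOp g f) +
          C * (ENNReal.ofReal G * E) := by
  set K := ENNReal.LpAddConst p with hK
  have hKt : K ≠ ∞ := (ENNReal.LpAddConst_lt_top p).ne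
  -- Large enough that `K ≤ b^α / 2`: moving inwards multiplies the distance to the circle by `b`,
  -- so the weight gains `b^α`, which absorbs the quasi-triangle constant and leaves the contraction
  -- factor `1/2`.
  set b : ℝ := max 2 ((2 * K.toReal) ^ (1 / α)) with hb
  have hb2 : 2 ≤ b := le_max_left _ _
  have hb0 : 0 < b := by linarith
  have hKb : K ≤ ENNReal.ofReal (2⁻¹ * b ^ α) := by
    rw [← ENNReal.ofReal_toReal hKt]
    refine ENNReal.ofReal_le_ofReal ?_
    have h1 : ((2 * K.toReal) ^ (1 / α)) ^ α ≤ b ^ α := by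
      gcongr
      exact le_max_right _ _
    rw [← Real.rpow_mul (by positivity), one_div, inv_mul_cancel₀ hα.ne', Real.rpow_one] at h1
    linarith
  obtain ⟨C, hC, hmax⟩ := exists_maximal_bound hp hα (b := b) (by linarith)
  refine ⟨b, by linarith, K * ENNReal.ofReal (b - 1) * C,
    ENNReal.mul_ne_top (ENNReal.mul_ne_top hKt ENNReal.ofReal_ne_top) hC,
    fun g f hg hf r hr G hG E hGz hE => ?_⟩
  have hδ : 0 < 1 - r := by linarith [hr.2]
  have hδ1 : 1 - r ≤ 1 := by linarith [hr.1]
  set r' := max 0 (1 - b * (1 - r)) with hr'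
  have hr'0 : 0 ≤ r' := le_max_left _ _
  have hr'1 : 1 - b * (1 - r) ≤ r' := le_max_right _ _
  have hrr : r' ≤ r := max_le hr.1 (by nlinarith)
  obtain ⟨B, hBm, hB, hBn⟩ := hmax f hf (1 - r) hδ hδ1 E hE
  rw [sub_sub_cancel] at hB
  set F := integralOp g f with hF
  have hFh : IsHolo F := isHolo_integralOp hf hg
  have hdiff : ∀ θ : ℝ, ‖F (r * Complex.exp (θ * Complex.I)) -
      F (r' * Complex.exp (θ * Complex.I))‖ₑ ≤ ENNReal.ofReal (G * (b - 1)) * B θ := fun θ =>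
    enorm_integralOp_sub_le hf hg hr'0 hrr hr.2 (by linarith) (by linarith) hG hGz
      fun z hz hz2 => hB θ z hz hz2
  have hm1 := hFh.aestronglyMeasurable hr
  have hm2 := hFh.aestronglyMeasurable (r := r') ⟨hr'0, hrr.trans_lt hr.2⟩
  have h1 : integralMean p r F ≤ K * (integralMean p r' F +
      ENNReal.ofReal (G * (b - 1)) * eLpNorm B p angleMeasure) := by
    have h2 := eLpNorm_add_le' hm2 (hm1.sub hm2) p
    rw [add_sub_cancel] at h2
    refine h2.trans ?_
    gcongr
    · rfl
    · refine (eLpNorm_le_mul_eLpNorm_of_ae_le_mul'' p hBm.aestronglyMeasurable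
        (c := (ENNReal.ofReal (G * (b - 1)))) ?_)
      exact Eventually.of_forall fun θ => by simpa using hdiff θ
  have h3 : ENNReal.ofReal ((1 - r) ^ α) * (K * integralMean p r' F) ≤
      2⁻¹ * weightedMean p α r' F := by
    rcases le_total 0 (1 - b * (1 - r)) with h | h
    · have h4 : r' = 1 - b * (1 - r) := max_eq_right h
      have h5 : (1 - r') ^ α = b ^ α * (1 - r) ^ α := by
        rw [h4, sub_sub_cancel, Real.mul_rpow hb0.le hδ.le]
      rw [weightedMean, h5]
      calc _ ≤ ENNReal.ofReal ((1 - r) ^ α) *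
            (ENNReal.ofReal (2⁻¹ * b ^ α) * integralMean p r' F) := by gcongr
        _ = _ := by
          rw [ENNReal.ofReal_mul (by positivity), ENNReal.ofReal_mul (by positivity),
            ENNReal.ofReal_inv_of_pos two_pos]
          simp only [ENNReal.ofReal_ofNat]
          ring
    -- If the inward step would pass the centre, it stops there, and `T_g f` vanishes at 0.
    · have h4 : r' = 0 := max_eq_left h
      have h5 : integralMean p r' F = 0 := by
        rw [h4]
        refine le_antisymm (integralMean_le_of_forall_norm_le le_rfl fun z hz => ?_) zero_le
        rw [norm_eq_zero.1 hz, hF, integralOp_zero_eq]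
        simp
      rw [h5]
      simp
  calc weightedMean p α r F ≤ ENNReal.ofReal ((1 - r) ^ α) * (K * (integralMean p r' F +
        ENNReal.ofReal (G * (b - 1)) * eLpNorm B p angleMeasure)) := by
        rw [weightedMean]; gcongr
    _ = ENNReal.ofReal ((1 - r) ^ α) * (K * integralMean p r' F) +
        K * ENNReal.ofReal (b - 1) * ENNReal.ofReal G *
          (eLpNorm B p angleMeasure * ENNReal.ofReal ((1 - r) ^ α)) := by
        rw [ENNReal.ofReal_mul hG.le]; ring
    _ ≤ 2⁻¹ * weightedMean p α r' F + K * ENNReal.ofReal (b - 1) * ENNReal.ofReal G * (C * E) := by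
        gcongr
    _ = _ := by ring

end

/-! ### Boundedness of the integral operator -/

section

variable {p : ℝ≥0∞} {α : ℝ} {f g : ℂ → ℂ}

/-- The data entering the recursive estimate for `T_g f` on the circle of radius `r`: a bound for
`(1 - |z|) |g'(z)|` and one for the weighted means of `f`, on the relevant annuli, whose product
is at most `D`. -/
def LocalBound (p : ℝ≥0∞) (α b : ℝ) (g f : ℂ → ℂ) (r : ℝ) (D : ℝ≥0∞) : Prop :=
  ∃ G : ℝ, 0 < G ∧ ∃ E : ℝ≥0∞,
    (∀ z : ℂ, max 0 (1 - b * (1 - r)) ≤ ‖z‖ → ‖z‖ ≤ r → (1 - ‖z‖) * ‖deriv g z‖ ≤ G) ∧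
    (∀ s ∈ Ico (0 : ℝ) 1, (1 - r) / 2 ≤ 1 - s → 1 - s ≤ (b + 1) * (1 - r) →
      weightedMean p α s f ≤ E) ∧ ENNReal.ofReal G * E ≤ D

theorem tendsto_max_sub_mul {b : ℝ} (hb : 0 < b) :
    Tendsto (fun r : ℝ => max 0 (1 - b * (1 - r))) (𝓝[<] 1) (𝓝[<] 1) := by
  refine tendsto_nhdsWithin_iff.2 ⟨?_, ?_⟩
  · have : Tendsto (fun r : ℝ => max 0 (1 - b * (1 - r))) (𝓝 1) (𝓝 (max 0 (1 - b * (1 - 1)))) :=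
      Continuous.tendsto (by fun_prop) 1
    simp only [sub_self, mul_zero, sub_zero, zero_le_one, sup_of_le_right] at this
    exact this.mono_left nhdsWithin_le_nhds
  · filter_upwards [self_mem_nhdsWithin] with r hr
    have h1 : 0 < b * (1 - r) := mul_pos hb (sub_pos.2 hr)
    have h2 : 1 - b * (1 - r) < 1 := by linarith
    exact max_lt one_pos h2

theorem exists_integralOp_estimates (hp : p ≠ 0) (hα : 0 < α) :
    ∃ b : ℝ, 1 < b ∧ ∃ C : ℝ≥0∞, C ≠ ∞ ∧ ∀ g f : ℂ → ℂ, DifferentiableOn ℂ g (ball 0 1) →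
      IsHolo f →
      (∀ D : ℝ≥0∞, (∀ r ∈ Ico (0 : ℝ) 1, LocalBound p α b g f r D) →
        mixedNorm p α (integralOp g f) ≤ C * D) ∧
      (mixedNorm p α (integralOp g f) < ∞ →
        (∀ ε : ℝ≥0∞, 0 < ε → ∀ᶠ r in 𝓝[<] (1 : ℝ), LocalBound p α b g f r ε) →
        Tendsto (fun r => weightedMean p α r (integralOp g f)) (𝓝[<] 1) (𝓝 0)) := by
  obtain ⟨b, hb, C, hC, h⟩ := exists_weightedMean_integralOp_le hp hα
  refine ⟨b, hb, 2 * C, ENNReal.mul_ne_top (by simp) hC, fun g f hg hf => ?_⟩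
  set F := integralOp g f with hF
  have hstep : ∀ r ∈ Ico (0 : ℝ) 1, ∀ D, LocalBound p α b g f r D →
      weightedMean p α r F ≤ 2⁻¹ * weightedMean p α (max 0 (1 - b * (1 - r))) F + C * D := by
    rintro r hr D ⟨G, hG, E, h1, h2, h3⟩
    refine (h g f hg hf r hr G hG E h1 h2).trans ?_
    gcongr
  have hhalf : ∀ x : ℝ≥0∞, 2⁻¹ * (2 * x) = x := fun x => by
    rw [← mul_assoc, ENNReal.inv_mul_cancel two_ne_zero ENNReal.ofNat_ne_top, one_mul]
  refine ⟨fun D hD => ?_, fun hfin hloc => ?_⟩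
  -- The condition says that `n` inward steps reach the centre. The bound `2CD` is the fixed point
  -- of `x ↦ x / 2 + CD`, so it survives each step.
  · have key : ∀ n : ℕ, ∀ r ∈ Ico (0 : ℝ) 1, 1 ≤ b ^ n * (1 - r) →
        weightedMean p α r F ≤ 2 * C * D := by
      intro n
      induction n with
      | zero =>
        intro r hr hn
        have hr0 : r = 0 := le_antisymm (by linarith) hr.1
        have : integralMean p r F = 0 := by
          rw [hr0]
          refine le_antisymm (integralMean_le_of_forall_norm_le le_rfl fun z hz => ?_) zero_le
          rw [norm_eq_zero.1 hz, hF, integralOp_zero_eq]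
          simp
        rw [weightedMean, this, mul_zero]
        exact zero_le
      | succ n ih =>
        intro r hr hn
        have hbn : 1 ≤ b ^ n := one_le_pow₀ hb.le
        have h1r : 0 < 1 - r := by linarith [hr.2]
        refine (hstep r hr D (hD r hr)).trans ?_
        have h1 := ih (max 0 (1 - b * (1 - r))) ⟨le_max_left _ _, max_lt one_pos (by nlinarith)⟩ (by
          rcases le_total 0 (1 - b * (1 - r)) with h | h
          · rw [max_eq_right h, sub_sub_cancel]
            rw [pow_succ] at hn
            linarith
          · rw [max_eq_left h]
            linarith)
        calc _ ≤ 2⁻¹ * (2 * C * D) + C * D := by gcongr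
          _ = 2 * C * D := by rw [mul_assoc, hhalf, two_mul]
    refine weightedMean_le_iff.2 fun r hr => ?_
    have h1r : 0 < 1 - r := by linarith [hr.2]
    obtain ⟨n, hn⟩ := pow_unbounded_of_one_lt (1 / (1 - r)) hb
    refine key n r hr ?_
    rw [div_lt_iff₀ h1r] at hn
    exact hn.le
  · have hIco : ∀ᶠ r in 𝓝[<] (1 : ℝ), r ∈ Ico (0 : ℝ) 1 := Ico_mem_nhdsLT zero_lt_one
    -- For a fixed number of steps, all radii involved are still near 1. Each step halves the crude
    -- bound by the norm of `F`, and the errors sum to at most `2CD`.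
    have key : ∀ D : ℝ≥0∞, (∀ᶠ r in 𝓝[<] (1 : ℝ), LocalBound p α b g f r D) → ∀ n : ℕ,
        ∀ᶠ r in 𝓝[<] (1 : ℝ), weightedMean p α r F ≤ mixedNorm p α F * 2⁻¹ ^ n + 2 * (C * D) := by
      intro D hD n
      induction n with
      | zero =>
        filter_upwards [hIco] with r hr
        rw [pow_zero, mul_one]
        exact le_add_right (le_mixedNorm p α hr F)
      | succ n ih =>
        filter_upwards [hIco, hD, (tendsto_max_sub_mul (zero_lt_one.trans hb)).eventually ih]
          with r hr hDr hrn
        refine (hstep r hr D hDr).trans ?_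
        calc _ ≤ 2⁻¹ * (mixedNorm p α F * 2⁻¹ ^ n + 2 * (C * D)) + C * D := by gcongr
          _ = mixedNorm p α F * 2⁻¹ ^ (n + 1) + (C * D + C * D) := by
            rw [mul_add, hhalf, pow_succ]; ring
          _ = _ := by rw [two_mul]
    rw [ENNReal.tendsto_nhds_zero]
    intro ε hε
    obtain ⟨n, hn⟩ : ∃ n : ℕ, mixedNorm p α F * 2⁻¹ ^ n < ε / 2 := by
      have h1 : Tendsto (fun n : ℕ => mixedNorm p α F * (2⁻¹ : ℝ≥0∞) ^ n) atTop (𝓝 0) := by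
        have := ENNReal.Tendsto.const_mul (a := mixedNorm p α F)
          (ENNReal.tendsto_pow_atTop_nhds_zero_of_lt_one (r := 2⁻¹) (by simp)) (Or.inr hfin.ne)
        rwa [mul_zero] at this
      exact (h1.eventually (gt_mem_nhds (ENNReal.half_pos hε.ne'))).exists
    have hε' : 0 < ε / (4 * (C + 1)) := ENNReal.div_pos hε.ne'
      (ENNReal.mul_ne_top (by simp) (ENNReal.add_ne_top.2 ⟨hC, by simp⟩))
    filter_upwards [key _ (hloc _ hε') n] with r hr
    refine hr.trans ?_
    have h2 : 2 * (C * (ε / (4 * (C + 1)))) ≤ ε / 2 := by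
      calc 2 * (C * (ε / (4 * (C + 1)))) ≤ 2 * ((C + 1) * (ε / (4 * (C + 1)))) := by
            gcongr; exact le_self_add
        _ = ε / 2 := by
          have hC1 : C + 1 ≠ 0 := by simp
          have hC2 : C + 1 ≠ ∞ := by simp [hC]
          rw [div_eq_mul_inv, ENNReal.mul_inv (by simp) (by simp)]
          calc 2 * ((C + 1) * (ε * (4⁻¹ * (C + 1)⁻¹))) =
              ε * (2 * 4⁻¹) * ((C + 1) * (C + 1)⁻¹) := by ring
            _ = ε / 2 := by
              rw [ENNReal.mul_inv_cancel hC1 hC2, mul_one, div_eq_mul_inv]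
              congr 1
              rw [show (4 : ℝ≥0∞) = 2 * 2 by norm_num, ENNReal.mul_inv (by simp) (by simp),
                ← mul_assoc, ENNReal.mul_inv_cancel (by simp) (by simp), one_mul]
    calc _ ≤ ε / 2 + ε / 2 := add_le_add hn.le h2
      _ = ε := ENNReal.add_halves ε

theorem one_sub_mul_le {x y : ℝ} (hx : 0 ≤ x) (hx1 : x < 1) (hy : 0 ≤ y) :
    (1 - x) * y ≤ (1 - x ^ 2) * y := by
  gcongr
  nlinarith

theorem Bloch.exists_bound (hg : Bloch g) :
    ∃ G : ℝ, 0 < G ∧ ∀ z : ℂ, ‖z‖ < 1 → (1 - ‖z‖) * ‖deriv g z‖ ≤ G := by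
  obtain ⟨-, C, hC⟩ := hg
  refine ⟨max C 1, by positivity, fun z hz => le_max_of_le_left ?_⟩
  exact (one_sub_mul_le (norm_nonneg _) hz (norm_nonneg _)).trans (hC z (by simpa using hz))

theorem LittleBloch.exists_bound (hg : LittleBloch g) {ε : ℝ} (hε : 0 < ε) :
    ∃ R : ℝ, 0 < R ∧ R < 1 ∧ ∀ z : ℂ, R ≤ ‖z‖ → ‖z‖ < 1 → (1 - ‖z‖) * ‖deriv g z‖ ≤ ε := by
  have h := hg.2.eventually (gt_mem_nhds hε)
  rw [eventually_comap] at h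
  obtain ⟨R, hR, hR2⟩ := mem_nhdsLT_iff_exists_Ico_subset.1 h
  refine ⟨max R (1 / 2), by positivity, max_lt hR (by norm_num), fun z hz hz1 => ?_⟩
  refine (one_sub_mul_le (norm_nonneg _) hz1 (norm_nonneg _)).trans ?_
  exact (hR2 ⟨(le_max_left _ _).trans hz, hz1⟩ z rfl).le

theorem exists_mixedNorm_integralOp_le (hp : p ≠ 0) (hα : 0 < α) (hg : Bloch g) :
    ∃ C : ℝ≥0∞, C ≠ ∞ ∧ ∀ f, IsHolo f →
      mixedNorm p α (integralOp g f) ≤ C * mixedNorm p α f := by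
  obtain ⟨b, hb, C, hC, h⟩ := exists_integralOp_estimates hp hα
  obtain ⟨G, hG, hGz⟩ := hg.exists_bound
  refine ⟨C * ENNReal.ofReal G, ENNReal.mul_ne_top hC ENNReal.ofReal_ne_top, fun f hf => ?_⟩
  rw [mul_assoc]
  refine (h g f hg.1 hf).1 _ fun r hr => ⟨G, hG, mixedNorm p α f,
    fun z _ hz => hGz z (hz.trans_lt hr.2), fun s hs _ _ => le_mixedNorm p α hs f, le_rfl⟩

theorem integralOp_mem_bigO (hp : p ≠ 0) (hα : 0 < α) (hg : Bloch g) (hf : f ∈ bigO p α) :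
    integralOp g f ∈ bigO p α := by
  obtain ⟨C, hC, h⟩ := exists_mixedNorm_integralOp_le hp hα hg
  exact ⟨isHolo_integralOp hf.1 hg.1, (h f hf.1).trans_lt (ENNReal.mul_lt_top hC.lt_top hf.2)⟩

theorem exists_mul_le {M D : ℝ≥0∞} (hM : M ≠ ∞) (hD : 0 < D) :
    ∃ G : ℝ, 0 < G ∧ ENNReal.ofReal G * M ≤ D := by
  have h1 : Tendsto (fun G : ℝ => ENNReal.ofReal G * M) (𝓝[>] 0) (𝓝 0) := by
    have : Tendsto (fun G : ℝ => ENNReal.ofReal G * M) (𝓝 0) (𝓝 (ENNReal.ofReal 0 * M)) :=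
      ENNReal.Tendsto.mul_const (ENNReal.continuous_ofReal.tendsto 0) (Or.inr hM)
    rw [ENNReal.ofReal_zero, zero_mul] at this
    exact this.mono_left nhdsWithin_le_nhds
  obtain ⟨G, h2, h3⟩ := ((h1.eventually (gt_mem_nhds hD)).and self_mem_nhdsWithin).exists
  exact ⟨G, h3, h2.le⟩

theorem eventually_forall_annulus {P : ℝ → Prop} (hP : ∀ᶠ s in 𝓝[<] (1 : ℝ), P s) (c : ℝ) :
    ∀ᶠ r in 𝓝[<] (1 : ℝ), ∀ s ∈ Ico (0 : ℝ) 1, 1 - s ≤ c * (1 - r) → P s := by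
  obtain ⟨R, hR, hR2⟩ := mem_nhdsLT_iff_exists_Ico_subset.1 hP
  have h1 : Tendsto (fun r : ℝ => c * (1 - r)) (𝓝[<] 1) (𝓝 0) := by
    have : Tendsto (fun r : ℝ => c * (1 - r)) (𝓝 1) (𝓝 (c * (1 - 1))) :=
      Continuous.tendsto (by fun_prop) 1
    rw [sub_self, mul_zero] at this
    exact this.mono_left nhdsWithin_le_nhds
  filter_upwards [h1.eventually (gt_mem_nhds (sub_pos.2 hR))] with r hr s hs hsr
  exact hR2 ⟨by linarith, hs.2⟩

/-- In the local bounds, the factor from `g` stays bounded and the one from `f` tends to zero at the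
circle. -/
theorem integralOp_mem_littleO (hp : p ≠ 0) (hα : 0 < α) (hg : Bloch g) (hf : f ∈ littleO p α) :
    integralOp g f ∈ littleO p α := by
  obtain ⟨b, hb, C, hC, h⟩ := exists_integralOp_estimates hp hα
  obtain ⟨G, hG, hGz⟩ := hg.exists_bound
  have hmem := integralOp_mem_bigO hp hα hg hf.1
  refine ⟨hmem, (h g f hg.1 hf.1.1).2 hmem.2 fun ε hε => ?_⟩
  have h1 : ∀ᶠ s in 𝓝[<] (1 : ℝ), weightedMean p α s f ≤ ε / ENNReal.ofReal G :=
    (ENNReal.tendsto_nhds_zero.1 hf.2) _ (ENNReal.div_pos hε.ne' ENNReal.ofReal_ne_top)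
  filter_upwards [eventually_forall_annulus h1 (b + 1), self_mem_nhdsWithin] with r hr hr1
  exact ⟨G, hG, ε / ENNReal.ofReal G, fun z _ hz => hGz z (hz.trans_lt hr1),
    fun s hs _ hs2 => hr s hs hs2, ENNReal.mul_div_le⟩

/-- Here the factor from `f` is only bounded, and the one from `g` tends to zero. -/
theorem integralOp_mem_littleO_of_littleBloch (hp : p ≠ 0) (hα : 0 < α) (hg : Bloch g)
    (hg0 : LittleBloch g) (hf : f ∈ bigO p α) : integralOp g f ∈ littleO p α := by
  obtain ⟨b, hb, C, hC, h⟩ := exists_integralOp_estimates hp hα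
  have hmem := integralOp_mem_bigO hp hα hg hf
  refine ⟨hmem, (h g f hg.1 hf.1).2 hmem.2 fun ε hε => ?_⟩
  obtain ⟨G, hG, hGε⟩ := exists_mul_le hf.2.ne hε
  obtain ⟨R, -, hR1, hR⟩ := hg0.exists_bound hG
  filter_upwards [(tendsto_max_sub_mul (zero_lt_one.trans hb)).eventually
    (Ico_mem_nhdsLT hR1), self_mem_nhdsWithin] with r hr hr1
  exact ⟨G, hG, mixedNorm p α f, fun z hz hz2 => hR z (hr.1.trans hz) (hz2.trans_lt hr1),
    fun s hs _ _ => le_mixedNorm p α hs f, hGε⟩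

/-- Near the circle the smallness comes from `g'`; on the remaining radii it comes from `f`. This is
continuity of `T_g` at 0 on norm-bounded sets, from locally uniform convergence to the norm. -/
theorem exists_mixedNorm_integralOp_small (hp : p ≠ 0) (hα : 0 < α) (hg : Bloch g)
    (hg0 : LittleBloch g) {M : ℝ≥0∞} (hM : M ≠ ∞) {ε : ℝ≥0∞} (hε : 0 < ε) :
    ∃ R : ℝ, R < 1 ∧ ∃ η : ℝ, 0 < η ∧ ∀ f, IsHolo f → mixedNorm p α f ≤ M →
      (∀ z : ℂ, ‖z‖ ≤ R → ‖f z‖ ≤ η) → mixedNorm p α (integralOp g f) < ε := by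
  obtain ⟨b, hb, C, hC, h⟩ := exists_integralOp_estimates hp hα
  obtain ⟨G, hG, hGz⟩ := hg.exists_bound
  obtain ⟨D', hD', hCD⟩ := exists_mul_le hC (ENNReal.half_pos (lt_min hε one_pos).ne')
  set D := ENNReal.ofReal D' with hD
  have hD0 : 0 < D := ENNReal.ofReal_pos.2 hD'
  have hCDε : C * D < ε := by
    rw [mul_comm]
    refine hCD.trans_lt (lt_of_lt_of_le (ENNReal.half_lt_self ?_ ?_) (min_le_left ε 1))
    · exact (lt_min hε one_pos).ne'
    · exact ((min_le_right _ _).trans_lt ENNReal.one_lt_top).ne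
  obtain ⟨G₁, hG₁, hG₁D⟩ := exists_mul_le hM hD0
  obtain ⟨R, hR0, hR1, hR⟩ := hg0.exists_bound hG₁
  obtain ⟨η, hη, hηD⟩ := exists_mul_le (M := ENNReal.ofReal G) ENNReal.ofReal_ne_top hD0
  have hb0 : 0 < b := by linarith
  -- If `1 - b (1 - r) < R`, then `1 - r > (1 - R) / b`, and the circles on which `f` enters satisfy
  -- `1 - s ≥ (1 - r) / 2`; they lie in this disk.
  refine ⟨1 - (1 - R) / (2 * b), ?_, η, hη, fun f hf hfM hfη => ?_⟩
  · have : 0 < (1 - R) / (2 * b) := div_pos (by linarith) (by linarith)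
    linarith
  refine ((h g f hg.1 hf).1 D fun r hr => ?_).trans_lt hCDε
  rcases le_or_gt R (1 - b * (1 - r)) with hrR | hrR
  · exact ⟨G₁, hG₁, M, fun z hz hz2 => hR z (hrR.trans ((le_max_right _ _).trans hz))
      (hz2.trans_lt hr.2), fun s hs _ _ => (le_mixedNorm p α hs f).trans hfM, hG₁D⟩
  · refine ⟨G, hG, ENNReal.ofReal η, fun z _ hz => hGz z (hz.trans_lt hr.2),
      fun s hs hs1 _ => ?_, by rwa [mul_comm]⟩
    have h1 : (1 - R) / (2 * b) ≤ 1 - s := by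
      refine le_trans ?_ hs1
      rw [div_le_div_iff₀ (by positivity) two_pos]
      nlinarith
    calc weightedMean p α s f ≤ 1 * ENNReal.ofReal η := by
          rw [weightedMean]
          gcongr
          · rw [ENNReal.ofReal_le_one]
            exact Real.rpow_le_one (by linarith [hs.2]) (by linarith [hs.1]) hα.le
          · refine integralMean_le_of_forall_norm_le hs.1 fun z hz => ?_
            rw [← ofReal_norm]
            exact ENNReal.ofReal_le_ofReal (hfη z (by linarith))
      _ = _ := one_mul _

/-- The integration operator `T_g` between spaces of functions with the mixed norm. -/
theorem exists_integralOp_clm (hp : p ≠ 0) (hα : 0 < α) (hg : Bloch g)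
    {S S' : Submodule ℂ (ℂ → ℂ)} (hS : S ≤ bigO p α) (h : ∀ f ∈ S, integralOp g f ∈ S') :
    ∃ T : Normed p α S →L[ℂ] Normed p α S', ∀ f, (T f).toFun = integralOp g f.toFun := by
  obtain ⟨C, hC, hb⟩ := exists_mixedNorm_integralOp_le hp hα hg
  let T : Normed p α S →ₗ[ℂ] Normed p α S' :=
    { toFun := fun f => Normed.mk (integralOp g f.toFun) (h _ f.toFun_mem)
      map_add' := fun f₁ f₂ => Normed.ext
        (integralOp_add (hS f₁.toFun_mem).1 (hS f₂.toFun_mem).1 hg.1)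
      map_smul' := fun c f => Normed.ext (integralOp_smul c g f.toFun) }
  exact ⟨⟨T, Normed.continuous_of_bound T C hC fun f => hb _ (hS f.toFun_mem).1⟩, fun f => rfl⟩

end

/-! ### Compactness -/

section

variable {p : ℝ≥0∞} {α : ℝ} {f g : ℂ → ℂ}

theorem exists_norm_le_of_mixedNorm_le_one (hp : p ≠ 0) (hα : 0 < α) {R : ℝ} (hR : R < 1) :
    ∃ M : ℝ, ∀ f : ℂ → ℂ, IsHolo f → mixedNorm p α f ≤ 1 → ∀ z : ℂ, ‖z‖ ≤ R → ‖f z‖ ≤ M := by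
  obtain ⟨C, hC, h⟩ := exists_enorm_le hp hα
  refine ⟨C.toReal / (1 - R) ^ (α + 1 / p.toReal), fun f hf hfn z hz => ?_⟩
  have h1 := h f hf z (hz.trans_lt hR) 1 fun s hs _ => (le_mixedNorm p α hs f).trans hfn
  have hR0 : 0 < 1 - R := by linarith
  rw [mul_one, ← ofReal_norm, ← ENNReal.ofReal_mul (norm_nonneg _)] at h1
  rw [le_div_iff₀ (by positivity)]
  have h2 := ENNReal.toReal_mono hC h1
  rw [ENNReal.toReal_ofReal (mul_nonneg (norm_nonneg _) (Real.rpow_nonneg (by linarith) _))] at h2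
  refine le_trans ?_ h2
  gcongr

/-- The derivative bound makes the unit ball equicontinuous on smaller disks, as Montel's theorem
requires. -/
theorem exists_lipschitz_of_mixedNorm_le_one (hp : p ≠ 0) (hα : 0 < α) {R : ℝ} (hR : R < 1) :
    ∃ L : ℝ, 0 < L ∧ ∀ f : ℂ → ℂ, IsHolo f → mixedNorm p α f ≤ 1 →
      ∀ z w : ℂ, ‖z‖ ≤ R → ‖w‖ ≤ R → ‖f z - f w‖ ≤ L * ‖z - w‖ := by
  obtain ⟨C, hC, h⟩ := exists_norm_deriv_le hp hα
  have hR0 : 0 < 1 - R := by linarith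
  refine ⟨C / (1 - R) ^ (α + 1 / p.toReal + 1), by positivity, fun f hf hfn z w hz hw => ?_⟩
  have hsub : closedBall (0 : ℂ) R ⊆ ball 0 1 := closedBall_subset_ball hR
  refine (convex_closedBall (0 : ℂ) R).norm_image_sub_le_of_norm_deriv_le (𝕜 := ℂ)
    (fun x hx => (hf.1.differentiableAt (isOpen_ball.mem_nhds (hsub hx)))) (fun x hx => ?_)
    (by simpa using hw) (by simpa using hz)
  have hx' : ‖x‖ ≤ R := by simpa using hx
  have h1 := h f hf x (hx'.trans_lt hR) 1 zero_le_one fun s hs _ => by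
    rw [ENNReal.ofReal_one]
    exact (le_mixedNorm p α hs f).trans hfn
  rw [le_div_iff₀ (by positivity)]
  rw [mul_one] at h1
  refine le_trans ?_ h1
  gcongr

/-- Fatou's lemma on each circle: the norm is lower semicontinuous under locally uniform
convergence. -/
theorem mixedNorm_le_one_of_forall_exists {f : ℂ → ℂ}
    (h : ∀ R : ℝ, R < 1 → ∀ η : ℝ, 0 < η →
      ∃ k : ℂ → ℂ, IsHolo k ∧ mixedNorm p α k ≤ 1 ∧ ∀ z : ℂ, ‖z‖ ≤ R → ‖k z - f z‖ ≤ η) :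
    mixedNorm p α f ≤ 1 := by
  refine weightedMean_le_iff.2 fun r hr => ?_
  choose k hk hk1 hkf using fun n : ℕ => h r hr.2 (1 / ((n : ℝ) + 1)) (by positivity)
  set d := ENNReal.ofReal ((1 - r) ^ α) with hd
  have hr1 : 0 < 1 - r := by linarith [hr.2]
  have hd0 : d ≠ 0 := by
    rw [hd, Ne, ENNReal.ofReal_eq_zero, not_le]
    positivity
  have h1 : integralMean p r f ≤ liminf (fun n => integralMean p r (k n)) atTop := by
    refine Lp.eLpNorm_lim_le_liminf_eLpNorm (fun n => (hk n).aestronglyMeasurable hr) _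
      (Eventually.of_forall fun θ => ?_)
    rw [tendsto_iff_norm_sub_tendsto_zero]
    exact squeeze_zero (fun _ => norm_nonneg _) (fun n => hkf n _ (norm_mul_exp hr.1 θ).le)
      tendsto_one_div_add_atTop_nhds_zero_nat
  have h2 : liminf (fun n => integralMean p r (k n)) atTop ≤ d⁻¹ := by
    refine liminf_le_of_frequently_le' (Frequently.of_forall fun n => ?_)
    rw [ENNReal.le_inv_iff_mul_le, mul_comm]
    exact (le_mixedNorm p α hr (k n)).trans (hk1 n)
  calc weightedMean p α r f ≤ d * d⁻¹ := by
        rw [weightedMean]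
        gcongr
        exact h1.trans h2
    _ = 1 := ENNReal.mul_inv_cancel hd0 ENNReal.ofReal_ne_top

/-- A Montel type theorem for the unit ball of `H(p,∞,α)`. -/
theorem exists_limit_of_ultrafilter (hp : p ≠ 0) (hα : 0 < α) (U : Ultrafilter (HBig p α))
    (hU : ∀ᶠ h in (U : Filter (HBig p α)), mixedNorm p α h.toFun ≤ 1) :
    ∃ f : HBig p α, mixedNorm p α f.toFun ≤ 1 ∧ ∀ R : ℝ, R < 1 → ∀ η : ℝ, 0 < η →
      ∀ᶠ h in (U : Filter (HBig p α)), ∀ z : ℂ, ‖z‖ ≤ R → ‖h.toFun z - f.toFun z‖ ≤ η := by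
  have hlim : ∀ z : ℂ, ∃ y : ℂ, Tendsto (fun h : HBig p α => h.toFun z) U (𝓝 y) := by
    intro z
    by_cases hz : ‖z‖ < 1
    · obtain ⟨M, hM⟩ := exists_norm_le_of_mixedNorm_le_one hp hα hz
      obtain ⟨y, -, hy⟩ := (isCompact_closedBall (0 : ℂ) M).ultrafilter_le_nhds
        (U.map fun h : HBig p α => h.toFun z) (by
          rw [le_principal_iff]
          change ∀ᶠ h in (U : Filter (HBig p α)), h.toFun z ∈ closedBall (0 : ℂ) M
          filter_upwards [hU] with h hh
          simpa using hM _ (isHolo_toFun h) hh z le_rfl)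
      exact ⟨y, hy⟩
    · refine ⟨0, tendsto_const_nhds.congr fun h => ?_⟩
      rw [(isHolo_toFun h).2 z (by simpa using hz)]
  choose f hf using hlim
  -- The common Lipschitz constant passes to the pointwise limit, so convergence on a finite net of
  -- the disk is uniform convergence on it.
  have hunif : ∀ R : ℝ, R < 1 → ∀ η : ℝ, 0 < η →
      ∀ᶠ h in (U : Filter (HBig p α)), ∀ z : ℂ, ‖z‖ ≤ R → ‖h.toFun z - f z‖ ≤ η := by
    intro R hR η hη
    obtain ⟨L, hL, hLip⟩ := exists_lipschitz_of_mixedNorm_le_one hp hα hR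
    have hfL : ∀ z w : ℂ, ‖z‖ ≤ R → ‖w‖ ≤ R → ‖f z - f w‖ ≤ L * ‖z - w‖ := by
      intro z w hz hw
      refine le_of_tendsto ((hf z).sub (hf w)).norm ?_
      filter_upwards [hU] with h hh using hLip _ (isHolo_toFun h) hh z w hz hw
    obtain ⟨t, ht, htf, hcov⟩ := finite_approx_of_totallyBounded
      (isCompact_closedBall (0 : ℂ) R).totallyBounded (η / (3 * L)) (by positivity)
    have h1 : ∀ᶠ h in (U : Filter (HBig p α)), ∀ w ∈ t, ‖h.toFun w - f w‖ < η / 3 := by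
      rw [htf.eventually_all]
      intro w _
      have := (tendsto_iff_norm_sub_tendsto_zero.1 (hf w))
      exact this.eventually (gt_mem_nhds (by positivity))
    filter_upwards [hU, h1] with h hh hht z hz
    obtain ⟨w, hw, hzw⟩ := mem_iUnion₂.1 (hcov (by simpa using hz : z ∈ closedBall (0 : ℂ) R))
    have hwR : ‖w‖ ≤ R := by simpa using ht hw
    have hzw' : L * ‖z - w‖ ≤ η / 3 := by
      have h2 : ‖z - w‖ < η / (3 * L) := mem_ball_iff_norm.1 hzw
      calc L * ‖z - w‖ ≤ L * (η / (3 * L)) := by gcongr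
        _ = η / 3 := by field_simp
    have h3 := hLip _ (isHolo_toFun h) hh z w hz hwR
    have h4 := hfL z w hz hwR
    calc ‖h.toFun z - f z‖ = ‖(h.toFun z - h.toFun w) + (h.toFun w - f w) - (f z - f w)‖ := by
          congr 1; ring
      _ ≤ ‖h.toFun z - h.toFun w‖ + ‖h.toFun w - f w‖ + ‖f z - f w‖ :=
          (norm_sub_le _ _).trans (add_le_add_left (norm_add_le _ _) _)
      _ ≤ η := by linarith [hht w hw]
  have hholo : IsHolo f := by
    refine ⟨?_, fun z hz => ?_⟩
    · have hloc : TendstoLocallyUniformlyOn (fun (h : HBig p α) => h.toFun) f U (ball 0 1) := by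
        rw [Metric.tendstoLocallyUniformlyOn_iff]
        intro ε hε x hx
        rw [mem_ball_zero_iff] at hx
        refine ⟨closedBall 0 ((1 + ‖x‖) / 2), mem_nhdsWithin_of_mem_nhds
          (closedBall_mem_nhds_of_mem ?_), ?_⟩
        · rw [mem_ball_zero_iff]; linarith
        · filter_upwards [hunif ((1 + ‖x‖) / 2) (by linarith) (ε / 2) (half_pos hε)] with h hh y hy
          rw [dist_comm, dist_eq_norm]
          exact (hh y (by simpa using hy)).trans_lt (by linarith)
      exact hloc.differentiableOn (Eventually.of_forall fun h => (isHolo_toFun h).1) isOpen_ball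
    · refine tendsto_nhds_unique (hf z) (tendsto_const_nhds.congr fun h => ?_)
      rw [(isHolo_toFun h).2 z hz]
  have hnorm : mixedNorm p α f ≤ 1 := by
    refine mixedNorm_le_one_of_forall_exists fun R hR η hη => ?_
    obtain ⟨h, h1, h2⟩ := (hU.and (hunif R hR η hη)).exists
    exact ⟨h.toFun, isHolo_toFun h, h1, h2⟩
  exact ⟨Normed.mk f ⟨hholo, hnorm.trans_lt ENNReal.one_lt_top⟩, hnorm, hunif⟩

/-- The image of the closed unit ball is itself compact: an ultrafilter on it lifts to the ball,
converges there locally uniformly to some `f` in the ball, and its images then converge to `T f` in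
norm. The general codomain `S` covers both spaces. -/
theorem isCompactOperator_of_littleBloch (hp : p ≠ 0) (hα : 0 < α) (hg : Bloch g)
    (hg0 : LittleBloch g) {S : Submodule ℂ (ℂ → ℂ)} (hS : S ≤ bigO p α)
    (T : HBig p α →L[ℂ] Normed p α S) (hT : ∀ f, (T f).toFun = integralOp g f.toFun) :
    IsCompactOperator T := by
  set B : Set (HBig p α) := {f | mixedNorm p α f.toFun ≤ 1} with hB
  refine ⟨T '' B, ?_, ?_⟩
  · refine isCompact_iff_ultrafilter_le_nhds.2 fun V hV => ?_
    have hVB : T '' B ∈ V := le_principal_iff.1 hV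
    classical
    set σ : Normed p α S → HBig p α := fun y => if hy : y ∈ T '' B then hy.choose else 0 with hσ
    have hσ1 : ∀ y ∈ T '' B, σ y ∈ B ∧ T (σ y) = y := by
      intro y hy
      rw [hσ]
      simp only [dif_pos hy]
      exact hy.choose_spec
    obtain ⟨f, hf1, hf⟩ := exists_limit_of_ultrafilter hp hα (V.map σ) (by
      change ∀ᶠ y in (V : Filter _), σ y ∈ B
      filter_upwards [hVB] with y hy using (hσ1 y hy).1)
    refine ⟨T f, ⟨f, hf1, rfl⟩, fun s hs => ?_⟩
    obtain ⟨ε, hε, hεs⟩ := (Normed.mem_nhds_iff hS).1 hs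
    obtain ⟨R, hR, η, hη, hRη⟩ := exists_mixedNorm_integralOp_small hp hα hg hg0
      (M := ENNReal.LpAddConst p * (1 + 1)) (ENNReal.mul_ne_top
        (ENNReal.LpAddConst_lt_top p).ne (by simp)) hε
    have h1 := hf R hR η hη
    rw [Ultrafilter.coe_map, eventually_map] at h1
    filter_upwards [hVB, h1] with y hy hyη
    refine hεs y ?_
    obtain ⟨hyB, hyT⟩ := hσ1 y hy
    rw [← hyT, ← map_sub, hT]
    refine hRη _ (isHolo_toFun _) ?_ fun z hz => hyη z hz
    rw [sub_eq_add_neg]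
    refine (mixedNorm_add_le p α (isHolo_toFun _) (isHolo_toFun (-f))).trans ?_
    gcongr
    · exact hyB
    · have : (-f).toFun = (-1 : ℂ) • f.toFun := by
        rw [← Normed.toFun_smul, neg_one_smul]
      rw [this, mixedNorm_smul]
      simpa using hf1
  · refine (Normed.mem_nhds_iff le_rfl).2 ⟨1, one_pos, fun h hh => ⟨h, ?_, rfl⟩⟩
    rw [sub_zero] at hh
    exact hh.le

end

/-! ### Test functions -/

section

theorem IsHolo.sum {ι : Type*} (t : Finset ι) {f : ι → ℂ → ℂ} (h : ∀ i ∈ t, IsHolo (f i)) :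
    IsHolo (∑ i ∈ t, f i) :=
  Finset.sum_induction f IsHolo (fun _ _ => IsHolo.add) IsHolo.zero h

/-- The exponent `q = min p 1`, for which the `q`-th power of the `L^p` quasi-norm is
subadditive. -/
def subaddExponent (p : ℝ≥0∞) : ℝ := (min p 1).toReal

theorem subaddExponent_pos {p : ℝ≥0∞} (hp : p ≠ 0) : 0 < subaddExponent p :=
  ENNReal.toReal_pos (by simp [hp]) ((min_le_right _ _).trans_lt ENNReal.one_lt_top).ne

/-- Minkowski's inequality if `p ≥ 1`, and `(x + y)^p ≤ x^p + y^p` under the integral if `p < 1`.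
Unlike the quasi-triangle inequality, this costs no constant, so it can be summed over arbitrarily
many terms. -/
theorem eLpNorm_add_rpow_le {p : ℝ≥0∞} (hp : p ≠ 0) {f g : ℝ → ℂ}
    (hf : AEStronglyMeasurable f angleMeasure) (hg : AEStronglyMeasurable g angleMeasure) :
    eLpNorm (f + g) p angleMeasure ^ subaddExponent p ≤
      eLpNorm f p angleMeasure ^ subaddExponent p +
        eLpNorm g p angleMeasure ^ subaddExponent p := by
  rcases le_or_gt 1 p with h | h
  · simp only [subaddExponent, min_eq_right h, ENNReal.toReal_one, ENNReal.rpow_one]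
    exact eLpNorm_add_le hf hg h
  · have hp' : p ≠ ∞ := (h.trans ENNReal.one_lt_top).ne
    have hpos := ENNReal.toReal_pos hp hp'
    have h1 : p.toReal ≤ 1 := by
      simpa using ENNReal.toReal_mono ENNReal.one_ne_top h.le
    have h2 : ∀ k : ℝ → ℂ, eLpNorm k p angleMeasure ^ p.toReal =
        ∫⁻ θ, ‖k θ‖ₑ ^ p.toReal ∂angleMeasure := fun k => by
      rw [eLpNorm_eq_lintegral_rpow_enorm_toReal hp hp', ← ENNReal.rpow_mul,
        one_div, inv_mul_cancel₀ hpos.ne', ENNReal.rpow_one]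
    simp only [subaddExponent, min_eq_left h.le, h2]
    rw [← lintegral_add_left' (hf.enorm.pow_const _)]
    refine lintegral_mono fun θ => ?_
    exact (ENNReal.rpow_le_rpow (enorm_add_le _ _) hpos.le).trans
      (ENNReal.rpow_add_le_add_rpow _ _ hpos.le h1)

theorem integralMean_sum_rpow_le {p : ℝ≥0∞} (hp : p ≠ 0) {r : ℝ} (hr : r ∈ Ico (0 : ℝ) 1)
    {ι : Type*} (t : Finset ι) {f : ι → ℂ → ℂ} (hf : ∀ i, IsHolo (f i)) :
    integralMean p r (∑ i ∈ t, f i) ^ subaddExponent p ≤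
      ∑ i ∈ t, integralMean p r (f i) ^ subaddExponent p := by
  classical
  induction t using Finset.induction_on with
  | empty => simp [integralMean_zero, subaddExponent_pos hp]
  | insert i t hi ih =>
    rw [Finset.sum_insert hi, Finset.sum_insert hi]
    refine (eLpNorm_add_rpow_le hp ((hf i).aestronglyMeasurable hr)
      ((IsHolo.sum t fun j _ => hf j).aestronglyMeasurable hr)).trans ?_
    exact add_le_add_right ih _

/-- With truncated subtraction the exponent is `|k - n|`; each side of `n` contributes at most a
geometric series. -/
theorem exists_hasSum_pow_dist {t : ℝ} (ht : 0 ≤ t) (ht1 : t < 1) (n : ℕ) :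
    ∃ S : ℝ, S ≤ 2 / (1 - t) ∧ HasSum (fun k : ℕ => t ^ ((k - n) + (n - k))) S := by
  have h1 : HasSum (fun k : ℕ => t ^ ((k + n - n) + (n - (k + n)))) (1 - t)⁻¹ := by
    simpa using hasSum_geometric_of_lt_one ht ht1
  refine ⟨_, ?_, (hasSum_nat_add_iff' n).1 (by simpa using h1 : HasSum _ ((1 - t)⁻¹ +
    ∑ i ∈ Finset.range n, t ^ ((i - n) + (n - i)) -
      ∑ i ∈ Finset.range n, t ^ ((i - n) + (n - i))))⟩
  have h2 : ∑ i ∈ Finset.range n, t ^ ((i - n) + (n - i)) ≤ (1 - t)⁻¹ := by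
    rw [← Finset.sum_range_reflect]
    refine le_trans (Finset.sum_le_sum fun i hi => ?_)
      (sum_le_hasSum (Finset.range n) (fun i _ => pow_nonneg ht i)
        (hasSum_geometric_of_lt_one ht ht1))
    have := Finset.mem_range.1 hi
    refine pow_le_pow_of_le_one ht ht1.le ?_
    omega
  rw [div_eq_mul_inv, two_mul]
  gcongr

/-- The test function `(1 - |a|)^s (1 - \bar a z)^{-N}`. -/
def testFun (N : ℕ) (s : ℝ) (a : ℂ) : ℂ → ℂ :=
  (ball (0 : ℂ) 1).indicator fun z =>
    (((1 - ‖a‖) ^ s : ℝ) : ℂ) * ((1 - (starRingEnd ℂ) a * z) ^ N)⁻¹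

section TestFun

variable {N : ℕ} {s : ℝ} {a : ℂ}

theorem one_sub_mul_norm_pos (ha : ‖a‖ < 1) {x : ℝ} (hx1 : x ≤ 1) :
    0 < 1 - ‖a‖ * x := by
  nlinarith [norm_nonneg a]

theorem one_sub_mul_norm_le (a z : ℂ) : 1 - ‖a‖ * ‖z‖ ≤ ‖1 - (starRingEnd ℂ) a * z‖ := by
  have h := norm_sub_norm_le (1 : ℂ) ((starRingEnd ℂ) a * z)
  rwa [norm_one, norm_mul, Complex.norm_conj] at h

theorem isHolo_testFun (ha : ‖a‖ < 1) : IsHolo (testFun N s a) := by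
  refine ⟨?_, fun z hz => indicator_of_notMem hz _⟩
  have h : DifferentiableOn ℂ (fun z : ℂ =>
      (((1 - ‖a‖) ^ s : ℝ) : ℂ) * ((1 - (starRingEnd ℂ) a * z) ^ N)⁻¹) (ball 0 1) := by
    refine (DifferentiableOn.inv (by fun_prop) fun z hz => pow_ne_zero _ ?_).const_mul _
    rw [← norm_pos_iff]
    rw [mem_ball_zero_iff] at hz
    exact (one_sub_mul_norm_pos ha hz.le).trans_le (one_sub_mul_norm_le a z)
  exact h.congr fun z hz => indicator_of_mem hz _

theorem norm_testFun {z : ℂ} (ha : ‖a‖ < 1) (hz : ‖z‖ < 1) : ‖testFun N s a z‖ =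
    (1 - ‖a‖) ^ s * (‖1 - (starRingEnd ℂ) a * z‖ ^ N)⁻¹ := by
  rw [testFun, indicator_of_mem (by simpa using hz), norm_mul, Complex.norm_real, norm_inv,
    norm_pow, Real.norm_of_nonneg (Real.rpow_nonneg (by linarith) _)]

theorem norm_testFun_le {z : ℂ} {x : ℝ} (ha : ‖a‖ < 1) (hz : ‖z‖ < 1) (hx : 0 < x)
    (hx1 : x ≤ 1 - ‖a‖ * ‖z‖) :
    ‖testFun N s a z‖ ≤ (1 - ‖a‖) ^ s * (x ^ N)⁻¹ := by
  rw [norm_testFun ha hz]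
  have h1 : 0 ≤ (1 - ‖a‖) ^ s := Real.rpow_nonneg (by linarith) _
  have h2 := hx1.trans (one_sub_mul_norm_le a z)
  gcongr

/-- Up to the factor `1 - |c|²` the integrand is a Poisson kernel, the real part of `(1 + cz) / (1 -
cz)`, whose mean over the circle is its value 1 at the origin. -/
theorem lintegral_poisson_le {c : ℂ} (hc : ‖c‖ < 1) :
    ∫⁻ θ, ENNReal.ofReal ((‖1 - c * Complex.exp (((θ : ℝ) : ℂ) * Complex.I)‖ ^ 2)⁻¹) ∂angleMeasure ≤
      ENNReal.ofReal (1 - ‖c‖)⁻¹ := by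
  set h : ℂ → ℂ := fun z => (1 + c * z) / (1 - c * z) with hh
  have hne : ∀ z : ℂ, ‖z‖ ≤ 1 → 1 - c * z ≠ 0 := by
    intro z hz h0
    have h1 : c * z = 1 := (sub_eq_zero.1 h0).symm
    have h2 : ‖c‖ * ‖z‖ = 1 := by rw [← norm_mul, h1, norm_one]
    nlinarith [norm_nonneg c, norm_nonneg z]
  have hexp : ∀ θ : ℝ, ‖Complex.exp (θ * Complex.I)‖ = 1 := Complex.norm_exp_ofReal_mul_I
  have hd : DiffContOnCl ℂ h (ball 0 |(1 : ℝ)|) := by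
    rw [abs_one]
    refine DifferentiableOn.diffContOnCl ?_
    refine DifferentiableOn.div (by fun_prop) (by fun_prop) fun z hz => hne z ?_
    simpa using closure_ball_subset_closedBall hz
  have hcont : Continuous fun θ : ℝ => h (Complex.exp (θ * Complex.I)) := by
    rw [hh]
    exact Continuous.div (by fun_prop) (by fun_prop) fun θ => hne _ (hexp θ).le
  have hint : Integrable (fun θ : ℝ => h (Complex.exp (θ * Complex.I))) angleMeasure := by
    rw [angleMeasure]
    exact (hcont.integrableOn_Ioc).smul_measure ENNReal.ofReal_ne_top
  have hmean : ∫ θ, h (Complex.exp (((θ : ℝ) : ℂ) * Complex.I)) ∂angleMeasure = 1 := by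
    have h1 := hd.circleAverage
    rw [Real.circleAverage_def, intervalIntegral.integral_of_le (by positivity)] at h1
    rw [angleMeasure, integral_smul_measure, ENNReal.toReal_ofReal (by positivity), one_div]
    simpa [hh, circleMap] using h1
  have hint_re : Integrable (fun θ : ℝ => (h (Complex.exp (θ * Complex.I))).re) angleMeasure :=
    hint.re
  have hre : ∀ θ : ℝ, (‖1 - c * Complex.exp (θ * Complex.I)‖ ^ 2)⁻¹ ≤
      (1 - ‖c‖)⁻¹ * (h (Complex.exp (θ * Complex.I))).re := by
    intro θ
    set u := c * Complex.exp (θ * Complex.I) with hu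
    have hun : ‖u‖ = ‖c‖ := by rw [hu, norm_mul, hexp, mul_one]
    have h1 : (h (Complex.exp (θ * Complex.I))).re = (1 - ‖c‖ ^ 2) / ‖1 - u‖ ^ 2 := by
      rw [hh]
      simp only [← hu]
      rw [Complex.div_re, ← add_div, ← hun, ← Complex.normSq_eq_norm_sq u,
        ← Complex.normSq_eq_norm_sq (1 - u)]
      congr 1
      simp only [Complex.add_re, Complex.one_re, Complex.sub_re, Complex.add_im, Complex.one_im,
        Complex.sub_im, Complex.normSq_apply]
      ring
    rw [h1, mul_div_assoc', inv_eq_one_div]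
    have h2 : (1 : ℝ) ≤ (1 - ‖c‖)⁻¹ * (1 - ‖c‖ ^ 2) := by
      rw [inv_mul_eq_div, le_div_iff₀ (by linarith)]
      nlinarith [norm_nonneg c]
    gcongr
  calc _ ≤ ∫⁻ θ, ENNReal.ofReal ((1 - ‖c‖)⁻¹ * (h (Complex.exp (((θ : ℝ) : ℂ) * Complex.I))).re)
        ∂angleMeasure := lintegral_mono fun θ => ENNReal.ofReal_le_ofReal (hre θ)
    _ = ENNReal.ofReal (∫ θ, (1 - ‖c‖)⁻¹ * (h (Complex.exp (((θ : ℝ) : ℂ) * Complex.I))).re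
        ∂angleMeasure) := by
      rw [ofReal_integral_eq_lintegral_ofReal (hint_re.const_mul _)]
      exact Eventually.of_forall fun θ => le_trans (by positivity) (hre θ)
    _ = _ := by
      rw [integral_const_mul]
      have h3 := integral_re hint
      simp only [RCLike.re_eq_complex_re] at h3
      rw [h3, hmean, Complex.one_re, mul_one]

/-- For finite `p`, split off the power `-2` of `|1 - \bar a z|` for the Poisson integral and bound
the rest by its maximum on the circle. The rest has a nonpositive exponent because `N p ≥ 2`. -/
theorem integralMean_testFun_le {p : ℝ≥0∞} (hp : p ≠ 0) (hN : 2 / p.toReal ≤ N) (ha : ‖a‖ < 1)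
    {r : ℝ} (hr : r ∈ Ico (0 : ℝ) 1) :
    integralMean p r (testFun N s a) ≤
      ENNReal.ofReal ((1 - ‖a‖) ^ s * (1 - ‖a‖ * r) ^ (-((N : ℝ) - 1 / p.toReal))) := by
  have ha0 : 0 < 1 - ‖a‖ := by linarith
  have hx : 0 < 1 - ‖a‖ * r := one_sub_mul_norm_pos ha hr.2.le
  by_cases hp' : p = ∞
  · subst hp'
    refine integralMean_le_of_forall_norm_le hr.1 fun z hz => ?_
    rw [← ofReal_norm]
    refine ENNReal.ofReal_le_ofReal ?_
    refine (norm_testFun_le ha (hz.trans_lt hr.2) hx (by rw [hz])).trans_eq ?_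
    rw [ENNReal.toReal_top, div_zero, sub_zero, Real.rpow_neg hx.le, Real.rpow_natCast]
  have hP := ENNReal.toReal_pos hp hp'
  set P := p.toReal with hPdef
  have hNP : 2 ≤ N * P := by rwa [div_le_iff₀ hP] at hN
  rw [← ENNReal.rpow_le_rpow_iff hP, integralMean_rpow hp hp', ← hPdef,
    ENNReal.ofReal_rpow_of_nonneg (by positivity) hP.le]
  set c : ℂ := (starRingEnd ℂ) a * r with hc
  have hcn : ‖c‖ = ‖a‖ * r := by
    rw [hc, norm_mul, Complex.norm_conj, Complex.norm_real, Real.norm_of_nonneg hr.1]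
  set A : ℝ := ((1 - ‖a‖) ^ s) ^ P * (1 - ‖a‖ * r) ^ (-(N * P - 2)) with hA
  have hA0 : 0 ≤ A := by positivity
  have hpt : ∀ θ : ℝ, ‖testFun N s a (r * Complex.exp (θ * Complex.I))‖ₑ ^ P ≤
      ENNReal.ofReal A *
        ENNReal.ofReal ((‖1 - c * Complex.exp (θ * Complex.I)‖ ^ 2)⁻¹) := by
    intro θ
    rw [← ofReal_norm, ENNReal.ofReal_rpow_of_nonneg (norm_nonneg _) hP.le,
      ← ENNReal.ofReal_mul hA0]
    refine ENNReal.ofReal_le_ofReal ?_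
    have hz : ‖(r : ℂ) * Complex.exp (θ * Complex.I)‖ = r := norm_mul_exp hr.1 θ
    rw [norm_testFun ha (by rw [hz]; exact hr.2), ← mul_assoc, ← hc]
    have h1 := one_sub_mul_norm_le a (r * Complex.exp (θ * Complex.I))
    rw [hz, ← mul_assoc, ← hc] at h1
    set y := ‖1 - c * Complex.exp (θ * Complex.I)‖ with hy
    have hy0 : 0 < y := hx.trans_le h1
    have h2 : ((y ^ N)⁻¹) ^ P = y ^ (-(N * P - 2)) * (y ^ 2)⁻¹ := by
      rw [← Real.rpow_natCast y N, ← Real.rpow_neg hy0.le, ← Real.rpow_mul hy0.le,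
        ← Real.rpow_two, ← Real.rpow_neg hy0.le, ← Real.rpow_add hy0]
      congr 1
      ring
    rw [Real.mul_rpow (by positivity) (by positivity), h2, hA, mul_assoc]
    have h3 : y ^ (-(N * P - 2)) ≤ (1 - ‖a‖ * r) ^ (-(N * P - 2)) :=
      Real.rpow_le_rpow_of_nonpos hx h1 (by linarith)
    exact mul_le_mul_of_nonneg_left (mul_le_mul_of_nonneg_right h3 (by positivity))
      (by positivity)
  calc _ ≤ ∫⁻ θ, ENNReal.ofReal A *
        ENNReal.ofReal ((‖1 - c * Complex.exp (((θ : ℝ) : ℂ) * Complex.I)‖ ^ 2)⁻¹) ∂angleMeasure :=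
        lintegral_mono hpt
    _ ≤ ENNReal.ofReal A * ENNReal.ofReal (1 - ‖c‖)⁻¹ := by
      rw [lintegral_const_mul' _ _ ENNReal.ofReal_ne_top]
      gcongr
      refine lintegral_poisson_le ?_
      rw [hcn]
      linarith
    _ = _ := by
      rw [← ENNReal.ofReal_mul hA0, hcn, hA]
      congr 1
      rw [Real.mul_rpow (by positivity) (by positivity), ← Real.rpow_mul hx.le, mul_assoc,
        ← Real.rpow_neg_one (1 - ‖a‖ * r), ← Real.rpow_add hx]
      congr 2
      field_simp
      ring

/-- The relation `s + α + 1/p = N` makes the bound scale invariant. The two terms of the minimum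
express decay on either side of `r = |a|`, which lets such functions be superposed. -/
theorem weightedMean_testFun_le {p : ℝ≥0∞} (hp : p ≠ 0) {α : ℝ} (hα : 0 < α)
    (hN : 2 / p.toReal ≤ N) (hs : 0 < s) (hsN : s + α + 1 / p.toReal = N) (ha : ‖a‖ < 1)
    {r : ℝ} (hr : r ∈ Ico (0 : ℝ) 1) :
    weightedMean p α r (testFun N s a) ≤
      ENNReal.ofReal (min (((1 - ‖a‖) / (1 - r)) ^ s) (((1 - r) / (1 - ‖a‖)) ^ α)) := by
  have ha0 : 0 < 1 - ‖a‖ := by linarith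
  have hr0 : 0 < 1 - r := by linarith [hr.2]
  have hx : 0 < 1 - ‖a‖ * r := one_sub_mul_norm_pos ha hr.2.le
  have hx1 : 1 - r ≤ 1 - ‖a‖ * r := by nlinarith [hr.1]
  have hx2 : 1 - ‖a‖ ≤ 1 - ‖a‖ * r := by nlinarith [hr.2, norm_nonneg a]
  rw [weightedMean]
  refine (mul_le_mul_right (integralMean_testFun_le hp hN ha hr) _).trans ?_
  rw [← ENNReal.ofReal_mul (by positivity)]
  refine ENNReal.ofReal_le_ofReal ?_
  have h1 : (1 - r) ^ α * ((1 - ‖a‖) ^ s * (1 - ‖a‖ * r) ^ (-((N : ℝ) - 1 / p.toReal))) =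
      ((1 - r) / (1 - ‖a‖ * r)) ^ α * ((1 - ‖a‖) / (1 - ‖a‖ * r)) ^ s := by
    have : -((N : ℝ) - 1 / p.toReal) = -α + -s := by linarith
    rw [this, Real.rpow_add hx, Real.div_rpow hr0.le hx.le, Real.div_rpow ha0.le hx.le,
      Real.rpow_neg hx.le, Real.rpow_neg hx.le]
    ring
  rw [h1]
  refine le_min ?_ ?_
  · calc _ ≤ 1 * ((1 - ‖a‖) / (1 - r)) ^ s := by
          gcongr
          exact Real.rpow_le_one (by positivity) ((div_le_one hx).2 hx1) hα.le
      _ = _ := one_mul _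
  · calc _ ≤ ((1 - r) / (1 - ‖a‖)) ^ α * 1 := by
          gcongr
          exact Real.rpow_le_one (by positivity) ((div_le_one hx).2 hx2) hs.le
      _ = _ := mul_one _

theorem testFun_mem_littleO {p : ℝ≥0∞} (hp : p ≠ 0) {α : ℝ} (hα : 0 < α)
    (hN : 2 / p.toReal ≤ N) (hs : 0 < s) (hsN : s + α + 1 / p.toReal = N) (ha : ‖a‖ < 1) :
    testFun N s a ∈ littleO p α := by
  have ha0 : 0 < 1 - ‖a‖ := by linarith
  have hw := fun {r : ℝ} (hr : r ∈ Ico (0 : ℝ) 1) =>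
    (weightedMean_testFun_le hp hα hN hs hsN ha hr).trans
      (ENNReal.ofReal_le_ofReal (min_le_right _ _))
  refine ⟨⟨isHolo_testFun ha, lt_of_le_of_lt (b := ENNReal.ofReal ((1 / (1 - ‖a‖)) ^ α))
    (weightedMean_le_iff.2 fun r hr => (hw hr).trans ?_) ENNReal.ofReal_lt_top⟩, ?_⟩
  · refine ENNReal.ofReal_le_ofReal ?_
    have : 0 ≤ 1 - r := by linarith [hr.2]
    gcongr
    linarith [hr.1]
  · have h1 : Tendsto (fun r : ℝ => ENNReal.ofReal (((1 - r) / (1 - ‖a‖)) ^ α)) (𝓝[<] 1) (𝓝 0) := by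
      have h2 : Tendsto (fun r : ℝ => ENNReal.ofReal (((1 - r) / (1 - ‖a‖)) ^ α)) (𝓝 1)
          (𝓝 (ENNReal.ofReal (((1 - 1) / (1 - ‖a‖)) ^ α))) := by
        refine (ENNReal.continuous_ofReal.tendsto _).comp ?_
        refine ((continuous_const.sub continuous_id).div_const _).tendsto 1 |>.rpow_const
          (Or.inr hα.le)
      rw [sub_self, zero_div, Real.zero_rpow hα.ne', ENNReal.ofReal_zero] at h2
      exact h2.mono_left nhdsWithin_le_nhds
    refine tendsto_of_tendsto_of_tendsto_of_le_of_le' tendsto_const_nhds h1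
      (Eventually.of_forall fun _ => zero_le) ?_
    filter_upwards [Ico_mem_nhdsLT zero_lt_one] with r hr using hw hr

end TestFun

end

/-! ### Families along lacunary sequences -/

section

/-- A sequence in the disk that approaches the unit circle so fast that the `s`-th and `α`-th
powers of the quotients of the distances to the circle decay geometrically with ratio `τ`. -/
structure IsLacunary (α s τ : ℝ) (z : ℕ → ℂ) : Prop where
  norm_lt : ∀ k, ‖z k‖ < 1
  anti : ∀ i j, i ≤ j → 1 - ‖z j‖ ≤ 1 - ‖z i‖
  pow_s : ∀ i j, i ≤ j → ((1 - ‖z j‖) / (1 - ‖z i‖)) ^ s ≤ τ ^ (j - i)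
  pow_α : ∀ i j, i ≤ j → ((1 - ‖z j‖) / (1 - ‖z i‖)) ^ α ≤ τ ^ (j - i)

theorem exists_isLacunary {α s τ : ℝ} (hα : 0 < α) (hs : 0 < s) (hτ : 0 < τ) (hτ1 : τ < 1)
    {Q : ℂ → Prop} (hQ : ∀ ε : ℝ, 0 < ε → ∃ z : ℂ, ‖z‖ < 1 ∧ 1 - ‖z‖ < ε ∧ Q z) :
    ∃ z : ℕ → ℂ, IsLacunary α s τ z ∧ ∀ k, Q (z k) := by
  set μ : ℝ := min (τ ^ (1 / s)) (τ ^ (1 / α)) with hμ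
  have hμ0 : 0 < μ := lt_min (by positivity) (by positivity)
  have hμ1 : μ ≤ 1 := (min_le_left _ _).trans (Real.rpow_le_one hτ.le hτ1.le (by positivity))
  have hμs : μ ^ s ≤ τ := by
    calc μ ^ s ≤ (τ ^ (1 / s)) ^ s := by gcongr; exact min_le_left _ _
      _ = τ := by rw [← Real.rpow_mul hτ.le, one_div, inv_mul_cancel₀ hs.ne', Real.rpow_one]
  have hμα : μ ^ α ≤ τ := by
    calc μ ^ α ≤ (τ ^ (1 / α)) ^ α := by gcongr; exact min_le_right _ _
      _ = τ := by rw [← Real.rpow_mul hτ.le, one_div, inv_mul_cancel₀ hα.ne', Real.rpow_one]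
  choose! pick hpick using hQ
  -- `d n` is the tolerance for the `n`-th point: 1 at the start, then `μ` times the distance of the
  -- previous point to the circle.
  let d : ℕ → ℝ := fun n => Nat.rec 1 (fun _ ε => μ * (1 - ‖pick ε‖)) n
  have hd0 : ∀ n, 0 < d n := by
    intro n
    induction n with
    | zero => exact one_pos
    | succ n ih =>
      have := (hpick (d n) ih).1
      exact mul_pos hμ0 (by linarith)
  set z : ℕ → ℂ := fun n => pick (d n) with hz
  have hnorm : ∀ k, ‖z k‖ < 1 := fun k => (hpick _ (hd0 k)).1
  have hstep : ∀ k, 1 - ‖z (k + 1)‖ ≤ μ * (1 - ‖z k‖) := fun k => (hpick _ (hd0 (k + 1))).2.1.le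
  have hdec : ∀ i m, 1 - ‖z (i + m)‖ ≤ μ ^ m * (1 - ‖z i‖) := by
    intro i m
    induction m with
    | zero => simp
    | succ m ih =>
      calc 1 - ‖z (i + m + 1)‖ ≤ μ * (1 - ‖z (i + m)‖) := hstep _
        _ ≤ μ * (μ ^ m * (1 - ‖z i‖)) := by gcongr
        _ = _ := by ring
  have hpow : ∀ β : ℝ, 0 < β → μ ^ β ≤ τ → ∀ i j, i ≤ j →
      ((1 - ‖z j‖) / (1 - ‖z i‖)) ^ β ≤ τ ^ (j - i) := by
    intro β hβ hμβ i j hij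
    obtain ⟨m, rfl⟩ := Nat.exists_eq_add_of_le hij
    have hi : 0 < 1 - ‖z i‖ := by linarith [hnorm i]
    have hj : 0 < 1 - ‖z (i + m)‖ := by linarith [hnorm (i + m)]
    rw [Nat.add_sub_cancel_left]
    calc _ ≤ (μ ^ m) ^ β := by
          gcongr
          exact (div_le_iff₀ hi).2 (hdec i m)
      _ = (μ ^ β) ^ m := by
          rw [← Real.rpow_natCast, ← Real.rpow_mul hμ0.le, mul_comm, Real.rpow_mul hμ0.le,
            Real.rpow_natCast]
      _ ≤ _ := by gcongr
  refine ⟨z, ⟨hnorm, fun i j hij => ?_, hpow s hs hμs, hpow α hα hμα⟩,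
    fun k => (hpick _ (hd0 k)).2.2⟩
  obtain ⟨m, rfl⟩ := Nat.exists_eq_add_of_le hij
  refine (hdec i m).trans ?_
  have hi : 0 < 1 - ‖z i‖ := by linarith [hnorm i]
  exact mul_le_of_le_one_left hi.le (pow_le_one₀ hμ0.le hμ1)

/-- The series `∑ a_k f_k` of test functions with peaks at the points `z_k`. -/
def testSeries (N : ℕ) (s : ℝ) (z : ℕ → ℂ) (a : ℕ → ℂ) : ℂ → ℂ :=
  fun w => ∑' k, a k * testFun N s (z k) w

namespace IsLacunary

variable {α s τ : ℝ} {z : ℕ → ℂ} {N : ℕ} {p : ℝ≥0∞}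

theorem one_sub_pos (hz : IsLacunary α s τ z) (k : ℕ) : 0 < 1 - ‖z k‖ := by
  linarith [hz.norm_lt k]

theorem pow_le (hz : IsLacunary α s τ z) (hs : 0 < s) (k : ℕ) : (1 - ‖z k‖) ^ s ≤ τ ^ k := by
  refine le_trans ?_ (hz.pow_s 0 k (Nat.zero_le k))
  have h0 := hz.one_sub_pos 0
  have hk := hz.one_sub_pos k
  gcongr
  rw [le_div_iff₀ h0]
  nlinarith [norm_nonneg (z 0)]

theorem norm_testFun_le (hz : IsLacunary α s τ z) (hs : 0 < s) (k : ℕ) {R : ℝ}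
    (hR : R < 1) {w : ℂ} (hw : ‖w‖ ≤ R) :
    ‖testFun N s (z k) w‖ ≤ τ ^ k * ((1 - R) ^ N)⁻¹ := by
  have hR' : 0 < 1 - R := by linarith
  refine (MixedNorm.norm_testFun_le (hz.norm_lt k) (hw.trans_lt hR) hR' ?_).trans ?_
  · nlinarith [norm_nonneg w, hz.norm_lt k]
  · gcongr
    exact hz.pow_le hs k

theorem summable (hz : IsLacunary α s τ z) (hs : 0 < s) (hτ : 0 < τ) (hτ1 : τ < 1) {a : ℕ → ℂ}
    {M : ℝ} (ha : ∀ k, ‖a k‖ ≤ M) (w : ℂ) : Summable fun k => a k * testFun N s (z k) w := by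
  by_cases hw : ‖w‖ < 1
  · refine Summable.of_norm_bounded (g := fun k => M * (τ ^ k * ((1 - ‖w‖) ^ N)⁻¹))
      (((summable_geometric_of_lt_one hτ.le hτ1).mul_right _).mul_left _) fun k => ?_
    rw [norm_mul]
    have := (norm_nonneg (a k)).trans (ha k)
    gcongr
    · exact ha k
    · exact hz.norm_testFun_le hs k hw le_rfl
  · refine summable_zero.congr fun k => ?_
    rw [(isHolo_testFun (hz.norm_lt k)).2 w (by simpa using hw), mul_zero]

theorem isHolo_testSeries (hz : IsLacunary α s τ z) (hs : 0 < s) (hτ : 0 < τ) (hτ1 : τ < 1)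
    {a : ℕ → ℂ} {M : ℝ} (ha : ∀ k, ‖a k‖ ≤ M) : IsHolo (testSeries N s z a) := by
  refine ⟨fun w hw => ?_, fun w hw => ?_⟩
  · rw [mem_ball_zero_iff] at hw
    obtain ⟨R, hwR, hR⟩ := exists_between hw
    have h : DifferentiableOn ℂ (testSeries N s z a) (ball 0 R) := by
      refine Complex.differentiableOn_tsum_of_summable_norm
        (u := fun k => M * (τ ^ k * ((1 - R) ^ N)⁻¹))
        (((summable_geometric_of_lt_one hτ.le hτ1).mul_right _).mul_left _)
        (fun k => (((isHolo_testFun (hz.norm_lt k)).1.mono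
          (ball_subset_ball hR.le)).const_mul _)) isOpen_ball fun k x hx => ?_
      rw [norm_mul]
      have := (norm_nonneg (a k)).trans (ha k)
      gcongr
      · exact ha k
      · exact hz.norm_testFun_le hs k hR (by simpa using (mem_ball_zero_iff.1 hx).le)
    exact (h.differentiableAt (isOpen_ball.mem_nhds (by simpa using hwR))).differentiableWithinAt
  · rw [testSeries]
    simp only [(isHolo_testFun (hz.norm_lt _)).2 w hw, mul_zero, tsum_zero]

/-- For each `r` the contributions decay geometrically away from the first index `n` with `|z_n| ≥
r`. The lost factor `τ⁻¹` arises because for `k < n` the comparison is with the point of index `n -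
1`. -/
theorem exists_weightedMean_le (hz : IsLacunary α s τ z) (hp : p ≠ 0) (hα : 0 < α) (hs : 0 < s)
    (hτ : 0 < τ) (hτ1 : τ < 1) (hN : 2 / p.toReal ≤ N) (hsN : s + α + 1 / p.toReal = N) {r : ℝ}
    (hr : r ∈ Ico (0 : ℝ) 1) : ∃ n : ℕ, ∀ k, weightedMean p α r (testFun N s (z k)) ≤
      ENNReal.ofReal (τ⁻¹ * τ ^ ((k - n) + (n - k))) := by
  have hr0 : 0 < 1 - r := by linarith [hr.2]
  have hex : ∃ k, 1 - ‖z k‖ ≤ 1 - r := by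
    by_contra! hcon
    have h1 : Tendsto (fun k : ℕ => τ ^ k) atTop (𝓝 0) :=
      tendsto_pow_atTop_nhds_zero_of_lt_one hτ.le hτ1
    obtain ⟨k, hk⟩ := (h1.eventually (gt_mem_nhds (show 0 < (1 - r) ^ s by positivity))).exists
    have h2 : (1 - r) ^ s ≤ (1 - ‖z k‖) ^ s := by
      gcongr
      linarith [hcon k]
    exact (hk.trans_le h2).not_ge (hz.pow_le hs k)
  classical
  refine ⟨Nat.find hex, fun k => ?_⟩
  have hn := Nat.find_spec hex
  set n := Nat.find hex with hndef
  have hk0 := hz.one_sub_pos k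
  refine (weightedMean_testFun_le hp hα hN hs hsN (hz.norm_lt k) hr).trans
    (ENNReal.ofReal_le_ofReal ?_)
  have hτi : 1 ≤ τ⁻¹ := (one_le_inv₀ hτ).2 hτ1.le
  rcases le_or_gt n k with h | h
  · refine (min_le_left _ _).trans ?_
    have hn0 := hz.one_sub_pos n
    rw [Nat.sub_eq_zero_of_le h, add_zero]
    calc _ ≤ ((1 - ‖z k‖) / (1 - ‖z n‖)) ^ s := by gcongr
      _ ≤ τ ^ (k - n) := hz.pow_s n k h
      _ ≤ τ⁻¹ * τ ^ (k - n) := le_mul_of_one_le_left (by positivity) hτi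
  · refine (min_le_right _ _).trans ?_
    obtain ⟨m, hm⟩ : ∃ m, n = m + 1 := ⟨n - 1, by omega⟩
    have hmn : 1 - r < 1 - ‖z m‖ := not_le.1 (Nat.find_min hex (by omega))
    have hkm : k ≤ m := by omega
    calc _ ≤ ((1 - ‖z m‖) / (1 - ‖z k‖)) ^ α := by gcongr
      _ ≤ τ ^ (m - k) := hz.pow_α k m hkm
      _ = _ := by
        have : (k - n) + (n - k) = (m - k) + 1 := by omega
        rw [this, pow_succ]
        field_simp

/-- On each circle the `q`-th powers of the terms, `q = min p 1`, are dominated by a two-sided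
geometric series with ratio `τ^q`, uniformly in `r`. The partial sums pass to the limit by Fatou's
lemma. -/
theorem exists_mixedNorm_testSeries_le (hz : IsLacunary α s τ z) (hp : p ≠ 0) (hα : 0 < α)
    (hs : 0 < s) (hτ : 0 < τ) (hτ1 : τ < 1) (hN : 2 / p.toReal ≤ N)
    (hsN : s + α + 1 / p.toReal = N) :
    ∃ C : ℝ, 0 ≤ C ∧ ∀ (a : ℕ → ℂ) (M : ℝ), (∀ k, ‖a k‖ ≤ M) →
      mixedNorm p α (testSeries N s z a) ≤ ENNReal.ofReal (C * M) := by
  set q := subaddExponent p with hq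
  have hq0 : 0 < q := subaddExponent_pos hp
  have hτq : τ ^ q < 1 := Real.rpow_lt_one hτ.le hτ1 hq0
  have hτq0 : 0 < 1 - τ ^ q := by linarith
  set A : ℝ := 2 / (1 - τ ^ q) with hA
  have hA0 : 0 < A := by positivity
  refine ⟨τ⁻¹ * A ^ (1 / q), by positivity, fun a M ha => weightedMean_le_iff.2 fun r hr => ?_⟩
  have hM : 0 ≤ M := (norm_nonneg _).trans (ha 0)
  obtain ⟨n, hn⟩ := hz.exists_weightedMean_le hp hα hs hτ hτ1 hN hsN hr
  set d := ENNReal.ofReal ((1 - r) ^ α) with hd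
  have hr0 : 0 < 1 - r := by linarith [hr.2]
  have hd0 : d ≠ 0 := by
    rw [hd, Ne, ENNReal.ofReal_eq_zero, not_le]
    positivity
  have hdt : d ≠ ∞ := ENNReal.ofReal_ne_top
  have hf : ∀ k, IsHolo (a k • testFun N s (z k)) := fun k =>
    (isHolo_testFun (hz.norm_lt k)).smul _
  obtain ⟨S, hS, hSsum⟩ := exists_hasSum_pow_dist (Real.rpow_nonneg hτ.le q) hτq n
  have hpart : ∀ m : ℕ, d * integralMean p r (∑ k ∈ Finset.range m, a k • testFun N s (z k)) ≤
      ENNReal.ofReal (τ⁻¹ * A ^ (1 / q) * M) := by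
    intro m
    have hD : ENNReal.ofReal (τ⁻¹ * A ^ (1 / q) * M) ^ q =
        ENNReal.ofReal ((τ⁻¹ * A ^ (1 / q) * M) ^ q) :=
      ENNReal.ofReal_rpow_of_nonneg (by positivity) hq0.le
    rw [← ENNReal.rpow_le_rpow_iff hq0, ENNReal.mul_rpow_of_nonneg _ _ hq0.le, hD]
    calc _ ≤ d ^ q * ∑ k ∈ Finset.range m, integralMean p r (a k • testFun N s (z k)) ^ q := by
          gcongr
          exact integralMean_sum_rpow_le hp hr _ hf
      _ = ∑ k ∈ Finset.range m, (‖a k‖ₑ * weightedMean p α r (testFun N s (z k))) ^ q := by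
          rw [Finset.mul_sum]
          refine Finset.sum_congr rfl fun k _ => ?_
          rw [← ENNReal.mul_rpow_of_nonneg _ _ hq0.le, integralMean_smul, weightedMean]
          congr 1
          ring
      _ ≤ ∑ k ∈ Finset.range m,
          ENNReal.ofReal ((M * τ⁻¹) ^ q * (τ ^ q) ^ ((k - n) + (n - k))) := by
          refine Finset.sum_le_sum fun k _ => ?_
          calc _ ≤ (ENNReal.ofReal M * ENNReal.ofReal (τ⁻¹ * τ ^ ((k - n) + (n - k)))) ^ q := by
                gcongr
                · rw [← ofReal_norm]
                  exact ENNReal.ofReal_le_ofReal (ha k)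
                · exact hn k
            _ = _ := by
                rw [← ENNReal.ofReal_mul hM, ENNReal.ofReal_rpow_of_nonneg (by positivity) hq0.le,
                  ← mul_assoc, Real.mul_rpow (by positivity) (by positivity)]
                congr 2
                rw [← Real.rpow_natCast, ← Real.rpow_natCast, ← Real.rpow_mul hτ.le,
                  ← Real.rpow_mul hτ.le, mul_comm]
      _ = ENNReal.ofReal (∑ k ∈ Finset.range m,
          (M * τ⁻¹) ^ q * (τ ^ q) ^ ((k - n) + (n - k))) := by
          rw [ENNReal.ofReal_sum_of_nonneg fun k _ => by positivity]
      _ ≤ _ := by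
          refine ENNReal.ofReal_le_ofReal ?_
          rw [← Finset.mul_sum]
          calc _ ≤ (M * τ⁻¹) ^ q * A := by
                gcongr
                exact (sum_le_hasSum _ (fun k _ => by positivity) hSsum).trans hS
            _ = _ := by
                rw [show τ⁻¹ * A ^ (1 / q) * M = M * τ⁻¹ * A ^ (1 / q) by ring,
                  Real.mul_rpow (x := M * τ⁻¹) (by positivity) (by positivity),
                  ← Real.rpow_mul hA0.le, one_div, inv_mul_cancel₀ hq0.ne', Real.rpow_one]
  have hlim : integralMean p r (testSeries N s z a) ≤
      ENNReal.ofReal (τ⁻¹ * A ^ (1 / q) * M) / d := by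
    refine Lp.eLpNorm_le_of_ae_tendsto (u := atTop)
      (f := fun (m : ℕ) (θ : ℝ) => (∑ k ∈ Finset.range m, a k • testFun N s (z k))
        (r * Complex.exp (θ * Complex.I)))
      (Eventually.of_forall fun m => ?_)
      (fun m => (IsHolo.sum _ fun k _ => hf k).aestronglyMeasurable hr)
      (Eventually.of_forall fun θ => ?_)
    · rw [ENNReal.le_div_iff_mul_le (Or.inl hd0) (Or.inl hdt), mul_comm]
      exact hpart m
    · have := (hz.summable (N := N) hs hτ hτ1 ha (r * Complex.exp (θ * Complex.I))).hasSum.tendsto_sum_nat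
      simpa [Finset.sum_apply, testSeries] using this
  rw [weightedMean, mul_comm, ← ENNReal.le_div_iff_mul_le (Or.inl hd0) (Or.inl hdt)]
  exact hlim

/-- Off-diagonal decay of the matrix `f_k(z_j)`: bound `|1 - \bar z_k z_j|` below by the larger of
the two distances to the circle. The factor `2^N` comes from `1 - |z_j|² ≤ 2 (1 - |z_j|)` on the
diagonal. -/
theorem norm_testFun_le_mul (hz : IsLacunary α s τ z) (hτ : 0 < τ)
    (hsN : s + α + 1 / p.toReal = N) (k j : ℕ) :
    ‖testFun N s (z k) (z j)‖ ≤
      2 ^ N * τ ^ ((k - j) + (j - k)) * ‖testFun N s (z j) (z j)‖ := by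
  have hk := hz.one_sub_pos k
  have hj := hz.one_sub_pos j
  have hjj : ‖testFun N s (z j) (z j)‖ = (1 - ‖z j‖) ^ s * ((1 - ‖z j‖ ^ 2) ^ N)⁻¹ := by
    rw [norm_testFun (hz.norm_lt j) (hz.norm_lt j)]
    congr 3
    rw [mul_comm, Complex.mul_conj, Complex.normSq_eq_norm_sq, ← Complex.ofReal_one,
      ← Complex.ofReal_sub, Complex.norm_real, Real.norm_of_nonneg]
    nlinarith [norm_nonneg (z j)]
  have hlow : (1 - ‖z j‖) ^ s * ((1 - ‖z j‖) ^ N)⁻¹ ≤ 2 ^ N * ‖testFun N s (z j) (z j)‖ := by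
    have h1 : 0 < 1 - ‖z j‖ ^ 2 := by nlinarith [norm_nonneg (z j)]
    have h2 : (1 - ‖z j‖ ^ 2) ^ N ≤ 2 ^ N * (1 - ‖z j‖) ^ N := by
      rw [← mul_pow]
      gcongr
      nlinarith [norm_nonneg (z j)]
    rw [hjj, ← mul_assoc, mul_comm (2 ^ N : ℝ), mul_assoc]
    gcongr
    rw [← div_eq_mul_inv, inv_eq_one_div, div_le_div_iff₀ (by positivity) (by positivity), one_mul]
    exact h2
  have hx1 : 1 - ‖z k‖ ≤ 1 - ‖z k‖ * ‖z j‖ := by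
    nlinarith [norm_nonneg (z k), hz.norm_lt j]
  have hx2 : 1 - ‖z j‖ ≤ 1 - ‖z k‖ * ‖z j‖ := by
    nlinarith [norm_nonneg (z j), hz.norm_lt k]
  suffices h : ‖testFun N s (z k) (z j)‖ ≤
      τ ^ ((k - j) + (j - k)) * ((1 - ‖z j‖) ^ s * ((1 - ‖z j‖) ^ N)⁻¹) by
    calc _ ≤ _ := h
      _ ≤ τ ^ ((k - j) + (j - k)) * (2 ^ N * ‖testFun N s (z j) (z j)‖) := by gcongr
      _ = _ := by ring
  rcases le_total j k with h | h
  · rw [Nat.sub_eq_zero_of_le h, add_zero]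
    refine (MixedNorm.norm_testFun_le (hz.norm_lt k) (hz.norm_lt j) hj hx2).trans ?_
    have h1 := hz.pow_s j k h
    rw [Real.div_rpow hk.le hj.le, div_le_iff₀ (by positivity)] at h1
    rw [← mul_assoc]
    gcongr
  · rw [Nat.sub_eq_zero_of_le h, zero_add]
    refine (MixedNorm.norm_testFun_le (hz.norm_lt k) (hz.norm_lt j) hk hx1).trans ?_
    have h1 := hz.pow_α k j h
    have hjk : 1 - ‖z j‖ ≤ 1 - ‖z k‖ := hz.anti k j h
    set x := 1 - ‖z k‖ with hx
    set y := 1 - ‖z j‖ with hy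
    set β := α + 1 / p.toReal with hβ
    have hαβ : α ≤ β := by rw [hβ]; exact le_add_of_nonneg_right (by positivity)
    have h2 : ∀ t : ℝ, 0 < t → t ^ s * (t ^ N)⁻¹ = (t ^ β)⁻¹ := by
      intro t ht
      rw [← Real.rpow_natCast, ← hsN, ← Real.rpow_neg ht.le, ← Real.rpow_neg ht.le,
        ← Real.rpow_add ht]
      congr 1
      rw [hβ]
      ring
    rw [h2 x hk, h2 y hj]
    have h3 : (y / x) ^ β ≤ τ ^ (j - k) := by
      refine le_trans ?_ h1
      exact Real.rpow_le_rpow_of_exponent_ge (by positivity) ((div_le_one hk).2 hjk) hαβ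
    rw [Real.div_rpow hj.le hk.le, div_le_iff₀ (by positivity)] at h3
    rw [← div_eq_mul_inv, inv_eq_one_div, div_le_div_iff₀ (by positivity) (by positivity), one_mul]
    exact h3

theorem testFun_self_ne_zero (hz : IsLacunary α s τ z) (j : ℕ) :
    testFun N s (z j) (z j) ≠ 0 := by
  have hj := hz.one_sub_pos j
  have h := one_sub_mul_norm_le (z j) (z j)
  have h1 : 0 < 1 - ‖z j‖ * ‖z j‖ := one_sub_mul_norm_pos (hz.norm_lt j) (hz.norm_lt j).le
  have h2 := h1.trans_le h
  rw [← norm_pos_iff, norm_testFun (hz.norm_lt j) (hz.norm_lt j)]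
  positivity

/-- Diagonal dominance. Lacunarity with ratio `τ²` leaves a spare factor `τ` off the diagonal to
beat `2^N`: `τ 2^N = 1/8`, and the geometric series is at most 4, so the error is at most `M / 2`.
-/
theorem norm_testSeries_sub_le (hz : IsLacunary α s (τ ^ 2) z) (hs : 0 < s)
    (hτ : 0 < τ) (hτN : τ * 2 ^ (N + 3) = 1) (hsN : s + α + 1 / p.toReal = N) {a : ℕ → ℂ} {M : ℝ}
    (ha : ∀ k, ‖a k‖ ≤ M) (j : ℕ) :
    ‖testSeries N s z a (z j) / testFun N s (z j) (z j) - a j‖ ≤ M / 2 := by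
  have hM : 0 ≤ M := (norm_nonneg _).trans (ha 0)
  have hN1 : (1 : ℝ) ≤ 2 ^ N := one_le_pow₀ one_le_two
  have hτ8 : τ * 2 ^ N = 1 / 8 := by rw [pow_add] at hτN; linarith
  have hτ1 : τ ≤ 1 / 8 := by nlinarith
  have hsum := hz.summable (N := N) hs (by positivity) (by nlinarith) ha (z j)
  have hne := hz.testFun_self_ne_zero (N := N) j
  set F := testFun N s (z j) (z j) with hF
  obtain ⟨S, hS, hSsum⟩ := exists_hasSum_pow_dist hτ.le (by linarith : τ < 1) j
  have hS4 : S ≤ 4 := hS.trans (by rw [div_le_iff₀ (by linarith)]; linarith)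
  have hrest : ‖∑' k, (if k = j then 0 else a k * testFun N s (z k) (z j))‖ ≤
      M * 2 ^ N * τ * ‖F‖ * S := by
    refine tsum_of_norm_bounded (hSsum.mul_left _) fun k => ?_
    split_ifs with hkj
    · rw [norm_zero]
      positivity
    · rw [norm_mul]
      have h1 := hz.norm_testFun_le_mul (by positivity) hsN k j
      have h2 : (τ ^ 2) ^ ((k - j) + (j - k)) ≤ τ * τ ^ ((k - j) + (j - k)) := by
        rw [← pow_mul, ← pow_succ']
        refine pow_le_pow_of_le_one hτ.le (by linarith) ?_
        omega
      calc _ ≤ M * (2 ^ N * (τ * τ ^ ((k - j) + (j - k))) * ‖F‖) := by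
            refine mul_le_mul (ha k) (h1.trans ?_) (norm_nonneg _) hM
            gcongr
        _ = _ := by ring
  have heq : testSeries N s z a (z j) / F - a j =
      (∑' k, (if k = j then 0 else a k * testFun N s (z k) (z j))) / F := by
    rw [testSeries, hsum.tsum_eq_add_tsum_ite j]
    field_simp
    ring
  rw [heq, norm_div, div_le_iff₀ (norm_pos_iff.2 hne)]
  refine hrest.trans ?_
  calc M * 2 ^ N * τ * ‖F‖ * S ≤ M * 2 ^ N * τ * ‖F‖ * 4 := by gcongr
    _ = (τ * 2 ^ N) * (M * ‖F‖ * 4) := by ring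
    _ = _ := by rw [hτ8]; ring

end IsLacunary

end

/-! ### Interpolation -/

section

variable {p : ℝ≥0∞} {α : ℝ} {f g : ℂ → ℂ}

/-- `H(p,0,α)` is closed in `H(p,∞,α)`. -/
theorem mem_littleO_of_forall_exists (hf : f ∈ bigO p α)
    (h : ∀ ε : ℝ≥0∞, 0 < ε → ∃ k ∈ littleO p α, mixedNorm p α (f - k) ≤ ε) : f ∈ littleO p α := by
  refine ⟨hf, ENNReal.tendsto_nhds_zero.2 fun ε hε => ?_⟩
  set K := ENNReal.LpAddConst p with hK
  have hKt : K ≠ ∞ := (ENNReal.LpAddConst_lt_top p).ne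
  obtain ⟨δ', hδ', hδK⟩ := exists_mul_le (M := K + K) (by simp [hKt]) hε
  set δ := ENNReal.ofReal δ' with hδ
  have hδ0 : 0 < δ := ENNReal.ofReal_pos.2 hδ'
  obtain ⟨k, hk, hfk⟩ := h δ hδ0
  filter_upwards [ENNReal.tendsto_nhds_zero.1 hk.2 δ hδ0, Ico_mem_nhdsLT zero_lt_one] with r hr hr1
  have hsub : IsHolo (f - k) := ((bigO p α).sub_mem hf hk.1).1
  have h1 := weight_add_le p α hr1 hsub hk.1.1
  rw [sub_add_cancel] at h1
  calc _ ≤ K * (δ + δ) := by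
        refine h1.trans ?_
        gcongr
        exact (le_mixedNorm p α hr1 _).trans hfk
    _ = δ * (K + K) := by ring
    _ ≤ ε := hδK

theorem exists_of_not_littleBloch (hg : Bloch g) (hng : ¬ LittleBloch g) :
    ∃ c : ℝ, 0 < c ∧ ∀ ε : ℝ, 0 < ε →
      ∃ z : ℂ, ‖z‖ < 1 ∧ 1 - ‖z‖ < ε ∧ c ≤ (1 - ‖z‖) * ‖deriv g z‖ := by
  by_contra! hcon
  refine hng ⟨hg.1, Metric.tendsto_nhds.2 fun ε hε => ?_⟩
  obtain ⟨δ, hδ, h⟩ := hcon (ε / 2) (half_pos hε)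
  rw [eventually_comap]
  filter_upwards [Ico_mem_nhdsLT (zero_lt_one' ℝ),
    Ico_mem_nhdsLT (show 1 - δ / 2 < 1 by linarith)] with r hr hr2 z hz
  have h1 := h z (by rw [hz]; exact hr.2) (by rw [hz]; linarith [hr2.1])
  have h2 : 0 ≤ 1 - ‖z‖ ^ 2 := by rw [hz]; nlinarith [hr.1, hr.2]
  rw [dist_zero_right, Real.norm_of_nonneg (mul_nonneg h2 (norm_nonneg _))]
  calc (1 - ‖z‖ ^ 2) * ‖deriv g z‖ ≤ (2 * (1 - ‖z‖)) * ‖deriv g z‖ := by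
        gcongr
        rw [hz]
        nlinarith [hr.1, hr.2]
    _ < ε := by linarith

theorem norm_le_of_ellInfty (a : EllInfty) (k : ℕ) : ‖a k‖ ≤ ‖a‖ :=
  lp.norm_apply_le_norm ENNReal.top_ne_zero a k

/-- A bounded sequence as an element of `ℓ_∞`. -/
def ellInftyMk (a : ℕ → ℂ) (h : ∃ C, ∀ k, ‖a k‖ ≤ C) : EllInfty :=
  ⟨a, memℓp_infty (by
    obtain ⟨C, hC⟩ := h
    exact ⟨C, by rintro _ ⟨k, rfl⟩; exact hC k⟩)⟩

theorem ellInftyMk_apply (a : ℕ → ℂ) (h : ∃ C, ∀ k, ‖a k‖ ≤ C) (k : ℕ) :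
    ellInftyMk a h k = a k := rfl

/-- The constant sequence `1` cut off at `n`. -/
def truncOne (n : ℕ) : EllInfty :=
  ellInftyMk (fun k => if k < n then 1 else 0) ⟨1, fun k => by split_ifs <;> simp⟩

/-- The constant sequence `1`. -/
def constOne : EllInfty := ellInftyMk (fun _ => 1) ⟨1, fun _ => by simp⟩

/-- Finite sums lie in the closed subspace `H(p,0,α)`, and the norm of a tail is at most `C` times
the supremum of its coefficients. -/
theorem IsLacunary.testSeries_mem_littleO {s τ : ℝ} {z : ℕ → ℂ} {N : ℕ} (hz : IsLacunary α s τ z)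
    (hp : p ≠ 0) (hα : 0 < α) (hs : 0 < s) (hτ : 0 < τ) (hτ1 : τ < 1) (hN : 2 / p.toReal ≤ N)
    (hsN : s + α + 1 / p.toReal = N) {a : ℕ → ℂ} (ha : Tendsto a atTop (𝓝 0)) :
    testSeries N s z a ∈ littleO p α := by
  obtain ⟨C, hC0, hC⟩ := hz.exists_mixedNorm_testSeries_le hp hα hs hτ hτ1 hN hsN
  obtain ⟨M, hM⟩ := ha.norm.bddAbove_range
  have haM : ∀ k, ‖a k‖ ≤ M := fun k => hM ⟨k, rfl⟩
  refine mem_littleO_of_forall_exists ⟨hz.isHolo_testSeries hs hτ hτ1 haM,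
    (hC a M haM).trans_lt ENNReal.ofReal_lt_top⟩ fun ε hε => ?_
  obtain ⟨η, hη, hηε⟩ := exists_mul_le (M := ENNReal.ofReal C) ENNReal.ofReal_ne_top hε
  rw [← ENNReal.ofReal_mul hη.le] at hηε
  obtain ⟨n, hn⟩ := eventually_atTop.1 ((tendsto_zero_iff_norm_tendsto_zero.1 ha).eventually
    (gt_mem_nhds hη))
  have htail : ∀ k, ‖if k < n then 0 else a k‖ ≤ η := by
    intro k
    split_ifs with h
    · simpa using hη.le
    · exact (hn k (not_lt.1 h)).le
  refine ⟨∑ k ∈ Finset.range n, a k • testFun N s (z k), Submodule.sum_mem _ fun k _ =>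
    Submodule.smul_mem _ _ (testFun_mem_littleO hp hα hN hs hsN (hz.norm_lt k)), ?_⟩
  have heq : testSeries N s z a - ∑ k ∈ Finset.range n, a k • testFun N s (z k) =
      testSeries N s z (fun k => if k < n then 0 else a k) := by
    ext w
    have h1 := hz.summable (N := N) hs hτ hτ1 haM w
    have h2 := hz.summable (N := N) hs hτ hτ1 htail w
    simp only [Pi.sub_apply, Finset.sum_apply, Pi.smul_apply, smul_eq_mul, testSeries]
    rw [← h1.sum_add_tsum_nat_add n, ← h2.sum_add_tsum_nat_add n, add_sub_cancel_left,
      Finset.sum_eq_zero, zero_add]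
    · simp
    · intro k hk
      rw [if_pos (Finset.mem_range.1 hk), zero_mul]
  rw [heq]
  refine (hC _ η htail).trans ?_
  rwa [mul_comm]

/-- If `g` is a Bloch function but not in the little Bloch space, then `T_g` acts on the range of
a suitable operator `Φ : ℓ_∞ → H(p,∞,α)` as a small perturbation of an isomorphism. -/
theorem exists_interpolation (hp : p ≠ 0) (hα : 0 < α) (hg : Bloch g) (hng : ¬ LittleBloch g)
    (T : HBig p α →L[ℂ] HBig p α) (hT : ∀ f, (T f).toFun = integralOp g f.toFun) :
    ∃ (Φ : EllInfty →L[ℂ] HBig p α) (L : HBig p α →L[ℂ] EllInfty),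
      (∀ a k, ‖L (T (Φ a)) k - a k‖ ≤ ‖a‖ / 2) ∧
      (∀ F : HBig p α, F.toFun ∈ littleO p α → Tendsto (fun k => L F k) atTop (𝓝 0)) ∧
      (∀ a : EllInfty, Tendsto (fun k => a k) atTop (𝓝 0) → (Φ a).toFun ∈ littleO p α) ∧
      ∀ k, Tendsto (fun n => L (T (Φ (truncOne n))) k) atTop (𝓝 (L (T (Φ constOne)) k)) := by
  obtain ⟨c, hc, hpts⟩ := exists_of_not_littleBloch hg hng
  -- Large enough for both `N ≥ 2/p` and `s > 0`.
  obtain ⟨N, hN'⟩ := exists_nat_ge (α + 2 / p.toReal + 1)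
  set s : ℝ := N - α - 1 / p.toReal with hsdef
  have hPinv : 0 ≤ 1 / p.toReal := by positivity
  have h2P : 2 / p.toReal = 1 / p.toReal + 1 / p.toReal := by ring
  have hs : 0 < s := by rw [hsdef]; linarith
  have hN : 2 / p.toReal ≤ N := by linarith
  have hsN : s + α + 1 / p.toReal = N := by rw [hsdef]; ring
  set σ : ℝ := (2 ^ (N + 3))⁻¹ with hσdef
  have hσ : 0 < σ := by positivity
  have hσN : σ * 2 ^ (N + 3) = 1 := inv_mul_cancel₀ (by positivity)
  have hσ1 : σ < 1 := inv_lt_one_of_one_lt₀ (one_lt_pow₀ one_lt_two (by omega))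
  have hτ : 0 < σ ^ 2 := by positivity
  have hτ1 : σ ^ 2 < 1 := pow_lt_one₀ hσ.le hσ1 two_ne_zero
  obtain ⟨z, hz, hzc⟩ := exists_isLacunary hα hs hτ hτ1 hpts
  obtain ⟨C, hC0, hC⟩ := hz.exists_mixedNorm_testSeries_le hp hα hs hτ hτ1 hN hsN
  have hsum := fun (a : EllInfty) (w : ℂ) =>
    hz.summable (N := N) hs hτ hτ1 (norm_le_of_ellInfty a) w
  -- the operator `Φ`
  let Φ₀ : EllInfty →ₗ[ℂ] HBig p α :=
    { toFun := fun a => Normed.mk (testSeries N s z a)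
        ⟨hz.isHolo_testSeries hs hτ hτ1 (norm_le_of_ellInfty a),
          (hC a ‖a‖ (norm_le_of_ellInfty a)).trans_lt ENNReal.ofReal_lt_top⟩
      map_add' := fun a b => Normed.ext (by
        ext w
        change ∑' k, (a k + b k) * testFun N s (z k) w =
          ∑' k, a k * testFun N s (z k) w + ∑' k, b k * testFun N s (z k) w
        rw [← (hsum a w).tsum_add (hsum b w)]
        exact tsum_congr fun k => add_mul _ _ _)
      map_smul' := fun c a => Normed.ext (by
        ext w
        change ∑' k, (c * a k) * testFun N s (z k) w = c * ∑' k, a k * testFun N s (z k) w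
        rw [← tsum_mul_left]
        exact tsum_congr fun k => mul_assoc _ _ _) }
  have hΦ₀ : ∀ a, (Φ₀ a).toFun = testSeries N s z a := fun a => rfl
  let Φ : EllInfty →L[ℂ] HBig p α := ⟨Φ₀, Normed.continuous_of_bound_codomain Φ₀
    (ENNReal.ofReal C) ENNReal.ofReal_ne_top fun a => by
      rw [hΦ₀, ← ofReal_norm, ← ENNReal.ofReal_mul hC0]
      exact hC a ‖a‖ (norm_le_of_ellInfty a)⟩
  have hΦ : ∀ a, (Φ a).toFun = testSeries N s z a := fun a => rfl
  -- the coefficient functionals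
  obtain ⟨C₁, hC₁, hder⟩ := exists_norm_deriv_le hp hα
  have hball : ∀ k, z k ∈ ball (0 : ℂ) 1 := fun k => by simpa using hz.norm_lt k
  have hdg : ∀ k, deriv g (z k) ≠ 0 := by
    intro k h0
    have := hzc k
    rw [h0, norm_zero, mul_zero] at this
    linarith
  have hF0 : ∀ k, testFun N s (z k) (z k) ≠ 0 := fun k => hz.testFun_self_ne_zero k
  set u : ℕ → ℂ := fun k => deriv g (z k) * testFun N s (z k) (z k) with hu
  have hu0 : ∀ k, u k ≠ 0 := fun k => mul_ne_zero (hdg k) (hF0 k)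
  -- The powers of `1 - |z_k|` match those of the derivative bound exactly, so dividing `F'(z_k)` by
  -- `u k` gives uniformly bounded functionals. This is where `(1 - |z_k|)|g'(z_k)| ≥ c` enters.
  have hulow : ∀ k, c / 2 ^ N ≤ ‖u k‖ * (1 - ‖z k‖) ^ (α + 1 / p.toReal + 1) := by
    intro k
    have hk := hz.one_sub_pos k
    have h1 : ‖1 - (starRingEnd ℂ) (z k) * z k‖ ≤ 2 * (1 - ‖z k‖) := by
      rw [mul_comm, Complex.mul_conj, Complex.normSq_eq_norm_sq, ← Complex.ofReal_one,
        ← Complex.ofReal_sub, Complex.norm_real, Real.norm_of_nonneg] <;>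
      nlinarith [norm_nonneg (z k)]
    have h0 : 0 < ‖1 - (starRingEnd ℂ) (z k) * z k‖ :=
      (one_sub_mul_norm_pos (hz.norm_lt k) (hz.norm_lt k).le).trans_le (one_sub_mul_norm_le _ _)
    have h2 : (1 - ‖z k‖) ^ s * ((2 * (1 - ‖z k‖)) ^ N)⁻¹ ≤ ‖testFun N s (z k) (z k)‖ := by
      rw [norm_testFun (hz.norm_lt k) (hz.norm_lt k)]
      gcongr
    have h3 : (1 - ‖z k‖) ^ s * ((2 * (1 - ‖z k‖)) ^ N)⁻¹ * (1 - ‖z k‖) ^ (α + 1 / p.toReal) =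
        (2 ^ N)⁻¹ := by
      have : (1 - ‖z k‖) ^ s * (1 - ‖z k‖) ^ (α + 1 / p.toReal) = (1 - ‖z k‖) ^ N := by
        rw [← Real.rpow_add hk, ← add_assoc, hsN, Real.rpow_natCast]
      rw [mul_right_comm, this, mul_pow]
      field_simp
    calc c / 2 ^ N = c * (2 ^ N)⁻¹ := div_eq_mul_inv _ _
      _ ≤ ((1 - ‖z k‖) * ‖deriv g (z k)‖) *
          (‖testFun N s (z k) (z k)‖ * (1 - ‖z k‖) ^ (α + 1 / p.toReal)) := by
        rw [← h3]
        gcongr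
        exact hzc k
      _ = _ := by
        rw [hu, norm_mul, Real.rpow_add_one hk.ne']
        ring
  set C₂ : ℝ := C₁ * (2 ^ N / c) with hC₂
  have hC₂0 : 0 < C₂ := by positivity
  have hcoef : ∀ (F : ℂ → ℂ), IsHolo F → ∀ (k : ℕ) (E : ℝ), 0 ≤ E →
      (∀ r ∈ Ico (0 : ℝ) 1, 1 - r ≤ 5 * (1 - ‖z k‖) →
        ENNReal.ofReal ((1 - r) ^ α) * integralMean p r F ≤ ENNReal.ofReal E) →
      ‖deriv F (z k) / u k‖ ≤ C₂ * E := by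
    intro F hF k E hE0 hE
    have h1 := hder F hF (z k) (hz.norm_lt k) E hE0 hE
    have hk := hz.one_sub_pos k
    have h2 := hulow k
    rw [norm_div, div_le_iff₀ (norm_pos_iff.2 (hu0 k))]
    set x := (1 - ‖z k‖) ^ (α + 1 / p.toReal + 1) with hx
    have hx0 : 0 < x := by positivity
    refine le_of_mul_le_mul_right (h1.trans ?_) hx0
    calc C₁ * E = C₂ * E * (c / 2 ^ N) := by rw [hC₂]; field_simp
      _ ≤ C₂ * E * (‖u k‖ * x) := by gcongr
      _ = _ := by ring
  have hcoef' : ∀ (F : HBig p α) (k : ℕ),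
      ‖deriv F.toFun (z k) / u k‖ ≤ C₂ * (mixedNorm p α F.toFun).toReal := fun F k =>
    hcoef _ (isHolo_toFun F) k _ ENNReal.toReal_nonneg fun r hr _ => by
      rw [ENNReal.ofReal_toReal F.toFun_mem.2.ne]
      exact le_mixedNorm p α hr _
  have hdiff : ∀ (F : HBig p α) k, DifferentiableAt ℂ F.toFun (z k) := fun F k =>
    (isHolo_toFun F).1.differentiableAt (isOpen_ball.mem_nhds (hball k))
  let L₀ : HBig p α →ₗ[ℂ] EllInfty :=
    { toFun := fun F => ellInftyMk (fun k => deriv F.toFun (z k) / u k) ⟨_, hcoef' F⟩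
      map_add' := fun F G => by
        ext k
        rw [lp.coeFn_add, Pi.add_apply, ellInftyMk_apply, ellInftyMk_apply, ellInftyMk_apply,
          Normed.toFun_add, deriv_add (hdiff F k) (hdiff G k), add_div]
      map_smul' := fun c F => by
        ext k
        rw [RingHom.id_apply, lp.coeFn_smul, Pi.smul_apply, ellInftyMk_apply, ellInftyMk_apply,
          Normed.toFun_smul, deriv_const_smul c (hdiff F k), smul_eq_mul, smul_eq_mul,
          mul_div_assoc] }
  let L : HBig p α →L[ℂ] EllInfty := ⟨L₀, Normed.continuous_of_bound_domain L₀
    (ENNReal.ofReal C₂) ENNReal.ofReal_ne_top fun F => by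
      rw [← ofReal_norm, ← ENNReal.ofReal_toReal F.toFun_mem.2.ne, ← ENNReal.ofReal_mul hC₂0.le]
      exact ENNReal.ofReal_le_ofReal (lp.norm_le_of_forall_le (by positivity) (hcoef' F))⟩
  have hL : ∀ F k, L F k = deriv F.toFun (z k) / u k := fun F k => rfl
  have hLT : ∀ a k, L (T (Φ a)) k = testSeries N s z a (z k) / testFun N s (z k) (z k) := by
    intro a k
    rw [hL, hT, (hasDerivAt_integralOp (isHolo_toFun (Φ a)) hg.1 (hball k)).deriv, hΦ, hu]
    have := hdg k
    have := hF0 k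
    field_simp
  refine ⟨Φ, L, fun a k => ?_, fun F hF => ?_, fun a ha => ?_, fun k => ?_⟩
  · rw [hLT]
    exact hz.norm_testSeries_sub_le hs hσ hσN hsN (norm_le_of_ellInfty a) k
  -- The coefficient at `z_k` only depends on circles with `1 - r ≤ 5 (1 - |z_k|)`, where the
  -- weighted means of a function in `H(p,0,α)` become small.
  · refine Metric.tendsto_nhds.2 fun ε hε => ?_
    have hE : 0 < ε / (2 * C₂) := by positivity
    have h1 := eventually_forall_annulus
      ((ENNReal.tendsto_nhds_zero.1 hF.2) _ (ENNReal.ofReal_pos.2 hE)) 5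
    have h2 : Tendsto (fun k => ‖z k‖) atTop (𝓝[<] 1) := by
      refine tendsto_nhdsWithin_iff.2 ⟨?_, Eventually.of_forall hz.norm_lt⟩
      have h3 : Tendsto (fun k => (1 - ‖z k‖) ^ s) atTop (𝓝 0) :=
        squeeze_zero (fun k => Real.rpow_nonneg (hz.one_sub_pos k).le _) (hz.pow_le hs)
          (tendsto_pow_atTop_nhds_zero_of_lt_one hτ.le hτ1)
      have h4 : Tendsto (fun k => 1 - ‖z k‖) atTop (𝓝 0) := by
        have h5 := h3.rpow_const (p := 1 / s) (Or.inr (by positivity))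
        rw [Real.zero_rpow (by positivity)] at h5
        refine h5.congr fun k => ?_
        rw [← Real.rpow_mul (hz.one_sub_pos k).le, mul_one_div_cancel hs.ne', Real.rpow_one]
      simpa using h4.const_sub 1
    filter_upwards [h2.eventually h1] with k hk
    rw [dist_zero_right, hL]
    calc _ ≤ C₂ * (ε / (2 * C₂)) := hcoef _ (isHolo_toFun F) k _ hE.le hk
      _ = ε / 2 := by field_simp
      _ < ε := half_lt_self hε
  · rw [hΦ]
    exact hz.testSeries_mem_littleO hp hα hs hτ hτ1 hN hsN ha
  · simp only [hLT]
    refine Tendsto.div_const ?_ _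
    have h1 := (hsum constOne (z k)).hasSum.tendsto_sum_nat
    refine h1.congr fun n => ?_
    rw [testSeries, tsum_eq_sum (s := Finset.range n)]
    · refine Finset.sum_congr rfl fun i hi => ?_
      rw [constOne, truncOne, ellInftyMk_apply, ellInftyMk_apply, if_pos (Finset.mem_range.1 hi)]
    · intro i hi
      rw [truncOne, ellInftyMk_apply, if_neg (by simpa using hi), zero_mul]

end

/-! ### Operators that fix copies of `c₀` and `ℓ_∞` -/

section

variable {p : ℝ≥0∞} {α : ℝ} {f g : ℂ → ℂ}

theorem mixedNorm_sub_le (p : ℝ≥0∞) (α : ℝ) {f g : ℂ → ℂ} (hf : IsHolo f) (hg : IsHolo g) :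
    mixedNorm p α (f - g) ≤ ENNReal.LpAddConst p * (mixedNorm p α f + mixedNorm p α g) := by
  have h := mixedNorm_add_le p α hf (hg.smul (-1))
  rw [mixedNorm_smul] at h
  simpa [sub_eq_add_neg] using h

theorem isEmbedding_inclusion (p : ℝ≥0∞) (α : ℝ) : IsEmbedding (inclusion p α) := by
  refine ⟨isInducing_iff_nhds.2 fun f => ?_, fun f h hfh => Normed.ext ?_⟩
  · ext s
    rw [Normed.mem_nhds_iff (littleO_le_bigO p α), mem_comap]
    constructor
    · rintro ⟨ε, hε, h⟩
      refine ⟨{k | mixedNorm p α (k - inclusion p α f).toFun < ε},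
        (Normed.mem_nhds_iff le_rfl).2 ⟨ε, hε, fun k hk => hk⟩, fun k hk => h k hk⟩
    · rintro ⟨t, ht, hts⟩
      obtain ⟨ε, hε, h⟩ := (Normed.mem_nhds_iff le_rfl).1 ht
      exact ⟨ε, hε, fun k hk => hts (h _ hk)⟩
  · rw [← toFun_inclusion, hfh, toFun_inclusion]

/-- A compact operator is not bounded below on a subspace in which the unit ball contains a
separated sequence. -/
theorem not_fixesCopy_of_isCompactOperator {S : Submodule ℂ (ℂ → ℂ)} (hS : S ≤ bigO p α)
    {X Z : Type*} [AddCommGroup X] [Module ℂ X] [TopologicalSpace X]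
    [NormedAddCommGroup Z] [NormedSpace ℂ Z] {e : ℕ → Z} (he : ∀ n, ‖e n‖ ≤ 1)
    (he' : ∀ m n, m < n → 1 ≤ ‖e n - e m‖) {T : X →L[ℂ] Normed p α S} (hT : IsCompactOperator T) :
    ¬ FixesCopy Z T := by
  rintro ⟨Φ, -, hTΦ⟩
  set A : Z →L[ℂ] Normed p α S := T.comp Φ with hA
  have hAemb : IsEmbedding A := hTΦ
  obtain ⟨Q, hQ, hQ0⟩ : IsCompactOperator A := hT.comp_clm Φ
  obtain ⟨ε, hε, hεQ⟩ := Metric.mem_nhds_iff.1 hQ0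
  set c : ℂ := ((ε / 2 : ℝ) : ℂ) with hc
  have hcn : ‖c‖ = ε / 2 := by
    rw [hc, Complex.norm_real, Real.norm_of_nonneg (by positivity)]
  have hmem : ∀ n, A (c • e n) ∈ Q := fun n => hεQ (by
    rw [mem_ball_zero_iff, norm_smul, hcn]
    nlinarith [he n])
  -- Two images close to a cluster point are close to each other. As `A` is an embedding, their
  -- preimages would be closer than the separation `ε / 2` of the vectors `c • e n`.
  obtain ⟨y, -, hy⟩ := hQ.exists_mapClusterPt (f := atTop) (u := fun n => A (c • e n))
    (le_principal_iff.2 (mem_map.2 (Eventually.of_forall hmem)))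
  have hball : ball (0 : Z) (ε / 2) ∈ 𝓝 (0 : Z) := ball_mem_nhds _ (by positivity)
  rw [hAemb.isInducing.nhds_eq_comap, map_zero, mem_comap] at hball
  obtain ⟨t, ht, htb⟩ := hball
  obtain ⟨η, hη, hηt⟩ := (Normed.mem_nhds_iff hS).1 ht
  set K := ENNReal.LpAddConst p with hK
  have hKt : K ≠ ∞ := (ENNReal.LpAddConst_lt_top p).ne
  obtain ⟨δ', hδ', hδK⟩ := exists_mul_le (M := K + K) (by simp [hKt])
    (ENNReal.half_pos (lt_min hη one_pos).ne')
  set δ := ENNReal.ofReal δ' with hδ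
  have hδ0 : 0 < δ := ENNReal.ofReal_pos.2 hδ'
  have hfreq := mapClusterPt_iff_frequently.1 hy {k | mixedNorm p α (k - y).toFun < δ}
    ((Normed.mem_nhds_iff hS).2 ⟨δ, hδ0, fun k hk => hk⟩)
  obtain ⟨m, hm⟩ := hfreq.exists
  obtain ⟨n, hn, hmn⟩ := (hfreq.and_eventually (eventually_gt_atTop m)).exists
  have hsub : mixedNorm p α (A (c • e n) - A (c • e m)).toFun < η := by
    have h1 : (A (c • e n) - A (c • e m)).toFun =
        (A (c • e n) - y).toFun - (A (c • e m) - y).toFun := by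
      rw [← Normed.toFun_sub, sub_sub_sub_cancel_right]
    rw [h1]
    refine (mixedNorm_sub_le p α (hS (Normed.toFun_mem _)).1 (hS (Normed.toFun_mem _)).1).trans_lt ?_
    calc _ ≤ K * (δ + δ) := by
          gcongr
          · exact le_of_lt hn
          · exact le_of_lt hm
      _ = δ * (K + K) := by ring
      _ ≤ min η 1 / 2 := hδK
      _ < min η 1 := ENNReal.half_lt_self (lt_min hη one_pos).ne'
          ((min_le_right _ _).trans_lt ENNReal.one_lt_top).ne
      _ ≤ η := min_le_left _ _
  have h2 : c • e n - c • e m ∈ ball (0 : Z) (ε / 2) := htb (hηt _ (by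
    rw [sub_zero, map_sub]
    exact hsub))
  rw [mem_ball_zero_iff, ← smul_sub, norm_smul, hcn] at h2
  nlinarith [he' m n hmn]

/-- The scalar `c` shrinks the unit ball into the neighbourhood that `T ∘ Ψ` maps into a weakly
compact set. Limits along a fixed ultrafilter avoid any passage to weakly convergent subsequences.
-/
theorem exists_weak_limit {X Y Z : Type*} [AddCommGroup X] [Module ℂ X] [TopologicalSpace X]
    [AddCommGroup Y] [Module ℂ Y] [TopologicalSpace Y] [NormedAddCommGroup Z] [NormedSpace ℂ Z]
    {T : X →L[ℂ] Y} (hT : IsWeaklyCompactOperator T) (Ψ : Z →L[ℂ] X) {b : ℕ → Z}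
    (hb : ∀ n, ‖b n‖ ≤ 1) :
    ∃ c : ℂ, c ≠ 0 ∧ ∃ y : Y, ∀ φ : Y →L[ℂ] ℂ,
      Tendsto (fun n => c * φ (T (Ψ (b n)))) (hyperfilter ℕ) (𝓝 (φ y)) := by
  obtain ⟨Q, hQ, hQ0⟩ := hT.comp_clm Ψ
  obtain ⟨ε, hε, hεQ⟩ := Metric.mem_nhds_iff.1 hQ0
  set c : ℂ := ((ε / 2 : ℝ) : ℂ) with hc
  have hcn : ‖c‖ = ε / 2 := by
    rw [hc, Complex.norm_real, Real.norm_of_nonneg (by positivity)]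
  have hmem : ∀ n, toWeakSpace ℂ Y (T (Ψ (c • b n))) ∈ Q := fun n => hεQ (by
    rw [mem_ball_zero_iff, norm_smul, hcn]
    nlinarith [hb n])
  obtain ⟨y, -, hy⟩ := hQ.ultrafilter_le_nhds
    ((hyperfilter ℕ).map fun n => toWeakSpace ℂ Y (T (Ψ (c • b n))))
    (le_principal_iff.2 (mem_map.2 (Eventually.of_forall hmem)))
  refine ⟨c, by rw [← norm_pos_iff, hcn]; positivity, (toWeakSpace ℂ Y).symm y, fun φ => ?_⟩
  have hφ : Continuous fun x : WeakSpace ℂ Y => φ ((toWeakSpace ℂ Y).symm x) :=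
    WeakBilin.eval_continuous (topDualPairing ℂ Y).flip φ
  have h1 := (hφ.tendsto y).comp (show Tendsto (fun n => toWeakSpace ℂ Y (T (Ψ (c • b n))))
    (hyperfilter ℕ) (𝓝 y) from hy)
  refine h1.congr fun n => ?_
  simp

/-- The limit of a bounded sequence along an ultrafilter, as a functional on `ℓ_∞`. -/
theorem exists_ultrafilter_limit : ∃ φ : EllInfty →L[ℂ] ℂ,
    ∀ a : EllInfty, Tendsto (fun k => a k) (hyperfilter ℕ) (𝓝 (φ a)) := by
  have hex : ∀ a : EllInfty, ∃ l : ℂ, ‖l‖ ≤ ‖a‖ ∧ Tendsto (fun k => a k) (hyperfilter ℕ) (𝓝 l) := by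
    intro a
    obtain ⟨l, hl, hl2⟩ := (isCompact_closedBall (0 : ℂ) ‖a‖).ultrafilter_le_nhds
      ((hyperfilter ℕ).map fun k => a k) (le_principal_iff.2
        (mem_map.2 (Eventually.of_forall fun k => by simpa using norm_le_of_ellInfty a k)))
    exact ⟨l, by simpa using hl, hl2⟩
  choose φ hφ hφt using hex
  refine ⟨LinearMap.mkContinuous
    { toFun := φ
      map_add' := fun a b => tendsto_nhds_unique (hφt (a + b)) ((hφt a).add (hφt b))
      map_smul' := fun c a => tendsto_nhds_unique (hφt (c • a)) ((hφt a).const_mul c) } 1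
    fun a => by simpa using hφ a, hφt⟩

/-- Evaluation at `k` as a functional on `ℓ_∞`. -/
def ellInftyEval (k : ℕ) : EllInfty →L[ℂ] ℂ :=
  LinearMap.mkContinuous
    { toFun := fun a => a k
      map_add' := fun _ _ => rfl
      map_smul' := fun _ _ => rfl } 1 fun a => by
      rw [one_mul]; exact norm_le_of_ellInfty a k

theorem ellInftyEval_apply (k : ℕ) (a : EllInfty) : ellInftyEval k a = a k := rfl

theorem CZero.norm_apply_le (a : CZero) (k : ℕ) : ‖a k‖ ≤ ‖a‖ := by
  rw [← ZeroAtInftyContinuousMap.norm_toBCF_eq_norm]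
  exact a.toBCF.norm_coe_le_norm k

theorem CZero.norm_le (a : CZero) {C : ℝ} (hC : 0 ≤ C) (h : ∀ k, ‖a k‖ ≤ C) : ‖a‖ ≤ C := by
  rw [← ZeroAtInftyContinuousMap.norm_toBCF_eq_norm]
  exact (BoundedContinuousFunction.norm_le hC).2 h

/-- The inclusion of `c₀` into `ℓ_∞`. -/
def czeroInclusion : CZero →L[ℂ] EllInfty :=
  LinearMap.mkContinuous
    { toFun := fun a => ellInftyMk (fun k => a k) ⟨‖a‖, a.norm_apply_le⟩
      map_add' := fun _ _ => rfl
      map_smul' := fun _ _ => rfl } 1 fun a => by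
        rw [one_mul]
        exact lp.norm_le_of_forall_le (norm_nonneg a) a.norm_apply_le

theorem norm_czeroInclusion (a : CZero) : ‖czeroInclusion a‖ = ‖a‖ :=
  le_antisymm (lp.norm_le_of_forall_le (norm_nonneg a) a.norm_apply_le)
    (a.norm_le (norm_nonneg _) fun k => norm_le_of_ellInfty (czeroInclusion a) k)

theorem isEmbedding_czeroInclusion : IsEmbedding czeroInclusion :=
  (AddMonoidHomClass.isometry_of_norm czeroInclusion norm_czeroInclusion).isEmbedding

/-- A null sequence as an element of `c₀`. -/
def czeroMk (a : ℕ → ℂ) (h : Tendsto a atTop (𝓝 0)) : CZero :=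
  ⟨⟨a, continuous_of_discreteTopology⟩, by
    rw [cocompact_eq_cofinite, Nat.cofinite_eq_atTop]
    exact h⟩

theorem czeroMk_apply (a : ℕ → ℂ) (h : Tendsto a atTop (𝓝 0)) (k : ℕ) : czeroMk a h k = a k := rfl

theorem CZero.tendsto (a : CZero) : Tendsto (fun k => a k) atTop (𝓝 0) := by
  have := a.zero_at_infty'
  rwa [cocompact_eq_cofinite, Nat.cofinite_eq_atTop] at this

/-- The unit vectors of `c₀`. -/
def czeroUnit (n : ℕ) : CZero :=
  czeroMk (fun k => if k = n then 1 else 0) (tendsto_const_nhds.congr' (by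
    filter_upwards [eventually_gt_atTop n] with k hk
    rw [if_neg hk.ne']))

theorem norm_czeroUnit_le (n : ℕ) : ‖czeroUnit n‖ ≤ 1 := by
  refine CZero.norm_le _ zero_le_one fun k => ?_
  rw [czeroUnit, czeroMk_apply]
  split_ifs <;> simp

theorem one_le_norm_czeroUnit_sub {m n : ℕ} (h : m < n) : 1 ≤ ‖czeroUnit n - czeroUnit m‖ := by
  refine le_trans (le_of_eq ?_) (CZero.norm_apply_le _ n)
  rw [ZeroAtInftyContinuousMap.sub_apply, czeroUnit, czeroUnit, czeroMk_apply, czeroMk_apply,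
    if_pos rfl, if_neg h.ne', sub_zero, norm_one]

/-- The partial sums of the unit vectors of `c₀`. -/
def czeroTrunc (n : ℕ) : CZero :=
  czeroMk (fun k => if k < n then 1 else 0) (tendsto_const_nhds.congr' (by
    filter_upwards [eventually_ge_atTop n] with k hk
    rw [if_neg hk.not_gt]))

theorem czeroInclusion_trunc (n : ℕ) : czeroInclusion (czeroTrunc n) = truncOne n := rfl

theorem norm_czeroTrunc_le (n : ℕ) : ‖czeroTrunc n‖ ≤ 1 := by
  refine CZero.norm_le _ zero_le_one fun k => ?_
  rw [czeroTrunc, czeroMk_apply]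
  split_ifs <;> simp

theorem tendsto_truncOne (n : ℕ) : Tendsto (fun k => truncOne n k) atTop (𝓝 0) :=
  (czeroTrunc n).tendsto

/-- An operator `Φ : ℓ_∞ → H(p,∞,α)` that maps null sequences into `H(p,0,α)` restricts to an
operator `c₀ → H(p,0,α)`. -/
theorem exists_restrict (Φ : EllInfty →L[ℂ] HBig p α)
    (hΦ : ∀ a : EllInfty, Tendsto (fun k => a k) atTop (𝓝 0) → (Φ a).toFun ∈ littleO p α) :
    ∃ Φ₀ : CZero →L[ℂ] HLittle p α, ∀ a, inclusion p α (Φ₀ a) = Φ (czeroInclusion a) := by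
  let Ψ : CZero →ₗ[ℂ] HLittle p α :=
    { toFun := fun a => Normed.mk (Φ (czeroInclusion a)).toFun (hΦ _ a.tendsto)
      map_add' := fun a b => Normed.ext (by
        rw [Normed.toFun_mk, map_add, map_add]; rfl)
      map_smul' := fun c a => Normed.ext (by
        rw [Normed.toFun_mk, map_smul, map_smul]; rfl) }
  have h : ∀ a, inclusion p α (Ψ a) = Φ (czeroInclusion a) := fun a => rfl
  refine ⟨⟨Ψ, (isEmbedding_inclusion p α).continuous_iff.2 ?_⟩, h⟩
  exact (Φ.comp czeroInclusion).continuous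

end

end MixedNorm

end

/-! ### The equivalence of the eight conditions -/

open MixedNorm

theorem corollary5p6 (p : ENNReal) (hp : 0 < p) (α : ℝ) (hα : 0 < α) (g : ℂ → ℂ)
    (hg : MixedNorm.Bloch g) :
    ∃ (T : MixedNorm.HBig p α →L[ℂ] MixedNorm.HBig p α)
      (T₀ : MixedNorm.HLittle p α →L[ℂ] MixedNorm.HLittle p α),
      (∀ f, (T f).toFun = MixedNorm.integralOp g f.toFun) ∧
      (∀ f, (T₀ f).toFun = MixedNorm.integralOp g f.toFun) ∧
      List.TFAE [
        IsCompactOperator T,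
        MixedNorm.IsWeaklyCompactOperator T,
        ∃ S : MixedNorm.HBig p α →L[ℂ] MixedNorm.HLittle p α,
          ∀ f, (S f).toFun = MixedNorm.integralOp g f.toFun,
        IsCompactOperator T₀,
        MixedNorm.IsWeaklyCompactOperator T₀,
        ¬ MixedNorm.FixesCopy MixedNorm.EllInfty T,
        ¬ MixedNorm.FixesCopy MixedNorm.CZero T₀,
        MixedNorm.LittleBloch g] := by
  have hp0 : p ≠ 0 := hp.ne'
  obtain ⟨T, hT⟩ := exists_integralOp_clm hp0 hα hg (S := bigO p α) (S' := bigO p α) le_rfl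
    fun f hf => integralOp_mem_bigO hp0 hα hg hf
  obtain ⟨T₀, hT₀⟩ := exists_integralOp_clm hp0 hα hg (S := littleO p α) (S' := littleO p α)
    (littleO_le_bigO p α) fun f hf => integralOp_mem_littleO hp0 hα hg hf
  refine ⟨T, T₀, hT, hT₀, ?_⟩
  have hinc : ∀ f, inclusion p α (T₀ f) = T (inclusion p α f) := fun f => Normed.ext (by
    rw [toFun_inclusion, hT₀, hT, toFun_inclusion])
  have hone : ∀ k (x : ℂ), ‖x - constOne k‖ ≤ ‖constOne‖ / 2 → 1 / 2 ≤ ‖x‖ := by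
    intro k x hx
    have h1 : ‖constOne‖ ≤ 1 := lp.norm_le_of_forall_le zero_le_one fun k => by
      rw [constOne, ellInftyMk_apply, norm_one]
    rw [show constOne k = 1 from rfl] at hx
    have h2 := norm_sub_norm_le (1 : ℂ) x
    rw [norm_one, norm_sub_rev] at h2
    linarith
  -- The common contradiction: a nonzero multiple of a sequence with moduli at least `1/2` cannot
  -- tend to zero. The filter is either `atTop` or an ultrafilter.
  have hnot : ∀ (c : ℂ) (v w : ℕ → ℂ) (l : Filter ℕ) [l.NeBot], c ≠ 0 →
      (∀ k, ‖w k - constOne k‖ ≤ ‖constOne‖ / 2) → (∀ k, v k = c * w k) →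
      ¬ Tendsto v l (𝓝 0) := by
    intro c v w l _ hc hw hv hlim
    have h1 : Tendsto w l (𝓝 0) := by
      have := hlim.const_mul c⁻¹
      rw [mul_zero] at this
      refine this.congr fun k => ?_
      rw [hv, inv_mul_cancel_left₀ hc]
    obtain ⟨k, hk⟩ := ((tendsto_zero_iff_norm_tendsto_zero.1 h1).eventually
      (gt_mem_nhds (show (0 : ℝ) < 1 / 2 by norm_num))).exists
    exact hk.not_ge (hone k _ (hw k))
  -- `‖L T Φ a - a‖ ≤ ‖a‖ / 2` makes `L T Φ` bounded below, hence an embedding, and then so is its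
  -- continuous factor `T Φ`.
  have hembed : ∀ (Φ : EllInfty →L[ℂ] HBig p α) (L : HBig p α →L[ℂ] EllInfty),
      (∀ a k, ‖L (T (Φ a)) k - a k‖ ≤ ‖a‖ / 2) → IsEmbedding fun a => T (Φ a) := by
    intro Φ L hL
    have h1 : AntilipschitzWith 2 (L.comp (T.comp Φ)) := by
      refine AddMonoidHomClass.antilipschitz_of_bound _ fun a => ?_
      have h2 : ‖L (T (Φ a)) - a‖ ≤ ‖a‖ / 2 :=
        lp.norm_le_of_forall_le (by positivity) (hL a)
      have h3 := norm_sub_norm_le a (L (T (Φ a)))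
      rw [norm_sub_rev] at h3
      change ‖a‖ ≤ 2 * ‖L (T (Φ a))‖
      linarith
    have h2 : IsEmbedding (L.comp (T.comp Φ)) :=
      (h1.isUniformEmbedding (L.comp (T.comp Φ)).uniformContinuous).isEmbedding
    exact IsEmbedding.of_comp (T.comp Φ).continuous L.continuous h2
  tfae_have 8 → 1 := fun h =>
    isCompactOperator_of_littleBloch hp0 hα hg h le_rfl T hT
  tfae_have 8 → 3 := fun h => exists_integralOp_clm hp0 hα hg (S := bigO p α)
    (S' := littleO p α) le_rfl fun f hf => integralOp_mem_littleO_of_littleBloch hp0 hα hg h hf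
  tfae_have 8 → 4 := fun h => by
    obtain ⟨S, hS⟩ := exists_integralOp_clm hp0 hα hg (S := bigO p α)
      (S' := littleO p α) le_rfl fun f hf => integralOp_mem_littleO_of_littleBloch hp0 hα hg h hf
    have h1 := (isCompactOperator_of_littleBloch hp0 hα hg h (littleO_le_bigO p α) S hS).comp_clm
      (inclusion p α)
    have h2 : (S ∘ inclusion p α) = T₀ := funext fun f => Normed.ext (by
      rw [Function.comp_apply, hS, toFun_inclusion, hT₀])
    rwa [h2] at h1
  tfae_have 1 → 2 := fun h => h.continuous_comp (toWeakSpaceCLM ℂ (HBig p α)).continuous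
  tfae_have 4 → 5 := fun h => h.continuous_comp (toWeakSpaceCLM ℂ (HLittle p α)).continuous
  tfae_have 1 → 6 := fun h => not_fixesCopy_of_isCompactOperator le_rfl
    (e := fun n => czeroInclusion (czeroUnit n))
    (fun n => (norm_czeroInclusion _).trans_le (norm_czeroUnit_le n))
    (fun m n hmn => by
      rw [← map_sub, norm_czeroInclusion]
      exact one_le_norm_czeroUnit_sub hmn) h
  tfae_have 4 → 7 := fun h => not_fixesCopy_of_isCompactOperator (littleO_le_bigO p α)
    norm_czeroUnit_le (fun m n hmn => one_le_norm_czeroUnit_sub hmn) h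
  tfae_have 2 → 8 := fun h => by
    by_contra hng
    obtain ⟨Φ, L, hL, hL0, hΦ, hlim⟩ := exists_interpolation hp0 hα hg hng T hT
    obtain ⟨c, hc, y, hy⟩ := exists_weak_limit h Φ (b := truncOne) fun n =>
      (norm_czeroInclusion (czeroTrunc n)).trans_le (norm_czeroTrunc_le n)
    obtain ⟨φ, hφ⟩ := exists_ultrafilter_limit
    -- The truncations are null sequences, so their images under `T Φ` lie in `H(p,0,α)`, where `L`
    -- has null values and the ultrafilter limit is 0. Coordinatewise, however, `L y` is `c` times
    -- `L T Φ 1`.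
    have h1 : ∀ n, φ (L (T (Φ (truncOne n)))) = 0 := fun n => by
      refine tendsto_nhds_unique (hφ _) ((hL0 _ ?_).mono_left Nat.hyperfilter_le_atTop)
      rw [hT]
      exact integralOp_mem_littleO hp0 hα hg (hΦ _ (tendsto_truncOne n))
    have h2 : φ (L y) = 0 := by
      refine tendsto_nhds_unique (hy (φ.comp L)) (tendsto_const_nhds.congr fun n => ?_)
      rw [ContinuousLinearMap.comp_apply, h1, mul_zero]
    have h3 := hφ (L y)
    rw [h2] at h3
    refine hnot c _ _ _ hc (hL constOne) (fun k => ?_) h3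
    exact tendsto_nhds_unique (hy ((ellInftyEval k).comp L))
      (((hlim k).const_mul c).mono_left Nat.hyperfilter_le_atTop)
  tfae_have 5 → 8 := fun h => by
    by_contra hng
    obtain ⟨Φ, L, hL, hL0, hΦ, hlim⟩ := exists_interpolation hp0 hα hg hng T hT
    obtain ⟨Φ₀, hΦ₀⟩ := exists_restrict Φ hΦ
    obtain ⟨c, hc, y, hy⟩ := exists_weak_limit h Φ₀ norm_czeroTrunc_le
    -- Here the weak limit `y` is itself in `H(p,0,α)`, so `L y` is a null sequence outright.
    refine hnot c _ _ atTop hc (hL constOne) (fun k => ?_)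
      (hL0 (inclusion p α y) y.toFun_mem)
    refine tendsto_nhds_unique (hy ((ellInftyEval k).comp (L.comp (inclusion p α))))
      ((((hlim k).const_mul c).mono_left Nat.hyperfilter_le_atTop).congr fun n => ?_)
    rw [ContinuousLinearMap.comp_apply, ContinuousLinearMap.comp_apply, hinc, hΦ₀,
      czeroInclusion_trunc, ellInftyEval_apply]
  tfae_have 3 → 8 := fun ⟨S, hS⟩ => by
    by_contra hng
    obtain ⟨Φ, L, hL, hL0, hΦ, hlim⟩ := exists_interpolation hp0 hα hg hng T hT
    refine hnot 1 _ _ atTop one_ne_zero (hL constOne) (fun k => (one_mul _).symm) (hL0 _ ?_)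
    rw [hT, ← hS]
    exact Normed.toFun_mem _
  tfae_have 6 → 8 := fun h => by
    by_contra hng
    obtain ⟨Φ, L, hL, hL0, hΦ, hlim⟩ := exists_interpolation hp0 hα hg hng T hT
    have h1 := hembed Φ L hL
    exact h ⟨Φ, IsEmbedding.of_comp Φ.continuous T.continuous h1, h1⟩
  tfae_have 7 → 8 := fun h => by
    by_contra hng
    obtain ⟨Φ, L, hL, hL0, hΦ, hlim⟩ := exists_interpolation hp0 hα hg hng T hT
    obtain ⟨Φ₀, hΦ₀⟩ := exists_restrict Φ hΦ
    have h1 : IsEmbedding fun a => T₀ (Φ₀ a) := by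
      refine IsEmbedding.of_comp (T₀.comp Φ₀).continuous (inclusion p α).continuous ?_
      have h2 : (inclusion p α ∘ fun a => T₀ (Φ₀ a)) =
          (fun a => T (Φ a)) ∘ czeroInclusion := funext fun a => by
        rw [Function.comp_apply, hinc, hΦ₀, Function.comp_apply]
      rw [h2]
      exact (hembed Φ L hL).comp isEmbedding_czeroInclusion
    exact h ⟨Φ₀, IsEmbedding.of_comp Φ₀.continuous T₀.continuous h1, h1⟩
  tfae_finish
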